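/- **Proposition (Galerkin orthogonality).** Let $d\ge 2$ and let $\Omega\subset\mathbb R^d$ be a polygonal (polyhedral) domain. Let $\widehat\Omega_0,\widehat\Omega_1\subset\Omega$ be polygonal subdomains with $\widehat\Omega_0\cup\widehat\Omega_1=\Omega$, put $\Omega_0=\Omega\setminus\widehat\Omega_1$ (assumed to have nonempty interior), $\Omega_1=\widehat\Omega_1$, $\Gamma=\partial\Omega_1\setminus\partial\Omega$, and let $n$ be the unit normal to $\Gamma$ exterior to $\Omega_1$. For $i=0,1$ let $\widehat{\mathcal K}_{h,i}$ be a finite mesh of $\widehat\Omega_i$ consisting of closed convex polytopes (for example simplices), and let $\Omega_{h,i}$ be the union of the elements $K\in\widehat{\mathcal K}_{h,i}$ with $K\cap\Omega_i\ne\emptyset$. Let $\omega_{h,0}\subset\overline{\Omega_0}$ be a union of such elements of $\widehat{\mathcal K}_{h,0}$. For $i=0,1$ let $\widehat V_{h,i}$ be a linear space of continuous, $\mathbb R^d$-valued piecewise polynomials of degree at most $k$ on $\widehat{\mathcal K}_{h,i}$, and $\widehat Q_{h,i}$ a linear space of (possibly discontinuous) scalar piecewise polynomials of degree at most $l$. Let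 $V_h$ be the space of pairs $v=(v_0,v_1)$ with $v_i\in\widehat V_{h,i}|_{\Omega_{h,i}}$ and $v_i=0$ on $\partial\Omega\cap\Omega_{h,i}$, and let $Q_h$ be the space of pairs $q=(q_0,q_1)$ with $q_i\in\widehat Q_{h,i}|_{\Omega_{h,i}}$. On $\Gamma$ write $[v]=v_1-v_0$ and $\langle v\rangle=(v_0+v_1)/2$, where $v_i$ is the trace from $\Omega_i$; in integrals over $\Omega_i$ and over $\Omega_{h,i}$ the component with index $i$ is used. A function on $\Omega$ is identified with the pair having both components equal to it. For $h>0$ and $\beta>0$ define $$A_h((u,p),(v,q))=a_h(u,v)+b_h(u,q)+b_h(v,p)+d_h((u,p),(v,q)),$$ $$a_h(u,v)=\sum_{i=0}^1(Du,Dv)_{\Omega_i}-(\langle (Du)\cdot n\rangle,[v])_\Gamma-([u],\langle (Dv)\cdot n\rangle)_\Gamma+\beta h^{-1}([u],[v])_\Gamma+([Du],[Dv])_{\Omega_{h,0}\cap\Omega_1},$$ $$b_h(u,q)=-\sum_{i=0}^1(\operatorname{div}u,q)_{\Omega_i}+([n\cdot u],\langle q\rangle)_\Gamma,$$ $$d_h((u,p),(v,q))=h^2(\Delta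 u_0-\nabla p_0,\Delta v_0+\nabla q_0)_{\Omega_{h,0}\setminus\omega_{h,0}},$$ $$l_h(v,q)=\sum_{i=0}^1(f,v_i)_{\Omega_i}-h^2(f,\Delta v_0+\nabla q_0)_{\Omega_{h,0}\setminus\omega_{h,0}},$$ where the derivatives in $d_h$ and in the second term of $l_h$ are taken element by element. Let $f\in[L^2(\Omega)]^d$ and let $(u,p)\in V\times Q=[H^1_0(\Omega)]^d\times\{q\in L^2(\Omega):\int_\Omega q\,dx=0\}$ be a weak solution of the Stokes problem: $$(Du,Dv)_\Omega-(\operatorname{div}u,q)_\Omega-(\operatorname{div}v,p)_\Omega=(f,v)_\Omega\qquad\text{for all }(v,q)\in V\times Q.$$ Assume that the averages of the traces $\langle (Du)\cdot n\rangle$ and $\langle p\rangle$ on $\Gamma$ are square integrable over $\Gamma$, so that the interface terms of $A_h((u,p),\cdot)$ are defined (this holds, for instance, if $u\in[H^2(\Omega)]^d$ and $p\in H^1(\Omega)$). Let $(u_h,p_h)\in V_h\times Q_h$ satisfy $$A_h((u_h,p_h),(v,q))=l_h(v,q)\qquad\text{for all }(v,q)\in V_h\times Q_h.$$ Then $$A_h((u,p)-(u_h,p_h),(v_h,q_h))=0\qquad\text{for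 all }(v_h,q_h)\in V_h\times Q_h.$$ -/

import Mathlib

open MeasureTheory Set Filter Topology
open scoped ContDiff

noncomputable section

namespace CutStokes

/-- `ℝᵈ` with the Euclidean norm. -/
abbrev E (d : ℕ) := EuclideanSpace ℝ (Fin d)

/-! ### Weak derivatives and Sobolev spaces -/

/-- The classical partial derivative `∂ⱼ φ`. -/
def partialDeriv {d : ℕ} (j : Fin d) (φ : E d → ℝ) (x : E d) : ℝ :=
  fderiv ℝ φ x (EuclideanSpace.single j 1)

/-- `φ ∈ C_c^∞(U)`. -/
def IsTestFunction {d : ℕ} (U : Set (E d)) (φ : E d → ℝ) : Prop :=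
  ContDiff ℝ ∞ φ ∧ HasCompactSupport φ ∧ tsupport φ ⊆ U

/-- `g` is the weak partial derivative `∂ⱼ w` on the open set `U` (both locally integrable). -/
def IsWeakDeriv {d : ℕ} (U : Set (E d)) (j : Fin d) (w g : E d → ℝ) : Prop :=
  LocallyIntegrableOn w U volume ∧ LocallyIntegrableOn g U volume ∧
    ∀ φ, IsTestFunction U φ →
      ∫ x in U, w x * partialDeriv j φ x = - ∫ x in U, g x * φ x

open Classical in
/-- A representative of the weak derivative `∂ⱼ w` on `U`, unique up to null sets of `U`
(`0` if there is no weak derivative). -/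
def weakDeriv {d : ℕ} (U : Set (E d)) (j : Fin d) (w : E d → ℝ) : E d → ℝ :=
  if h : ∃ g, IsWeakDeriv U j w g then Classical.choose h else 0

/-- `w ∈ L²(U)`. -/
def MemL2 {d : ℕ} (U : Set (E d)) (w : E d → ℝ) : Prop :=
  MemLp w 2 (volume.restrict U)

/-- `w ∈ H¹(U)`. -/
def MemH1 {d : ℕ} (U : Set (E d)) (w : E d → ℝ) : Prop :=
  MemL2 U w ∧ ∀ j, ∃ g, MemL2 U g ∧ IsWeakDeriv U j w g

/-- `w ∈ H¹₀(U)`: `w ∈ H¹(U)` is the limit in `H¹(U)` of a sequence in `C_c^∞(U)`. -/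
def MemH10 {d : ℕ} (U : Set (E d)) (w : E d → ℝ) : Prop :=
  MemH1 U w ∧ ∃ φ : ℕ → E d → ℝ, (∀ n, IsTestFunction U (φ n)) ∧
    Tendsto (fun n => eLpNorm (fun x => w x - φ n x) 2 (volume.restrict U)) atTop (𝓝 0) ∧
    ∀ j, Tendsto (fun n => eLpNorm (fun x => weakDeriv U j w x - partialDeriv j (φ n) x) 2
      (volume.restrict U)) atTop (𝓝 0)

/-! ### The weak Stokes problem -/

/-- The velocity space `[H¹₀(Ω)]ᵈ`. -/
def MemV {d : ℕ} (Ω : Set (E d)) (v : E d → E d) : Prop :=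
  ∀ k, MemH10 Ω (fun x => v x k)

/-- The pressure space of square integrable functions with mean zero. -/
def MemQ {d : ℕ} (Ω : Set (E d)) (q : E d → ℝ) : Prop :=
  MemL2 Ω q ∧ ∫ x in Ω, q x = 0

/-- `a(u,v) = (Du, Dv)_Ω`. -/
def formA {d : ℕ} (Ω : Set (E d)) (u v : E d → E d) : ℝ :=
  ∫ x in Ω, ∑ k, ∑ j, weakDeriv Ω j (fun y => u y k) x * weakDeriv Ω j (fun y => v y k) x

/-- `b(v,q) = -(div v, q)_Ω`. -/
def formB {d : ℕ} (Ω : Set (E d)) (v : E d → E d) (q : E d → ℝ) : ℝ :=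
  - ∫ x in Ω, (∑ k, weakDeriv Ω k (fun y => v y k) x) * q x

/-- `(u,p) ∈ V × Q` and `a(u,v) + b(u,q) + b(v,p) = (f,v)_Ω` for all `(v,q) ∈ V × Q`. -/
def IsWeakStokesSolution {d : ℕ} (Ω : Set (E d)) (f u : E d → E d) (p : E d → ℝ) : Prop :=
  MemV Ω u ∧ MemQ Ω p ∧
    ∀ (v : E d → E d) (q : E d → ℝ), MemV Ω v → MemQ Ω q →
      formA Ω u v + formB Ω u q + formB Ω v p = ∫ x in Ω, ∑ k, f x k * v x k

/-! ### Polyhedral domains, meshes and composite meshes -/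

/-- A closed convex polytope with nonempty interior (for example a nondegenerate simplex). -/
def IsPolytope {d : ℕ} (K : Set (E d)) : Prop :=
  (∃ s : Finset (E d), K = convexHull ℝ (s : Set (E d))) ∧ (interior K).Nonempty

/-- A polygonal (polyhedral) domain: open, connected and nonempty, lying locally on one side of
its boundary (no slits), whose closure is a finite union of polytopes. -/
def IsPolyhedralDomain {d : ℕ} (U : Set (E d)) : Prop :=
  IsOpen U ∧ IsConnected U ∧ interior (closure U) = U ∧
    ∃ F : Finset (Set (E d)), (∀ K ∈ F, IsPolytope K) ∧ closure U = ⋃ K ∈ F, K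

/-- A mesh of `U`: finitely many closed polytopes with pairwise disjoint interiors that cover
exactly the closure of `U`. -/
def IsMesh {d : ℕ} (U : Set (E d)) (T : Finset (Set (E d))) : Prop :=
  (∀ K ∈ T, IsPolytope K) ∧
    (∀ K ∈ T, ∀ L ∈ T, K ≠ L → Disjoint (interior K) (interior L)) ∧
    closure U = ⋃ K ∈ T, K

/-- Two overlapping meshed predomains of `Ω`; the domain with index `1` lies on top. The
finset `core` lists the elements whose union is the set `ω_{h,0}`. -/
structure CompositeMesh (d : ℕ) where
  Ω : Set (E d)
  pre : Fin 2 → Set (E d)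
  mesh : Fin 2 → Finset (Set (E d))
  core : Finset (Set (E d))
  isPolyhedralDomain : IsPolyhedralDomain Ω
  isPolyhedralDomain_pre : ∀ i, IsPolyhedralDomain (pre i)
  pre_union : pre 0 ∪ pre 1 = Ω
  interior_nonempty : (interior (Ω \ pre 1)).Nonempty
  isMesh : ∀ i, IsMesh (pre i) (mesh i)
  core_mem : ∀ K ∈ core, K ∈ mesh 0 ∧ (K ∩ (Ω \ pre 1)).Nonempty
  core_subset : ∀ K ∈ core, K ⊆ closure (Ω \ pre 1)

namespace CompositeMesh

variable {d : ℕ} (M : CompositeMesh d)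

/-- The parts `Ω₀ = Ω \ Ω̂₁` and `Ω₁ = Ω̂₁` of `Ω`. -/
def part (i : Fin 2) : Set (E d) := ![M.Ω \ M.pre 1, M.pre 1] i

/-- The interface `Γ = ∂Ω₁ \ ∂Ω`. -/
def Γ : Set (E d) := frontier (M.part 1) \ frontier M.Ω

/-- The elements of the `i`-th mesh that meet `Ωᵢ`. -/
def submesh (i : Fin 2) : Set (Set (E d)) := {K | K ∈ M.mesh i ∧ (K ∩ M.part i).Nonempty}

/-- `Ω_{h,i}`, the union of these elements. -/
def Ωh (i : Fin 2) : Set (E d) := ⋃ K ∈ M.submesh i, K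

/-- `ω_{h,0}`. -/
def coreSet : Set (E d) := ⋃ K ∈ M.core, K

/-- The surface measure on `Γ`. -/
def surf : Measure (E d) := (Measure.euclideanHausdorffMeasure (d - 1)).restrict M.Γ

end CompositeMesh

/-! ### Discrete spaces -/

/-- On `K` the function `w` coincides with a polynomial of total degree at most `k`. -/
def IsPolyOn {d : ℕ} (K : Set (E d)) (k : ℕ) (w : E d → ℝ) : Prop :=
  ∃ P : MvPolynomial (Fin d) ℝ, P.totalDegree ≤ k ∧
    ∀ x ∈ K, w x = MvPolynomial.eval (fun i => x i) P

/-- Finite element spaces on the two predomains: linear spaces of continuous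
piecewise polynomial velocities of degree at most `k` and of (possibly discontinuous) piecewise
polynomial pressures of degree at most `l`. No boundary condition is imposed here. Only the values
on the closure of the `i`-th predomain matter. -/
structure FESpaces {d : ℕ} (M : CompositeMesh d) where
  k : ℕ
  l : ℕ
  V : Fin 2 → Submodule ℝ (E d → E d)
  Q : Fin 2 → Submodule ℝ (E d → ℝ)
  continuousOn_V : ∀ i, ∀ v ∈ V i, ContinuousOn v (closure (M.pre i))
  poly_V : ∀ i, ∀ v ∈ V i, ∀ K ∈ M.mesh i, ∀ c, IsPolyOn K k (fun x => v x c)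
  poly_Q : ∀ i, ∀ q ∈ Q i, ∀ K ∈ M.mesh i, IsPolyOn (interior K) l q

/-- The discrete velocity space: pairs `(v₀, v₁)` of restrictions of functions of the two
velocity spaces to `Ω_{h,0}` and `Ω_{h,1}` (extended by `0`) that vanish on `∂Ω`. -/
def FESpaces.Vh {d : ℕ} {M : CompositeMesh d} (S : FESpaces M) : Set (Fin 2 → E d → E d) :=
  {v | ∀ i, (∃ w ∈ S.V i, v i = (M.Ωh i).indicator w) ∧
    ∀ x ∈ M.Ωh i ∩ frontier M.Ω, v i x = 0}

/-- The discrete pressure space: pairs `(q₀, q₁)` of restrictions of functions of the two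
pressure spaces to `Ω_{h,0}` and `Ω_{h,1}` (extended by `0`). -/
def FESpaces.Qh {d : ℕ} {M : CompositeMesh d} (S : FESpaces M) : Set (Fin 2 → E d → ℝ) :=
  {q | ∀ i, ∃ w ∈ S.Q i, q i = (M.Ωh i).indicator w}

/-! ### Traces, normals, and elementwise derivatives -/

/-- The one-sided trace at `x` of a function on `A`, as the limit of its averages over
`A ∩ B(x,r)` as `r → 0`. For `w ∈ H¹(A)` this is the Sobolev trace at almost every point of a
flat piece of the boundary; for a function that is continuous up to the boundary near `x` it is
the boundary value. -/
def trace {d : ℕ} (A : Set (E d)) (w : E d → ℝ) (x : E d) : ℝ :=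
  limUnder (𝓝[>] (0 : ℝ)) (fun r => ⨍ y in Metric.ball x r ∩ A, w y)

/-- Near its boundary point `x` the set `A` is a half space with exterior unit normal `ν`. -/
def IsExteriorNormal {d : ℕ} (A : Set (E d)) (x ν : E d) : Prop :=
  ‖ν‖ = 1 ∧ ∀ᶠ y in 𝓝 x, (inner ℝ (y - x) ν < 0 → y ∈ A) ∧ (0 < inner ℝ (y - x) ν → y ∉ A)

open Classical in
/-- The exterior unit normal, defined at almost every boundary point of a polyhedral domain. -/
def exteriorNormal {d : ℕ} (A : Set (E d)) (x : E d) : E d :=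
  if h : ∃ ν, IsExteriorNormal A x ν then Classical.choose h else 0

/-- The elementwise weak derivative `∂ⱼ w`. -/
def brokenDeriv {d : ℕ} (T : Finset (Set (E d))) (j : Fin d) (w : E d → ℝ) (x : E d) : ℝ :=
  ∑ K ∈ T, (interior K).indicator (weakDeriv (interior K) j w) x

/-- The elementwise weak Laplacian. -/
def brokenLaplacian {d : ℕ} (T : Finset (Set (E d))) (w : E d → ℝ) (x : E d) : ℝ :=
  ∑ K ∈ T, (interior K).indicator
    (fun y => ∑ j, weakDeriv (interior K) j (weakDeriv (interior K) j w) y) x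

/-! ### The discrete forms

Arguments are pairs `u = (u₀, u₁)`, with `uᵢ` a function on `Ω_{h,i}`; a function `u` on `Ω` is
identified with the pair `(u, u)`. -/

namespace CompositeMesh

variable {d : ℕ} (M : CompositeMesh d)

/-- The entry `∂ⱼ (uᵢ)ₖ` of the gradient `D uᵢ` on `Ω_{h,i}`. -/
def D (i : Fin 2) (u : Fin 2 → E d → E d) (k j : Fin d) : E d → ℝ :=
  weakDeriv (interior (M.Ωh i)) j (fun y => u i y k)

/-- The divergence of `uᵢ`. -/
def divergence (i : Fin 2) (u : Fin 2 → E d → E d) (x : E d) : ℝ := ∑ k, M.D i u k k x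

/-- The unit normal `n` on `Γ` exterior to `Ω₁`. -/
def n (x : E d) : E d := exteriorNormal (M.part 1) x

/-- The component `[uₖ] = (u₁)ₖ - (u₀)ₖ` of the jump on `Γ`. -/
def jump (u : Fin 2 → E d → E d) (k : Fin d) (x : E d) : ℝ :=
  trace (M.part 1) (fun y => u 1 y k) x - trace (M.part 0) (fun y => u 0 y k) x

/-- The component `⟨(Du) · n⟩ₖ` of the average normal derivative on `Γ`. -/
def avgNormalDeriv (u : Fin 2 → E d → E d) (k : Fin d) (x : E d) : ℝ :=
  ((∑ j, trace (M.part 0) (M.D 0 u k j) x * M.n x j) +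
    (∑ j, trace (M.part 1) (M.D 1 u k j) x * M.n x j)) / 2

/-- The average `⟨q⟩` on `Γ`. -/
def avg (q : Fin 2 → E d → ℝ) (x : E d) : ℝ :=
  (trace (M.part 0) (q 0) x + trace (M.part 1) (q 1) x) / 2

/-- The Nitsche form `a_{h,N}`. -/
def ahN (h β : ℝ) (u v : Fin 2 → E d → E d) : ℝ :=
  (∑ i, ∫ x in M.part i, ∑ k, ∑ j, M.D i u k j x * M.D i v k j x)
    - (∫ x, ∑ k, M.avgNormalDeriv u k x * M.jump v k x ∂M.surf)
    - (∫ x, ∑ k, M.jump u k x * M.avgNormalDeriv v k x ∂M.surf)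
    + β * h⁻¹ * ∫ x, ∑ k, M.jump u k x * M.jump v k x ∂M.surf

/-- The overlap stabilization `a_{h,O}`. -/
def ahO (u v : Fin 2 → E d → E d) : ℝ :=
  ∫ x in M.Ωh 0 ∩ M.part 1, ∑ k, ∑ j,
    (M.D 1 u k j x - M.D 0 u k j x) * (M.D 1 v k j x - M.D 0 v k j x)

/-- `a_h`. -/
def ah (h β : ℝ) (u v : Fin 2 → E d → E d) : ℝ := M.ahN h β u v + M.ahO u v

/-- `b_h`. -/
def bh (u : Fin 2 → E d → E d) (q : Fin 2 → E d → ℝ) : ℝ :=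
  - (∑ i, ∫ x in M.part i, M.divergence i u x * q i x)
    + ∫ x, (∑ k, M.n x k * M.jump u k x) * M.avg q x ∂M.surf

/-- The least-squares form `d_h`; the second-order derivatives and the pressure gradients are
taken elementwise. -/
def dh (h : ℝ) (u : Fin 2 → E d → E d) (p : Fin 2 → E d → ℝ)
    (v : Fin 2 → E d → E d) (q : Fin 2 → E d → ℝ) : ℝ :=
  h ^ 2 * ∫ x in M.Ωh 0 \ M.coreSet, ∑ k,
    (brokenLaplacian (M.mesh 0) (fun y => u 0 y k) x - brokenDeriv (M.mesh 0) k (p 0) x) *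
    (brokenLaplacian (M.mesh 0) (fun y => v 0 y k) x + brokenDeriv (M.mesh 0) k (q 0) x)

/-- `A_h((u,p),(v,q))`. -/
def Ah (h β : ℝ) (u : Fin 2 → E d → E d) (p : Fin 2 → E d → ℝ)
    (v : Fin 2 → E d → E d) (q : Fin 2 → E d → ℝ) : ℝ :=
  M.ah h β u v + M.bh u q + M.bh v p + M.dh h u p v q

/-- The right-hand side `l_h`. -/
def lh (h : ℝ) (f : E d → E d) (v : Fin 2 → E d → E d) (q : Fin 2 → E d → ℝ) : ℝ :=
  (∑ i, ∫ x in M.part i, ∑ k, f x k * v i x k)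
    - h ^ 2 * ∫ x in M.Ωh 0 \ M.coreSet, ∑ k, f x k *
      (brokenLaplacian (M.mesh 0) (fun y => v 0 y k) x + brokenDeriv (M.mesh 0) k (q 0) x)

end CompositeMesh

/-- `(u_h,p_h) ∈ V_h × Q_h` solves the finite element problem. -/
def IsDiscreteSolution {d : ℕ} {M : CompositeMesh d} (S : FESpaces M) (h β : ℝ)
    (f : E d → E d) (uh : Fin 2 → E d → E d) (ph : Fin 2 → E d → ℝ) : Prop :=
  uh ∈ S.Vh ∧ ph ∈ S.Qh ∧
    ∀ v ∈ S.Vh, ∀ q ∈ S.Qh, M.Ah h β uh ph v q = M.lh h f v q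

end CutStokes

end

noncomputable section

namespace CutStokes

/-! ### Calculus of test functions -/

section Test

variable {d : ℕ} {U V : Set (E d)} {φ ψ θ : E d → ℝ}

/-! The form is linear in its first pair, so by the discrete equation everything reduces to
consistency: the exact solution satisfies A_h((u,p),(v,q)) = l_h(v,q) for all discrete (v,q).
Consistency is integration by parts of -Δu + ∇p = f over the two parts of Ω. The jump of u on Γ
vanishes, both copies of Du agree on the overlap, div u = 0, and the elementwise residual Δu - ∇p
equals -f; what remains is Green's formula, whose term on Γ pairs the jump of v with the normal
stress.

The difficulty is that (u,p) is only a weak solution on a polyhedral domain, so nothing beyond H¹ ×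
L² is known up to ∂Ω. In the interior, `stokes_regularity` gives H² × H¹ locally: the vorticity
solves a Poisson equation with right-hand side in divergence form and is therefore locally H¹; since
div u = 0, its derivatives yield Δu in L² locally; then each ∂ₖuₗ solves a Poisson equation of the
same kind. Hence Du and p are local Sobolev functions and have equal traces from both sides of Γ
(`Adapted.ae_exists_hasTrace`). Traces are limits of averages over half balls, and they are
controlled by smooth approximations that converge uniformly along almost every normal line
(`RapidApprox.ae_average_above`).

All element boundaries lie in finitely many hyperplanes, and off these the discrete functions are
smooth with finitely many branches. For such functions `integral_gaussGreen` expresses the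
distributional derivative through the jumps, and `Adapted.integral_green` pairs them with a local
Sobolev function, provided that the support is compact in Ω. A discrete velocity vanishes on ∂Ω but
need not have compact support in Ω, so its small values are truncated first. Removing the truncation
uses only that Du, p and f are square integrable and that the normal stress is integrable on Γ; this
gives `Adapted.integral_green_V`, and `Adapted.consistency` collects the terms.

Linearity (`Adapted.Ah_sub`) is not automatic: traces, chosen weak derivatives and integrals are
additive only where they exist. `Admissible` records what is needed and is verified for exact and
for discrete pairs. -/

theorem _root_.ContDiff.partialDeriv (hφ : ContDiff ℝ ∞ φ) (j : Fin d) :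
    ContDiff ℝ ∞ (partialDeriv j φ) :=
  (hφ.fderiv_right (m := ∞) (by simp)).clm_apply contDiff_const

theorem _root_.ContDiff.differentiable_infty (hφ : ContDiff ℝ ∞ φ) : Differentiable ℝ φ :=
  hφ.differentiable (by simp)

theorem tsupport_partialDeriv_subset (j : Fin d) (φ : E d → ℝ) :
    tsupport (partialDeriv j φ) ⊆ tsupport φ :=
  tsupport_fderiv_apply_subset ℝ _

theorem IsTestFunction.partialDeriv (hφ : IsTestFunction U φ) (j : Fin d) :
    IsTestFunction U (partialDeriv j φ) :=
  ⟨hφ.1.partialDeriv j, hφ.2.1.mono' ((subset_tsupport _).trans (tsupport_partialDeriv_subset j φ)),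
    (tsupport_partialDeriv_subset j φ).trans hφ.2.2⟩

theorem IsTestFunction.mono (hφ : IsTestFunction U φ) (h : U ⊆ V) : IsTestFunction V φ :=
  ⟨hφ.1, hφ.2.1, hφ.2.2.trans h⟩

theorem IsTestFunction.mul_right (hθ : IsTestFunction U θ) (hφ : ContDiff ℝ ∞ φ) :
    IsTestFunction U (fun x => θ x * φ x) :=
  ⟨hθ.1.mul hφ, hθ.2.1.mul_right, (tsupport_mul_subset_left).trans hθ.2.2⟩

theorem isTestFunction_zero : IsTestFunction U (fun _ => (0 : ℝ)) :=
  ⟨contDiff_const, by simpa using! HasCompactSupport.zero, by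
    rw [show (fun _ : E d => (0 : ℝ)) = 0 from rfl]; simp [tsupport]⟩

theorem IsTestFunction.continuous (hφ : IsTestFunction U φ) : Continuous φ := hφ.1.continuous

theorem IsTestFunction.eq_zero (hφ : IsTestFunction U φ) {x : E d} (hx : x ∉ U) : φ x = 0 :=
  image_eq_zero_of_notMem_tsupport fun h => hx (hφ.2.2 h)

theorem IsTestFunction.memLp (hφ : IsTestFunction U φ) (p : ENNReal) (μ : Measure (E d))
    [IsFiniteMeasureOnCompacts μ] : MemLp φ p μ :=
  hφ.continuous.memLp_of_hasCompactSupport hφ.2.1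

theorem partialDeriv_mul (hθ : Differentiable ℝ θ) (hφ : Differentiable ℝ φ) (j : Fin d) (x : E d) :
    partialDeriv j (fun x => θ x * φ x) x = θ x * partialDeriv j φ x + partialDeriv j θ x * φ x := by
  simp only [CutStokes.partialDeriv]
  rw [fderiv_fun_mul (hθ x) (hφ x)]
  simp [mul_comm]

theorem partialDeriv_add (hθ : Differentiable ℝ θ) (hφ : Differentiable ℝ φ) (j : Fin d) (x : E d) :
    partialDeriv j (fun x => θ x + φ x) x = partialDeriv j θ x + partialDeriv j φ x := by
  simp only [CutStokes.partialDeriv]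
  rw [fderiv_fun_add (hθ x) (hφ x)]
  simp

theorem partialDeriv_sub (hθ : Differentiable ℝ θ) (hφ : Differentiable ℝ φ) (j : Fin d) (x : E d) :
    partialDeriv j (fun x => θ x - φ x) x = partialDeriv j θ x - partialDeriv j φ x := by
  simp only [CutStokes.partialDeriv]
  rw [fderiv_fun_sub (hθ x) (hφ x)]
  simp

theorem partialDeriv_comm (hφ : ContDiff ℝ ∞ φ) (i j : Fin d) :
    partialDeriv i (partialDeriv j φ) = partialDeriv j (partialDeriv i φ) := by
  have hd : Differentiable ℝ (fderiv ℝ φ) :=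
    (hφ.fderiv_right (m := ∞) (by simp)).differentiable (by simp)
  have key : ∀ i j : Fin d, ∀ x, partialDeriv i (partialDeriv j φ) x
      = fderiv ℝ (fderiv ℝ φ) x (EuclideanSpace.single i 1) (EuclideanSpace.single j 1) := by
    intro i j x
    have : partialDeriv j φ = fun y => fderiv ℝ φ y (EuclideanSpace.single j 1) := rfl
    rw [this, CutStokes.partialDeriv, fderiv_clm_apply (hd x) (differentiableAt_const _)]
    simp
  ext x
  rw [key, key]
  have := (hφ.contDiffAt (x := x)).isSymmSndFDerivAt (by simp; norm_cast)
  exact this _ _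

/-- The Laplacian of a smooth function. -/
def lap (φ : E d → ℝ) (x : E d) : ℝ := ∑ j, partialDeriv j (partialDeriv j φ) x

theorem _root_.ContDiff.lap (hφ : ContDiff ℝ ∞ φ) : ContDiff ℝ ∞ (lap φ) := by
  unfold CutStokes.lap
  exact ContDiff.sum fun j _ => (hφ.partialDeriv j).partialDeriv j

theorem lap_eq_zero_of_notMem_tsupport {x : E d} (hx : x ∉ tsupport φ) : lap φ x = 0 := by
  refine Finset.sum_eq_zero fun j _ => image_eq_zero_of_notMem_tsupport fun h => hx ?_
  exact tsupport_partialDeriv_subset j φ (tsupport_partialDeriv_subset j _ h)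

theorem IsTestFunction.lap (hφ : IsTestFunction U φ) : IsTestFunction U (lap φ) := by
  have h : tsupport (CutStokes.lap φ) ⊆ tsupport φ :=
    closure_minimal (fun x hx => by
      by_contra h
      exact hx (lap_eq_zero_of_notMem_tsupport h)) (isClosed_tsupport φ)
  exact ⟨hφ.1.lap, hφ.2.1.mono' ((subset_tsupport _).trans h), h.trans hφ.2.2⟩

theorem lap_mul (hθ : ContDiff ℝ ∞ θ) (hφ : ContDiff ℝ ∞ φ) (x : E d) :
    lap (fun x => θ x * φ x) x = θ x * lap φ x
      + 2 * ∑ j, partialDeriv j θ x * partialDeriv j φ x + lap θ x * φ x := by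
  simp only [lap, Finset.mul_sum, Finset.sum_mul, ← Finset.sum_add_distrib]
  refine Finset.sum_congr rfl fun j _ => ?_
  have h : partialDeriv j (fun x => θ x * φ x)
      = fun x => θ x * partialDeriv j φ x + partialDeriv j θ x * φ x := by
    ext y; exact partialDeriv_mul hθ.differentiable_infty hφ.differentiable_infty j y
  rw [h, partialDeriv_add (hθ.mul (hφ.partialDeriv j)).differentiable_infty
    ((hθ.partialDeriv j).mul hφ).differentiable_infty,
    partialDeriv_mul hθ.differentiable_infty (hφ.partialDeriv j).differentiable_infty,
    partialDeriv_mul (hθ.partialDeriv j).differentiable_infty hφ.differentiable_infty]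
  ring

theorem integral_mul_partialDeriv (hθ : ContDiff ℝ ∞ θ) (hφ : IsTestFunction U φ) (j : Fin d) :
    ∫ x, θ x * partialDeriv j φ x = - ∫ x, partialDeriv j θ x * φ x := by
  have hφ' := hφ.partialDeriv j
  refine integral_mul_fderiv_eq_neg_fderiv_mul_of_integrable ?_ ?_ ?_
    (fun x _ => hθ.differentiable_infty x) (fun x _ => hφ.1.differentiable_infty x)
  · exact ((hθ.partialDeriv j).continuous.mul hφ.continuous).integrable_of_hasCompactSupport
      hφ.2.1.mul_left
  · exact (hθ.continuous.mul hφ'.continuous).integrable_of_hasCompactSupport hφ'.2.1.mul_left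
  · exact (hθ.continuous.mul hφ.continuous).integrable_of_hasCompactSupport hφ.2.1.mul_left

/-- Having θ = 1 on a neighbourhood of K, and not only on K, lets θw replace w near K together with
all derivatives and traces. -/
theorem exists_isTestFunction_eq_one {K : Set (E d)} (hK : IsCompact K) (hU : IsOpen U)
    (hKU : K ⊆ U) : ∃ θ, IsTestFunction U θ ∧ (∀ᶠ x in 𝓝ˢ K, θ x = 1) ∧ (∀ x, θ x ∈ Icc (0 : ℝ) 1) := by
  -- θ takes the value 1 on L, a neighbourhood of K; the second compact set L' bounds its support.
  obtain ⟨L, hL, hKL, hLU⟩ := exists_compact_between hK hU hKU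
  obtain ⟨L', hL', hLL', hLU'⟩ := exists_compact_between hL hU hLU
  obtain ⟨f, hf, hf0, hf1, hf2⟩ := exists_contMDiff_zero_iff_one_iff_of_isClosed
    (modelWithCornersSelf ℝ (E d)) (n := ⊤) (s := (interior L')ᶜ) (t := L) isOpen_interior.isClosed_compl hL.isClosed
    (by rw [disjoint_compl_left_iff_subset]; exact hLL')
  refine ⟨f, ⟨hf.contDiff, ?_, ?_⟩, ?_, fun x => hf0 ⟨x, rfl⟩⟩
  · refine HasCompactSupport.intro hL' fun x hx => (hf1 x).1 fun h => hx (interior_subset h)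
  · refine (closure_minimal (fun x hx => ?_) hL'.isClosed).trans hLU'
    by_contra h
    exact hx ((hf1 x).1 fun h' => h (interior_subset h'))
  · filter_upwards [(isOpen_interior (s := L)).mem_nhdsSet.2 hKL] with x hx using
      (hf2 x).1 (interior_subset hx)

end Test

/-! ### Weak derivatives -/

section Weak

variable {d : ℕ} {U V : Set (E d)} {w w' g g' : E d → ℝ} {j : Fin d}

theorem IsTestFunction.setIntegral_mul {φ : E d → ℝ} (hφ : IsTestFunction U φ) (w : E d → ℝ) :
    ∫ x in U, w x * φ x = ∫ x, w x * φ x :=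
  setIntegral_eq_integral_of_forall_compl_eq_zero fun x hx => by rw [hφ.eq_zero hx, mul_zero]

theorem IsTestFunction.integrable_mul {φ : E d → ℝ} (hφ : IsTestFunction U φ) (_ : IsOpen U)
    (hw : LocallyIntegrableOn w U volume) : Integrable (fun x => w x * φ x) := by
  have h1 : IntegrableOn w (tsupport φ) := hw.integrableOn_compact_subset hφ.2.2 hφ.2.1
  have h2 : IntegrableOn (fun x => w x * φ x) (tsupport φ) :=
    h1.mul_continuousOn hφ.continuous.continuousOn hφ.2.1
  rwa [integrableOn_iff_integrable_of_support_subset] at h2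
  intro x hx
  by_contra h
  exact hx (by simp [image_eq_zero_of_notMem_tsupport h])

theorem IsWeakDeriv.integral_eq (h : IsWeakDeriv U j w g) {φ : E d → ℝ} (hφ : IsTestFunction U φ) :
    ∫ x, w x * partialDeriv j φ x = - ∫ x, g x * φ x := by
  rw [← hφ.setIntegral_mul, ← (hφ.partialDeriv j).setIntegral_mul]
  exact h.2.2 φ hφ

theorem isWeakDeriv_iff : IsWeakDeriv U j w g ↔ LocallyIntegrableOn w U ∧ LocallyIntegrableOn g U ∧
    ∀ φ, IsTestFunction U φ → ∫ x, w x * partialDeriv j φ x = - ∫ x, g x * φ x := by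
  refine ⟨fun h => ⟨h.1, h.2.1, fun φ hφ => h.integral_eq hφ⟩, fun h => ⟨h.1, h.2.1, fun φ hφ => ?_⟩⟩
  rw [hφ.setIntegral_mul, (hφ.partialDeriv j).setIntegral_mul]
  exact h.2.2 φ hφ

/-- The fundamental lemma of the calculus of variations for g - g'; it underlies every uniqueness
statement for weak derivatives. -/
theorem ae_eq_of_integral_mul_test (hU : IsOpen U) (hg : LocallyIntegrableOn g U)
    (hg' : LocallyIntegrableOn g' U)
    (h : ∀ φ, IsTestFunction U φ → ∫ x, g x * φ x = ∫ x, g' x * φ x) :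
    ∀ᵐ x, x ∈ U → g x = g' x := by
  have := hU.ae_eq_zero_of_integral_contDiff_smul_eq_zero (μ := volume) (f := fun x => g x - g' x)
    (hg.sub hg') (fun φ h1 h2 h3 => by
      have hφ : IsTestFunction U φ := ⟨h1, h2, h3⟩
      have := h φ hφ
      rw [← sub_eq_zero, ← integral_sub (hφ.integrable_mul hU hg) (hφ.integrable_mul hU hg')] at this
      rw [← this]
      congr 1; ext x; simp; ring)
  filter_upwards [this] with x hx hxU using sub_eq_zero.1 (hx hxU)

theorem IsWeakDeriv.unique (hU : IsOpen U) (h : IsWeakDeriv U j w g) (h' : IsWeakDeriv U j w g') :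
    ∀ᵐ x, x ∈ U → g x = g' x :=
  ae_eq_of_integral_mul_test hU h.2.1 h'.2.1 fun φ hφ => by
    have h1 := h.integral_eq hφ
    rw [h'.integral_eq hφ] at h1
    linarith

theorem IsWeakDeriv.isWeakDeriv_weakDeriv (h : IsWeakDeriv U j w g) :
    IsWeakDeriv U j w (weakDeriv U j w) := by
  have h' : ∃ g, IsWeakDeriv U j w g := ⟨g, h⟩
  rw [weakDeriv, dif_pos h']
  exact Classical.choose_spec h'

/-- `weakDeriv` is an arbitrary choice, so it can be compared with a known derivative only almost
everywhere; all later identities for it have this form. -/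
theorem IsWeakDeriv.weakDeriv_ae (hU : IsOpen U) (h : IsWeakDeriv U j w g) :
    ∀ᵐ x, x ∈ U → weakDeriv U j w x = g x :=
  h.isWeakDeriv_weakDeriv.unique hU h

theorem IsWeakDeriv.mono (h : IsWeakDeriv U j w g) (hVU : V ⊆ U) : IsWeakDeriv V j w g :=
  isWeakDeriv_iff.2 ⟨h.1.mono_set hVU, h.2.1.mono_set hVU,
    fun _ hφ => h.integral_eq (hφ.mono hVU)⟩

theorem locallyIntegrableOn_congr_ae (hU : MeasurableSet U) (hw : LocallyIntegrableOn w U)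
    (h : ∀ᵐ x, x ∈ U → w x = w' x) : LocallyIntegrableOn w' U := by
  intro x hx
  obtain ⟨s, hs, hi⟩ := hw x hx
  refine ⟨s ∩ U, inter_mem hs self_mem_nhdsWithin, (hi.mono_set inter_subset_left).congr ?_⟩
  have : ∀ᵐ x ∂(volume.restrict U), w x = w' x := (ae_restrict_iff' hU).2 h
  rw [← Measure.restrict_restrict_of_subset (s := s ∩ U) (t := U) inter_subset_right]
  exact ae_restrict_of_ae this

theorem IsWeakDeriv.congr_ae (hU : IsOpen U) (h : IsWeakDeriv U j w g)
    (hw : ∀ᵐ x, x ∈ U → w x = w' x) (hg : ∀ᵐ x, x ∈ U → g x = g' x) : IsWeakDeriv U j w' g' := by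
  refine isWeakDeriv_iff.2 ⟨locallyIntegrableOn_congr_ae hU.measurableSet h.1 hw,
    locallyIntegrableOn_congr_ae hU.measurableSet h.2.1 hg, fun φ hφ => ?_⟩
  have h1 := h.integral_eq hφ
  have e1 : ∫ x, w x * CutStokes.partialDeriv j φ x = ∫ x, w' x * CutStokes.partialDeriv j φ x := by
    refine integral_congr_ae ?_
    filter_upwards [hw] with x hx
    by_cases hxU : x ∈ U
    · simp only [hx hxU]
    · simp only [(hφ.partialDeriv j).eq_zero hxU, mul_zero]
  have e2 : ∫ x, g x * φ x = ∫ x, g' x * φ x := by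
    refine integral_congr_ae ?_
    filter_upwards [hg] with x hx
    by_cases hxU : x ∈ U
    · simp only [hx hxU]
    · simp only [hφ.eq_zero hxU, mul_zero]
  rw [← e1, ← e2, h1]

theorem IsWeakDeriv.sub (hU : IsOpen U) (h : IsWeakDeriv U j w g) (h' : IsWeakDeriv U j w' g') :
    IsWeakDeriv U j (fun x => w x - w' x) (fun x => g x - g' x) := by
  refine isWeakDeriv_iff.2 ⟨h.1.sub h'.1, h.2.1.sub h'.2.1, fun φ hφ => ?_⟩
  have hφ' := hφ.partialDeriv j
  simp only [sub_mul]
  rw [integral_sub (hφ'.integrable_mul hU h.1) (hφ'.integrable_mul hU h'.1),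
    integral_sub (hφ.integrable_mul hU h.2.1) (hφ.integrable_mul hU h'.2.1), h.integral_eq hφ,
    h'.integral_eq hφ]
  ring

theorem _root_.Continuous.locallyIntegrableOn' (hw : Continuous w) : LocallyIntegrableOn w U :=
  hw.locallyIntegrable.locallyIntegrableOn U

theorem isWeakDeriv_of_contDiff (hw : ContDiff ℝ ∞ w) (j : Fin d) :
    IsWeakDeriv U j w (partialDeriv j w) :=
  isWeakDeriv_iff.2 ⟨hw.continuous.locallyIntegrableOn',
    (hw.partialDeriv j).continuous.locallyIntegrableOn',
    fun _ hφ => integral_mul_partialDeriv hw hφ j⟩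

/-- `w` is square integrable on the compact subsets of `U`. -/
def LocL2 (U : Set (E d)) (w : E d → ℝ) : Prop :=
  ∀ K, IsCompact K → K ⊆ U → MemLp w 2 (volume.restrict K)

theorem MemL2.locL2 (hw : MemL2 U w) : LocL2 U w :=
  fun _ _ hKU => hw.mono_measure (Measure.restrict_mono hKU le_rfl)

theorem LocL2.add (hw : LocL2 U w) (hw' : LocL2 U w') : LocL2 U (fun x => w x + w' x) :=
  fun K hK hKU => (hw K hK hKU).add (hw' K hK hKU)

theorem LocL2.sub (hw : LocL2 U w) (hw' : LocL2 U w') : LocL2 U (fun x => w x - w' x) :=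
  fun K hK hKU => (hw K hK hKU).sub (hw' K hK hKU)

theorem LocL2.sum {ι : Type*} {s : Finset ι} {w : ι → E d → ℝ} (hw : ∀ i ∈ s, LocL2 U (w i)) :
    LocL2 U (fun x => ∑ i ∈ s, w i x) :=
  fun K hK hKU => memLp_finsetSum s fun i hi => hw i hi K hK hKU

theorem LocL2.locallyIntegrableOn (hU : IsOpen U) (hw : LocL2 U w) : LocallyIntegrableOn w U := by
  rw [locallyIntegrableOn_iff hU.isLocallyClosed]
  intro K hKU hK
  have : IsFiniteMeasure (volume.restrict K) := ⟨by simpa using hK.measure_lt_top⟩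
  exact (hw K hK hKU).integrable (by norm_num)

theorem LocL2.memLp_mul {θ : E d → ℝ} (hw : LocL2 U w) (hθ : IsTestFunction U θ) :
    MemLp (fun x => θ x * w x) 2 := by
  have h1 : MemLp (fun x => θ x * w x) 2 (volume.restrict (tsupport θ)) := by
    have h2 : MemLp θ ⊤ (volume.restrict (tsupport θ)) := hθ.memLp _ _
    have := (hw _ hθ.2.1 hθ.2.2).mul h2 (r := 2)
    exact this
  have h2 : (fun x => θ x * w x) = (tsupport θ).indicator (fun x => θ x * w x) := by
    ext x
    by_cases hx : x ∈ tsupport θ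
    · simp [hx]
    · simp [hx, image_eq_zero_of_notMem_tsupport hx]
  rw [h2]
  exact (memLp_indicator_iff_restrict (isClosed_tsupport θ).measurableSet).2 h1

/-- The product rule follows by testing with θφ. As θ has compact support in U, the product is
weakly differentiable on the whole space and can be mollified. -/
theorem IsWeakDeriv.test_mul {θ : E d → ℝ} (hU : IsOpen U) (h : IsWeakDeriv U j w g)
    (hθ : IsTestFunction U θ) :
    IsWeakDeriv univ j (fun x => θ x * w x) (fun x => θ x * g x + partialDeriv j θ x * w x) := by
  have hθ' := hθ.partialDeriv j
  have i1 : ∀ {w θ : E d → ℝ}, LocallyIntegrableOn w U → IsTestFunction U θ →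
      Integrable (fun x => θ x * w x) := fun hw hθ => by
    simpa only [mul_comm] using hθ.integrable_mul hU hw
  refine isWeakDeriv_iff.2 ⟨(i1 h.1 hθ).locallyIntegrable.locallyIntegrableOn _,
    ((i1 h.2.1 hθ).add (i1 h.1 hθ')).locallyIntegrable.locallyIntegrableOn _, fun φ hφ => ?_⟩
  have h1 := h.integral_eq (hθ.mul_right hφ.1)
  have e : ∀ x, w x * CutStokes.partialDeriv j (fun x => θ x * φ x) x
      = w x * (θ x * CutStokes.partialDeriv j φ x) + w x * (CutStokes.partialDeriv j θ x * φ x) :=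
    fun x => by
      rw [partialDeriv_mul hθ.1.differentiable_infty hφ.1.differentiable_infty]; ring
  simp_rw [e] at h1
  rw [integral_add ((hθ.mul_right (hφ.1.partialDeriv j)).integrable_mul hU h.1)
    ((hθ'.mul_right hφ.1).integrable_mul hU h.1)] at h1
  simp only [add_mul]
  rw [integral_add]
  · simp_rw [mul_assoc, mul_left_comm (θ _), mul_left_comm (CutStokes.partialDeriv j θ _)]
    linarith
  · simpa only [mul_left_comm, mul_comm, mul_assoc] using (hθ.mul_right hφ.1).integrable_mul hU h.2.1
  · simpa only [mul_left_comm, mul_comm, mul_assoc] using (hθ'.mul_right hφ.1).integrable_mul hU h.1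

end Weak

/-! ### Mollification -/

section Moll

variable {d : ℕ} {U : Set (E d)} {η F G : E d → ℝ} {j : Fin d}

/-- The convolution of two real functions on `ℝᵈ`. -/
def conv (η F : E d → ℝ) : E d → ℝ :=
  convolution η F (ContinuousLinearMap.lsmul ℝ ℝ) volume

theorem conv_apply (η F : E d → ℝ) (x : E d) : conv η F x = ∫ t, η (x - t) * F t := by
  simp [conv, convolution_lsmul_swap]

theorem integrable_conv (hη : Continuous η) (hη' : HasCompactSupport η) (hF : LocallyIntegrable F)
    (x : E d) : Integrable (fun t => η (x - t) * F t) := by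
  have h := hη'.convolutionExists_left (L := ContinuousLinearMap.lsmul ℝ ℝ) (μ := volume) hη hF x
  simpa using h.integrable_swap

theorem contDiff_conv (hη : IsTestFunction univ η) (hF : LocallyIntegrable F) :
    ContDiff ℝ ∞ (conv η F) :=
  hη.2.1.contDiff_convolution_left _ hη.1 hF

theorem partialDeriv_conv (hη : IsTestFunction univ η) (hF : LocallyIntegrable F) (j : Fin d) :
    partialDeriv j (conv η F) = conv (partialDeriv j η) F := by
  ext x
  have h := hη.2.1.hasFDerivAt_convolution_right (ContinuousLinearMap.lsmul ℝ ℝ).flip hF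
    (hη.1.of_le (by simp)) x
  rw [convolution_flip] at h
  rw [partialDeriv, conv, h.fderiv, convolution_precompR_apply _ hF (hη.2.1.fderiv ℝ)
    (hη.1.continuous_fderiv (by simp)), convolution_flip]
  rfl

theorem isTestFunction_comp_sub (hη : IsTestFunction univ η) (x : E d) :
    IsTestFunction univ (fun t => η (x - t)) := by
  refine ⟨hη.1.comp (contDiff_const.sub contDiff_id), ?_, subset_univ _⟩
  exact hη.2.1.comp_homeomorph (Homeomorph.subLeft x)

theorem partialDeriv_comp_sub (hη : IsTestFunction univ η) (x t : E d) :
    partialDeriv j (fun t => η (x - t)) t = - partialDeriv j η (x - t) := by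
  have h : HasFDerivAt (fun t : E d => x - t) (-ContinuousLinearMap.id ℝ (E d)) t :=
    (hasFDerivAt_id t).const_sub x
  have := (hη.1.differentiable_infty (x - t)).hasFDerivAt.comp t h
  have e : (fun t => η (x - t)) = η ∘ fun t => x - t := rfl
  rw [partialDeriv, e, this.fderiv]
  simp [partialDeriv]

/-- The definition of the weak derivative is applied to the reflected translate t ↦ η(x - t); the
two minus signs cancel. -/
theorem conv_partialDeriv (hη : IsTestFunction univ η) (h : IsWeakDeriv univ j F G) :
    conv (partialDeriv j η) F = conv η G := by
  ext x
  have := h.integral_eq (isTestFunction_comp_sub hη x)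
  simp_rw [partialDeriv_comp_sub hη] at this
  simp only [conv_apply]
  simp only [mul_neg, integral_neg, neg_inj] at this
  simpa only [mul_comm] using this

theorem conv_sub (hη : IsTestFunction univ η) (hF : LocallyIntegrable F) (hG : LocallyIntegrable G) :
    conv η (fun x => F x - G x) = fun x => conv η F x - conv η G x := by
  ext x
  simp only [conv_apply, mul_sub]
  exact integral_sub (integrable_conv hη.continuous hη.2.1 hF x)
    (integrable_conv hη.continuous hη.2.1 hG x)

theorem eLpNorm_two_eq {α : Type*} [MeasurableSpace α] {μ : Measure α} {f : α → ℝ}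
    (hf : MemLp f 2 μ) : eLpNorm f 2 μ = ENNReal.ofReal (√(∫ x, f x ^ 2 ∂μ)) := by
  rw [hf.eLpNorm_eq_integral_rpow_norm (by norm_num) (by norm_num), Real.sqrt_eq_rpow]
  simp

/-- A standard mollifier. -/
def mollifier (d n : ℕ) : ContDiffBump (0 : E d) where
  rIn := 1 / (2 * (n + 1))
  rOut := 1 / (n + 1)
  rIn_pos := by positivity
  rIn_lt_rOut := by
    rw [div_lt_div_iff₀ (by positivity) (by positivity)]
    have : (0 : ℝ) ≤ n := Nat.cast_nonneg n
    linarith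

/-- The kernel of the mollification. -/
def kernel (d n : ℕ) : E d → ℝ := (mollifier d n).normed volume

/-- The `n`-th mollification of a function. -/
def moll (n : ℕ) (F : E d → ℝ) : E d → ℝ := conv (kernel d n) F

theorem isTestFunction_kernel (d n : ℕ) : IsTestFunction univ (kernel d n) :=
  ⟨(mollifier d n).contDiff_normed, (mollifier d n).hasCompactSupport_normed, subset_univ _⟩

theorem kernel_nonneg (n : ℕ) (x : E d) : 0 ≤ kernel d n x := (mollifier d n).nonneg_normed x

theorem integral_kernel (n : ℕ) (x : E d) : ∫ t, kernel d n (x - t) = 1 := by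
  rw [integral_sub_left_eq_self (kernel d n) volume x]
  exact (mollifier d n).integral_normed

theorem contDiff_moll (n : ℕ) (hF : LocallyIntegrable F) : ContDiff ℝ ∞ (moll n F) :=
  contDiff_conv (isTestFunction_kernel d n) hF

theorem moll_sub (n : ℕ) (hF : LocallyIntegrable F) (hG : LocallyIntegrable G) :
    moll n (fun x => F x - G x) = fun x => moll n F x - moll n G x :=
  conv_sub (isTestFunction_kernel d n) hF hG

theorem partialDeriv_moll (n : ℕ) (h : IsWeakDeriv univ j F G) :
    partialDeriv j (moll n F) = moll n G := by
  rw [moll, partialDeriv_conv (isTestFunction_kernel d n) (locallyIntegrableOn_univ.1 h.1),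
    conv_partialDeriv (isTestFunction_kernel d n) h, moll]

theorem support_moll_subset (n : ℕ) (F : E d → ℝ) {x : E d} (hx : moll n F x ≠ 0) :
    ∃ y ∈ tsupport F, dist x y < 1 / (n + 1) := by
  by_contra! h
  refine hx ?_
  rw [moll, conv_apply]
  refine integral_eq_zero_of_ae (.of_forall fun t => ?_)
  by_cases ht : t ∈ tsupport F
  · have h0 : kernel d n (x - t) = 0 := by
      by_contra h0
      have : x - t ∈ Function.support ((mollifier d n).normed volume) := h0
      rw [ContDiffBump.support_normed_eq, Metric.mem_ball, dist_zero_right, ← dist_eq_norm] at this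
      exact absurd this (not_lt.2 (h t ht))
    simp [h0]
  · simp [image_eq_zero_of_notMem_tsupport ht]

theorem tsupport_moll_subset (n : ℕ) (F : E d → ℝ) :
    tsupport (moll n F) ⊆ Metric.cthickening (1 / (n + 1)) (tsupport F) := by
  refine closure_minimal (fun x hx => ?_) Metric.isClosed_cthickening
  obtain ⟨y, hy, hxy⟩ := support_moll_subset n F hx
  exact Metric.mem_cthickening_of_dist_le x y _ _ hy hxy.le

theorem isTestFunction_moll (n : ℕ) (hF : LocallyIntegrable F) (hF' : HasCompactSupport F) :
    IsTestFunction univ (moll n F) :=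
  ⟨contDiff_moll n hF, HasCompactSupport.of_support_subset_isCompact
    (hF'.isCompact.cthickening (r := 1 / (n + 1)))
    ((subset_tsupport _).trans (tsupport_moll_subset n F)), subset_univ _⟩

theorem _root_.MeasureTheory.MemLp.locallyIntegrable_two (hF : MemLp F 2) : LocallyIntegrable F :=
  hF.locallyIntegrable (by norm_num)

/-- Jensen's inequality for the probability density t ↦ k(x - t): with c the mean of F, the variance
∫ k(x - t)(F(t) - c)² dt is nonnegative. -/
theorem moll_sq_le (n : ℕ) (hF : MemLp F 2) (x : E d) :
    moll n F x ^ 2 ≤ moll n (fun y => F y ^ 2) x := by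
  set c := moll n F x with hc
  have hk := isTestFunction_kernel d n
  have i1 := integrable_conv hk.continuous hk.2.1 hF.locallyIntegrable_two x
  have i2 := integrable_conv hk.continuous hk.2.1 (hF.integrable_sq).locallyIntegrable x
  have i3 : Integrable (fun t => kernel d n (x - t)) :=
    (isTestFunction_comp_sub hk x).continuous.integrable_of_hasCompactSupport
      (isTestFunction_comp_sub hk x).2.1
  have h0 : 0 ≤ ∫ t, kernel d n (x - t) * (F t - c) ^ 2 :=
    integral_nonneg fun t => mul_nonneg (kernel_nonneg n _) (sq_nonneg _)
  have e : ∀ t, kernel d n (x - t) * (F t - c) ^ 2 = kernel d n (x - t) * F t ^ 2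
      - 2 * c * (kernel d n (x - t) * F t) + c ^ 2 * kernel d n (x - t) := fun t => by ring
  simp_rw [e] at h0
  have i4 : Integrable (fun t => kernel d n (x - t) * F t ^ 2
      - 2 * c * (kernel d n (x - t) * F t)) := i2.sub (i1.const_mul _)
  rw [integral_add i4 (i3.const_mul _), integral_sub i2 (i1.const_mul _),
    integral_const_mul, integral_const_mul, integral_kernel, ← conv_apply, ← conv_apply] at h0
  simp only [moll] at hc ⊢
  rw [← hc] at h0
  nlinarith

theorem memLp_moll (n : ℕ) (hF : MemLp F 2) : MemLp (moll n F) 2 := by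
  have hk := isTestFunction_kernel d n
  rw [memLp_two_iff_integrable_sq (contDiff_moll n hF.locallyIntegrable_two).continuous.aestronglyMeasurable]
  have i : Integrable (moll n (fun y => F y ^ 2)) :=
    (hk.continuous.integrable_of_hasCompactSupport hk.2.1).integrable_convolution _ hF.integrable_sq
  refine i.mono' ((contDiff_moll n hF.locallyIntegrable_two).continuous.pow 2).aestronglyMeasurable
    (.of_forall fun x => ?_)
  rw [Real.norm_of_nonneg (sq_nonneg _)]
  exact moll_sq_le n hF x

theorem eLpNorm_moll_le (n : ℕ) (hF : MemLp F 2) :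
    eLpNorm (moll n F) 2 volume ≤ eLpNorm F 2 volume := by
  have hk := isTestFunction_kernel d n
  rw [eLpNorm_two_eq (memLp_moll n hF), eLpNorm_two_eq hF]
  refine ENNReal.ofReal_le_ofReal (Real.sqrt_le_sqrt ?_)
  have ik := hk.continuous.integrable_of_hasCompactSupport (μ := volume) hk.2.1
  have i : Integrable (moll n (fun y => F y ^ 2)) := ik.integrable_convolution _ hF.integrable_sq
  refine (integral_mono (memLp_moll n hF).integrable_sq i (moll_sq_le n hF)).trans ?_
  have := integral_convolution (ContinuousLinearMap.lsmul ℝ ℝ) ik hF.integrable_sq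
  rw [moll, conv, this]
  have h1 : ∫ t, kernel d n t = 1 := (mollifier d n).integral_normed
  simp [h1]

theorem tendsto_moll_of_continuous (hF : Continuous F) (hF' : HasCompactSupport F) :
    Tendsto (fun n => eLpNorm (fun x => moll n F x - F x) 2 volume) atTop (𝓝 0) := by
  set K := Metric.cthickening 1 (tsupport F) with hK
  have hKc : IsCompact K := hF'.isCompact.cthickening
  rw [ENNReal.tendsto_nhds_zero]
  intro ε hε
  -- C is the admissible uniform error. The set K contains the supports of F and of all its
  -- mollifications, since the radii are at most 1, so a uniform error C costs at most C ·
  -- vol(K)^(1/2) ≤ ε in L².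
  obtain ⟨C, hC, hCK⟩ : ∃ C : NNReal, 0 < C ∧ C * (volume K) ^ (1 / 2 : ℝ) ≤ ε := by
    have hfin : (volume K) ^ (1 / 2 : ℝ) ≠ ⊤ :=
      ENNReal.rpow_ne_top_of_nonneg (by norm_num) hKc.measure_lt_top.ne
    have ht : Tendsto (fun C : NNReal => (C : ENNReal) * (volume K) ^ (1 / 2 : ℝ)) (𝓝[>] 0) (𝓝 0) := by
      have h1 : Tendsto (fun C : NNReal => (C : ENNReal)) (𝓝[>] 0) (𝓝 0) := by
        have := (ENNReal.continuous_coe.tendsto (0 : NNReal)).mono_left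
          (nhdsWithin_le_nhds (s := Ioi 0))
        simpa using this
      simpa using ENNReal.Tendsto.mul_const h1 (.inr hfin)
    have h2 := (ENNReal.tendsto_nhds_zero.1 ht) ε hε
    obtain ⟨C, h3, h4⟩ := (h2.and self_mem_nhdsWithin).exists
    exact ⟨C, h4, h3⟩
  have huc := hF'.uniformContinuous_of_continuous hF
  obtain ⟨δ, hδ, hδF⟩ := Metric.uniformContinuous_iff.1 huc C hC
  have hn : ∀ᶠ n : ℕ in atTop, 1 / ((n : ℝ) + 1) < δ :=
    tendsto_one_div_add_atTop_nhds_zero_nat.eventually (gt_mem_nhds hδ)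
  filter_upwards [hn] with n hn
  have hsup : (fun x => moll n F x - F x) = K.indicator (fun x => moll n F x - F x) := by
    ext x
    by_cases hx : x ∈ K
    · simp [hx]
    · have h1 : F x = 0 := image_eq_zero_of_notMem_tsupport fun h =>
        hx (Metric.self_subset_cthickening _ h)
      have h2 : moll n F x = 0 := image_eq_zero_of_notMem_tsupport fun h => hx <| by
        refine Metric.cthickening_mono ?_ _ (tsupport_moll_subset n F h)
        rw [div_le_one (by positivity)]; linarith [(Nat.cast_nonneg n : (0 : ℝ) ≤ n)]
      simp [hx, h1, h2]
  rw [hsup, eLpNorm_indicator_eq_eLpNorm_restrict hKc.measurableSet]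
  refine (eLpNorm_le_of_ae_bound (C := C) (.of_forall fun x => ?_)).trans ?_
  · rw [← dist_eq_norm]
    refine (mollifier d n).dist_normed_convolution_le hF.aestronglyMeasurable fun y hy => ?_
    exact (hδF (lt_trans hy hn)).le
  · rw [mul_comm]
    simpa using hCK

/-- Density of continuous compactly supported functions; mollification is an L² contraction, so the
approximation error is not magnified. -/
theorem tendsto_moll (hF : MemLp F 2) :
    Tendsto (fun n => eLpNorm (fun x => moll n F x - F x) 2 volume) atTop (𝓝 0) := by
  rw [ENNReal.tendsto_nhds_zero]
  intro ε hε
  have hε3 : ε / 3 ≠ 0 := by simp [hε.ne']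
  obtain ⟨g, hg1, hg2, hg3, hg4⟩ := hF.exists_hasCompactSupport_eLpNorm_sub_le (by norm_num) hε3
  filter_upwards [(ENNReal.tendsto_nhds_zero.1 (tendsto_moll_of_continuous hg3 hg1)) (ε / 3)
    (pos_iff_ne_zero.2 hε3)] with n hn
  have hd : MemLp (fun x => F x - g x) 2 := hF.sub hg4
  have e : (fun x => moll n F x - F x) = (moll n (fun x => F x - g x)) +
      ((fun x => moll n g x - g x) + (fun x => -(F x - g x))) := by
    rw [moll_sub n hF.locallyIntegrable_two hg4.locallyIntegrable_two]
    ext x; simp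
  have m1 := (memLp_moll n hd).aestronglyMeasurable
  have m2 := ((memLp_moll n hg4).sub hg4).aestronglyMeasurable
  calc eLpNorm (fun x => moll n F x - F x) 2 volume
      ≤ eLpNorm (moll n (fun x => F x - g x)) 2 volume + (eLpNorm (fun x => moll n g x - g x) 2 volume
        + eLpNorm (fun x => -(F x - g x)) 2 volume) := by
        rw [e]
        refine (eLpNorm_add_le m1 (m2.add hd.neg.aestronglyMeasurable) (by norm_num)).trans ?_
        gcongr
        exact eLpNorm_add_le m2 hd.neg.aestronglyMeasurable (by norm_num)
    _ ≤ ε / 3 + (ε / 3 + ε / 3) := by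
        have h1 : eLpNorm (fun x => -(F x - g x)) 2 volume ≤ ε / 3 := by
          have : eLpNorm (-(F - g)) 2 volume ≤ ε / 3 := by rw [eLpNorm_neg]; exact hg2
          exact this
        gcongr
        exact (eLpNorm_moll_le n hd).trans hg2
    _ = ε := by rw [← add_assoc, ENNReal.add_thirds]

end Moll

/-! ### Interior regularity for the Poisson equation -/

section LpLimits

variable {α : Type*} [MeasurableSpace α] {μ : Measure α}

theorem tendsto_integral_mul_of_eLpNorm {f : ℕ → α → ℝ} {F g : α → ℝ} (hf : ∀ n, MemLp (f n) 2 μ)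
    (hF : MemLp F 2 μ) (hg : MemLp g 2 μ)
    (h : Tendsto (fun n => eLpNorm (fun x => f n x - F x) 2 μ) atTop (𝓝 0)) :
    Tendsto (fun n => ∫ x, f n x * g x ∂μ) atTop (𝓝 (∫ x, F x * g x ∂μ)) := by
  refine tendsto_integral_of_L1' (fun x => F x * g x) (hF.integrable_mul hg).aestronglyMeasurable
    (.of_forall fun n => (hf n).integrable_mul hg) ?_
  have hle : ∀ n, eLpNorm ((fun x => f n x * g x) - fun x => F x * g x) 1 μ
      ≤ eLpNorm (fun x => f n x - F x) 2 μ * eLpNorm g 2 μ := fun n => by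
    have e : ((fun x => f n x * g x) - fun x => F x * g x) = (fun x => f n x - F x) • g := by
      ext x; simp [sub_mul]
    rw [e]
    exact eLpNorm_smul_le_mul_eLpNorm hg.aestronglyMeasurable ((hf n).sub hF).aestronglyMeasurable
  refine tendsto_of_tendsto_of_tendsto_of_le_of_le tendsto_const_nhds ?_ (fun _ => zero_le) hle
  simpa using ENNReal.Tendsto.mul_const h (.inr hg.eLpNorm_ne_top)

theorem dist_toLp_two {f g : α → ℝ} (hf : MemLp f 2 μ) (hg : MemLp g 2 μ) :
    dist (hf.toLp f) (hg.toLp g) = √(∫ x, (f x - g x) ^ 2 ∂μ) := by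
  rw [dist_eq_norm, ← MemLp.toLp_sub, Lp.norm_toLp, eLpNorm_two_eq (hf.sub hg),
    ENNReal.toReal_ofReal (Real.sqrt_nonneg _)]
  rfl

theorem tendsto_toLp_two_iff {f : ℕ → α → ℝ} {F : α → ℝ} (hf : ∀ n, MemLp (f n) 2 μ)
    (hF : MemLp F 2 μ) : Tendsto (fun n => (hf n).toLp (f n)) atTop (𝓝 (hF.toLp F)) ↔
      Tendsto (fun n => eLpNorm (fun x => f n x - F x) 2 μ) atTop (𝓝 0) :=
  Lp.tendsto_Lp_iff_tendsto_eLpNorm'' f hf F hF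

theorem tendsto_integral_sq_sub {f : ℕ → α → ℝ} {F : α → ℝ} (hf : ∀ n, MemLp (f n) 2 μ)
    (hF : MemLp F 2 μ) (h : Tendsto (fun n => eLpNorm (fun x => f n x - F x) 2 μ) atTop (𝓝 0)) :
    Tendsto (fun p : ℕ × ℕ => ∫ x, (f p.1 x - f p.2 x) ^ 2 ∂μ) atTop (𝓝 0) := by
  have hc := ((tendsto_toLp_two_iff hf hF).2 h).cauchySeq
  have := (cauchySeq_iff_tendsto_dist_atTop_0.1 hc).pow 2
  simp only [dist_toLp_two] at this
  simpa only [Real.sq_sqrt (integral_nonneg fun x => sq_nonneg _), ne_eq, OfNat.ofNat_ne_zero,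
    not_false_eq_true, zero_pow] using this

/-- Completeness of L², phrased with integrals of squares so that an energy estimate can be inserted
directly. -/
theorem exists_limit_of_integral_sq_sub {f : ℕ → α → ℝ} (hf : ∀ n, MemLp (f n) 2 μ)
    (h : Tendsto (fun p : ℕ × ℕ => ∫ x, (f p.1 x - f p.2 x) ^ 2 ∂μ) atTop (𝓝 0)) :
    ∃ F, MemLp F 2 μ ∧ Tendsto (fun n => eLpNorm (fun x => f n x - F x) 2 μ) atTop (𝓝 0) := by
  have hc : CauchySeq (fun n => (hf n).toLp (f n)) := by
    rw [cauchySeq_iff_tendsto_dist_atTop_0]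
    simp only [dist_toLp_two]
    simpa using h.sqrt
  obtain ⟨L, hL⟩ := cauchySeq_tendsto_of_complete hc
  refine ⟨L, Lp.memLp L, (tendsto_toLp_two_iff hf (Lp.memLp L)).1 ?_⟩
  rwa [Lp.toLp_coeFn]

end LpLimits

/-! ### Local H¹ regularity for equations in divergence form. -/

section Regularity

variable {d : ℕ} {U : Set (E d)}

/-- Testing the equation with V gives ‖∇V‖² = ∑ ∫ ∂ⱼV Hⱼ - ∫ V h. After doubling, Young's inequality
bounds the right side by ‖∇V‖² + ‖H‖² + ‖V‖² + ‖h‖², and one copy of ‖∇V‖² is absorbed. -/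
theorem integral_energy_le {V h : E d → ℝ} {H : Fin d → E d → ℝ} (hV : IsTestFunction univ V)
    (hH : ∀ j, IsTestFunction univ (H j)) (hh : IsTestFunction univ h)
    (e : ∀ x, lap V x = ∑ j, partialDeriv j (H j) x + h x) :
    ∑ j, ∫ x, partialDeriv j V x ^ 2 ≤ (∑ j, ∫ x, H j x ^ 2) + (∫ x, V x ^ 2) + ∫ x, h x ^ 2 := by
  have key : ∀ {a b : E d → ℝ}, IsTestFunction univ a → IsTestFunction univ b →
      Integrable (fun x => a x * b x) := fun ha hb =>
    (ha.continuous.mul hb.continuous).integrable_of_hasCompactSupport ha.2.1.mul_right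
  have sq : ∀ {a b : E d → ℝ}, IsTestFunction univ a → IsTestFunction univ b →
      2 * ∫ x, a x * b x ≤ (∫ x, a x ^ 2) + ∫ x, b x ^ 2 := fun {a b} ha hb => by
    have i1 := key ha ha
    have i2 := key hb hb
    simp_rw [pow_two]
    rw [← integral_const_mul, ← integral_add i1 i2]
    refine integral_mono ((key ha hb).const_mul 2) (i1.add i2) fun x => ?_
    simp only
    nlinarith [sq_nonneg (a x - b x)]
  have sq' : 2 * -(∫ x, V x * h x) ≤ (∫ x, V x ^ 2) + ∫ x, h x ^ 2 := by
    have i1 := key hV hV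
    have i2 := key hh hh
    simp_rw [pow_two]
    rw [← integral_neg, ← integral_const_mul, ← integral_add i1 i2]
    refine integral_mono ((key hV hh).neg.const_mul 2) (i1.add i2) fun x => ?_
    simp only
    nlinarith [sq_nonneg (V x + h x)]
  have h1 : ∫ x, V x * lap V x = - ∑ j, ∫ x, partialDeriv j V x ^ 2 := by
    simp_rw [lap, Finset.mul_sum]
    rw [integral_finsetSum _ fun j _ => key hV ((hV.partialDeriv j).partialDeriv j),
      ← Finset.sum_neg_distrib]
    refine Finset.sum_congr rfl fun j _ => ?_
    rw [integral_mul_partialDeriv hV.1 (hV.partialDeriv j)]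
    simp_rw [pow_two]
  have h2 : ∫ x, V x * lap V x = - (∑ j, ∫ x, partialDeriv j V x * H j x) + ∫ x, V x * h x := by
    simp_rw [e, mul_add, Finset.mul_sum]
    rw [integral_add (integrable_finsetSum _ fun j _ => key hV ((hH j).partialDeriv j)) (key hV hh),
      integral_finsetSum _ fun j _ => key hV ((hH j).partialDeriv j), ← Finset.sum_neg_distrib]
    congr 1
    exact Finset.sum_congr rfl fun j _ => integral_mul_partialDeriv hV.1 (hH j) j
  have h3 : 2 * ∑ j, ∫ x, partialDeriv j V x * H j x
      ≤ (∑ j, ∫ x, partialDeriv j V x ^ 2) + ∑ j, ∫ x, H j x ^ 2 := by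
    rw [Finset.mul_sum, ← Finset.sum_add_distrib]
    exact Finset.sum_le_sum fun j _ => sq (hV.partialDeriv j) (hH j)
  linarith

theorem IsTestFunction.sub {φ ψ : E d → ℝ} (hφ : IsTestFunction univ φ)
    (hψ : IsTestFunction univ ψ) : IsTestFunction univ (fun x => φ x - ψ x) :=
  ⟨hφ.1.sub hψ.1, hφ.2.1.sub hψ.2.1, subset_univ _⟩

theorem lap_sub {φ ψ : E d → ℝ} (hφ : ContDiff ℝ ∞ φ) (hψ : ContDiff ℝ ∞ ψ) (x : E d) :
    lap (fun x => φ x - ψ x) x = lap φ x - lap ψ x := by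
  simp only [lap]
  rw [← Finset.sum_sub_distrib]
  refine Finset.sum_congr rfl fun j _ => ?_
  have h : partialDeriv j (fun x => φ x - ψ x) = fun x => partialDeriv j φ x - partialDeriv j ψ x :=
    funext (partialDeriv_sub hφ.differentiable_infty hψ.differentiable_infty j)
  rw [h, partialDeriv_sub (hφ.partialDeriv j).differentiable_infty
    (hψ.partialDeriv j).differentiable_infty]

theorem lap_comp_sub {η : E d → ℝ} (hη : IsTestFunction univ η) (x t : E d) :
    lap (fun t => η (x - t)) t = lap η (x - t) := by
  simp only [lap]
  refine Finset.sum_congr rfl fun j _ => ?_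
  have h : partialDeriv j (fun t => η (x - t)) = fun t => (-1) * partialDeriv j η (x - t) := by
    ext t; rw [partialDeriv_comp_sub hη, neg_one_mul]
  rw [h, partialDeriv_mul (differentiable_const _)
    (isTestFunction_comp_sub (hη.partialDeriv j) x).1.differentiable_infty,
    partialDeriv_comp_sub (hη.partialDeriv j)]
  simp [partialDeriv]

/-- If `W` has compact support and `ΔW = div G + g` in the sense of distributions with `G` and `g`
square integrable, then `W` belongs to `H¹`. -/
theorem exists_isWeakDeriv_of_lap {W g : E d → ℝ} {G : Fin d → E d → ℝ}
    (hW : MemLp W 2) (hW' : HasCompactSupport W) (hG : ∀ j, MemLp (G j) 2)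
    (hG' : ∀ j, HasCompactSupport (G j)) (hg : MemLp g 2) (hg' : HasCompactSupport g)
    (h : ∀ φ, IsTestFunction univ φ → ∫ x, W x * lap φ x
      = - (∑ j, ∫ x, G j x * partialDeriv j φ x) + ∫ x, g x * φ x) (j : Fin d) :
    ∃ b, MemLp b 2 ∧ IsWeakDeriv univ j W b := by
  have tW := fun n => isTestFunction_moll n hW.locallyIntegrable_two hW'
  have tG := fun n j => isTestFunction_moll n (hG j).locallyIntegrable_two (hG' j)
  have tg := fun n => isTestFunction_moll n hg.locallyIntegrable_two hg'
  -- Testing the distributional equation with the translated kernel turns it into a classical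
  -- equation for the mollifications.
  have e : ∀ n x, lap (moll n W) x = ∑ j, partialDeriv j (moll n (G j)) x + moll n g x := by
    intro n x
    have hk := isTestFunction_kernel d n
    have e1 : lap (moll n W) x = ∫ t, W t * lap (kernel d n) (x - t) := by
      simp only [lap, moll, partialDeriv_conv hk hW.locallyIntegrable_two,
        partialDeriv_conv (hk.partialDeriv _) hW.locallyIntegrable_two, Finset.mul_sum, conv_apply]
      rw [integral_finsetSum]
      · simp only [mul_comm]
      · intro j _
        simpa only [mul_comm] using integrable_conv ((hk.partialDeriv j).partialDeriv j).continuous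
          ((hk.partialDeriv j).partialDeriv j).2.1 hW.locallyIntegrable_two x
    have e2 := h _ (isTestFunction_comp_sub hk x)
    simp_rw [lap_comp_sub hk, partialDeriv_comp_sub hk] at e2
    rw [e1, e2, ← Finset.sum_neg_distrib]
    congr 1
    · refine Finset.sum_congr rfl fun j _ => ?_
      rw [moll, partialDeriv_conv hk (hG j).locallyIntegrable_two, conv_apply, ← integral_neg]
      congr 1; ext t; ring
    · rw [moll, conv_apply]
      congr 1; ext t; ring
  -- The equation is linear, so the energy estimate applies to differences; as the mollified data
  -- are Cauchy in L², the gradients are too.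
  have hen : ∀ p : ℕ × ℕ, ∑ j, ∫ x, (partialDeriv j (moll p.1 W) x - partialDeriv j (moll p.2 W) x) ^ 2
      ≤ (∑ j, ∫ x, (moll p.1 (G j) x - moll p.2 (G j) x) ^ 2)
        + (∫ x, (moll p.1 W x - moll p.2 W x) ^ 2) + ∫ x, (moll p.1 g x - moll p.2 g x) ^ 2 := by
    intro p
    have := integral_energy_le ((tW p.1).sub (tW p.2)) (fun j => (tG p.1 j).sub (tG p.2 j))
      ((tg p.1).sub (tg p.2)) (fun x => by
        rw [lap_sub (tW _).1 (tW _).1, e, e]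
        simp_rw [partialDeriv_sub (tG _ _).1.differentiable_infty (tG _ _).1.differentiable_infty,
          Finset.sum_sub_distrib]
        ring)
    simp_rw [partialDeriv_sub (tW _).1.differentiable_infty (tW _).1.differentiable_infty] at this
    exact this
  have hlim : Tendsto (fun p : ℕ × ℕ =>
      ∫ x, (partialDeriv j (moll p.1 W) x - partialDeriv j (moll p.2 W) x) ^ 2) atTop (𝓝 0) := by
    have l1 := tendsto_integral_sq_sub (fun n => memLp_moll n hW) hW (tendsto_moll hW)
    have l2 := tendsto_integral_sq_sub (fun n => memLp_moll n hg) hg (tendsto_moll hg)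
    have l3 := fun j => tendsto_integral_sq_sub (fun n => memLp_moll n (hG j)) (hG j)
      (tendsto_moll (hG j))
    have l4 := ((tendsto_finsetSum Finset.univ fun j _ => l3 j).add l1).add l2
    simp only [Finset.sum_const_zero, add_zero] at l4
    refine squeeze_zero (fun p => integral_nonneg fun x => sq_nonneg _) (fun p => ?_) l4
    refine le_trans ?_ (hen p)
    exact Finset.single_le_sum (f := fun j => ∫ x, (partialDeriv j (moll p.1 W) x
      - partialDeriv j (moll p.2 W) x) ^ 2) (fun j _ => integral_nonneg fun x => sq_nonneg _)
      (Finset.mem_univ j)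
  obtain ⟨b, hb, hbl⟩ := exists_limit_of_integral_sq_sub
    (fun n => ((tW n).partialDeriv j).memLp 2 volume) hlim
  refine ⟨b, hb, isWeakDeriv_iff.2 ⟨hW.locallyIntegrable_two.locallyIntegrableOn _,
    hb.locallyIntegrable_two.locallyIntegrableOn _, fun φ hφ => ?_⟩⟩
  have t1 := tendsto_integral_mul_of_eLpNorm (fun n => memLp_moll n hW) hW
    ((hφ.partialDeriv j).memLp 2 volume) (tendsto_moll hW)
  have t2 := tendsto_integral_mul_of_eLpNorm (fun n => ((tW n).partialDeriv j).memLp 2 volume) hb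
    (hφ.memLp 2 volume) hbl
  refine tendsto_nhds_unique t1 (t2.neg.congr fun n => ?_)
  rw [integral_mul_partialDeriv (tW n).1 hφ]

/-- A compact exhaustion of U, transported to the ambient space. Its countability allows the
exceptional null sets of local statements to be combined. -/
theorem exists_open_cover_compact (hU : IsOpen U) : ∃ K : ℕ → Set (E d),
    (∀ n, IsCompact (K n)) ∧ (∀ n, K n ⊆ U) ∧ ∀ L, IsCompact L → L ⊆ U → ∃ n, L ⊆ K n := by
  have : LocallyCompactSpace U := hU.locallyCompactSpace
  let e : CompactExhaustion U := CompactExhaustion.choice U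
  refine ⟨fun n => Subtype.val '' e n, fun n => (e.isCompact n).image continuous_subtype_val,
    fun n => by simp, fun L hL hLU => ?_⟩
  have hL' : IsCompact ((Subtype.val : U → E d) ⁻¹' L) :=
    Topology.IsInducing.subtypeVal.isCompact_preimage_iff (by simpa using hLU) |>.2 hL
  obtain ⟨n, hn⟩ := e.exists_superset_of_isCompact hL'
  refine ⟨n, fun x hx => ⟨⟨x, hLU hx⟩, hn hx, rfl⟩⟩

/-- Local weak derivatives can be glued. -/
theorem exists_isWeakDeriv_of_local {w : E d → ℝ} {j : Fin d} (hU : IsOpen U) (hw : LocL2 U w)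
    (h : ∀ K, IsCompact K → K ⊆ U → ∃ V b, IsOpen V ∧ K ⊆ V ∧ MemLp b 2 ∧ IsWeakDeriv V j w b) :
    ∃ b, LocL2 U b ∧ IsWeakDeriv U j w b := by
  classical
  obtain ⟨K, hK, hKU, hKL⟩ := exists_open_cover_compact hU
  choose V b hV hKV hb hwb using fun n => h (K n) (hK n) (hKU n)
  have hex : ∀ x ∈ U, ∃ n, x ∈ K n := fun x hx => by
    obtain ⟨n, hn⟩ := hKL {x} isCompact_singleton (by simpa using hx)
    exact ⟨n, hn rfl⟩
  -- The value is taken from the first compact set that contains x. By uniqueness the local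
  -- derivatives agree almost everywhere on overlaps, so the choice is immaterial.
  let B : E d → ℝ := fun x => if hx : x ∈ U then b (Nat.find (hex x hx)) x else 0
  have hB : ∀ N, ∀ᵐ x, x ∈ K N → B x = b N x := fun N => by
    have : ∀ n, ∀ᵐ x, x ∈ V n ∩ V N → b n x = b N x := fun n =>
      ((hwb n).mono inter_subset_left).unique ((hV n).inter (hV N)) ((hwb N).mono inter_subset_right)
    filter_upwards [ae_all_iff.2 this] with x hx hxN
    have hxU := hKU N hxN
    simp only [B, dif_pos hxU]
    exact hx _ ⟨hKV _ (Nat.find_spec (hex x hxU)), hKV N hxN⟩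
  have hBL : LocL2 U B := fun L hL hLU => by
    obtain ⟨N, hN⟩ := hKL L hL hLU
    refine ((hb N).restrict L).ae_eq ?_
    refine (ae_restrict_iff' hL.measurableSet).2 ?_
    filter_upwards [hB N] with x hx hxL using (hx (hN hxL)).symm
  refine ⟨B, hBL, isWeakDeriv_iff.2 ⟨hw.locallyIntegrableOn hU, hBL.locallyIntegrableOn hU,
    fun φ hφ => ?_⟩⟩
  obtain ⟨N, hN⟩ := hKL _ hφ.2.1 hφ.2.2
  rw [(hwb N).integral_eq ⟨hφ.1, hφ.2.1, hN.trans (hKV N)⟩]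
  congr 1
  refine integral_congr_ae ?_
  filter_upwards [hB N] with x hx
  by_cases hxs : x ∈ tsupport φ
  · rw [hx (hN hxs)]
  · simp [image_eq_zero_of_notMem_tsupport hxs]

/-- If `Δw = div a` in the sense of distributions on `U` with `w` and `a` locally square integrable,
then `w` is locally in `H¹`. -/
theorem exists_isWeakDeriv_of_lap_eq_div {w : E d → ℝ} {a : Fin d → E d → ℝ} (hU : IsOpen U)
    (hw : LocL2 U w) (ha : ∀ j, LocL2 U (a j))
    (h : ∀ φ, IsTestFunction U φ →
      ∫ x, w x * lap φ x = - ∑ j, ∫ x, a j x * partialDeriv j φ x) (j : Fin d) :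
    ∃ b, LocL2 U b ∧ IsWeakDeriv U j w b := by
  refine exists_isWeakDeriv_of_local hU hw fun K hK hKU => ?_
  obtain ⟨θ, hθ, hθ1, -⟩ := exists_isTestFunction_eq_one hK hU hKU
  have hdθ := fun j => hθ.partialDeriv j
  have m1 : MemLp (fun x => θ x * w x) 2 := hw.memLp_mul hθ
  -- These data come from localizing the equation: Δ(θw) = div(θa + 2w∇θ) - ∇θ·a - wΔθ. Writing
  -- 2∇θ·∇w as 2 div(w∇θ) - 2wΔθ avoids the still unknown gradient of w.
  have m2 : ∀ j, MemLp (fun x => θ x * a j x + 2 * (partialDeriv j θ x * w x)) 2 := fun j =>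
    ((ha j).memLp_mul hθ).add ((hw.memLp_mul (hdθ j)).const_mul 2)
  have m3 : MemLp (fun x => -∑ j, partialDeriv j θ x * a j x - lap θ x * w x) 2 :=
    (memLp_finsetSum _ fun j _ => (ha j).memLp_mul (hdθ j)).neg.sub (hw.memLp_mul hθ.lap)
  have c0 : ∀ {f : E d → ℝ}, (∀ x ∉ tsupport θ, f x = 0) → HasCompactSupport f := fun hf =>
    HasCompactSupport.intro hθ.2.1 hf
  have z1 : ∀ x ∉ tsupport θ, θ x = 0 := fun x => image_eq_zero_of_notMem_tsupport
  have z2 : ∀ j, ∀ x ∉ tsupport θ, partialDeriv j θ x = 0 := fun j x hx =>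
    image_eq_zero_of_notMem_tsupport fun h' => hx (tsupport_partialDeriv_subset j θ h')
  have i1 : ∀ {w η φ : E d → ℝ}, LocL2 U w → IsTestFunction U η → IsTestFunction univ φ →
      Integrable (fun x => η x * w x * φ x) := fun hw hη hφ =>
    (hw.memLp_mul hη).integrable_mul (hφ.memLp 2 volume)
  obtain ⟨b, hb, hwb⟩ := exists_isWeakDeriv_of_lap m1 (c0 fun x hx => by simp [z1 x hx]) m2
    (fun j => c0 fun x hx => by simp [z1 x hx, z2 j x hx]) m3
    (c0 fun x hx => by simp [z2 _ x hx, lap_eq_zero_of_notMem_tsupport hx]) (fun φ hφ => by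
      have h1 := h _ (hθ.mul_right hφ.1)
      have hφ' := fun j => hφ.partialDeriv j
      simp_rw [lap_mul hθ.1 hφ.1, partialDeriv_mul hθ.1.differentiable_infty
        hφ.1.differentiable_infty] at h1
      have e1 : ∫ x, w x * (θ x * lap φ x + 2 * ∑ j, partialDeriv j θ x * partialDeriv j φ x
          + lap θ x * φ x) = (∫ x, θ x * w x * lap φ x)
          + 2 * (∑ j, ∫ x, partialDeriv j θ x * w x * partialDeriv j φ x)
          + ∫ x, lap θ x * w x * φ x := by
        rw [← integral_finsetSum _ fun j _ => i1 hw (hdθ j) (hφ' j), ← integral_const_mul,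
          ← integral_add (i1 hw hθ hφ.lap)
            ((integrable_finsetSum _ fun j _ => i1 hw (hdθ j) (hφ' j)).const_mul 2),
          ← integral_add _ (i1 hw hθ.lap hφ)]
        · congr 1; ext x
          simp only [mul_add, Finset.mul_sum]
          congr 1
          · congr 1
            · ring
            · exact Finset.sum_congr rfl fun j _ => by ring
          · ring
        · exact (i1 hw hθ hφ.lap).add
            ((integrable_finsetSum _ fun j _ => i1 hw (hdθ j) (hφ' j)).const_mul 2)
      have e2 : ∀ j, ∫ x, a j x * (θ x * partialDeriv j φ x + partialDeriv j θ x * φ x)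
          = (∫ x, θ x * a j x * partialDeriv j φ x) + ∫ x, partialDeriv j θ x * a j x * φ x :=
        fun j => by
          rw [← integral_add (i1 (ha j) hθ (hφ' j)) (i1 (ha j) (hdθ j) hφ)]
          congr 1; ext x; ring
      have e3 : ∀ j, ∫ x, (θ x * a j x + 2 * (partialDeriv j θ x * w x)) * partialDeriv j φ x
          = (∫ x, θ x * a j x * partialDeriv j φ x)
            + 2 * ∫ x, partialDeriv j θ x * w x * partialDeriv j φ x := fun j => by
        rw [← integral_const_mul, ← integral_add (i1 (ha j) hθ (hφ' j))
          ((i1 hw (hdθ j) (hφ' j)).const_mul 2)]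
        congr 1; ext x; ring
      have e4 : ∫ x, (-∑ j, partialDeriv j θ x * a j x - lap θ x * w x) * φ x
          = - (∑ j, ∫ x, partialDeriv j θ x * a j x * φ x) - ∫ x, lap θ x * w x * φ x := by
        have i2 : Integrable (fun x => -∑ j, partialDeriv j θ x * a j x * φ x) :=
          (integrable_finsetSum _ fun j _ => i1 (ha j) (hdθ j) hφ).neg
        rw [← integral_finsetSum _ fun j _ => i1 (ha j) (hdθ j) hφ, ← integral_neg,
          ← integral_sub i2 (i1 hw hθ.lap hφ)]
        congr 1; ext x
        rw [sub_mul, neg_mul, Finset.sum_mul]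
      rw [e1] at h1
      simp_rw [e2] at h1
      simp_rw [e3, e4, Finset.sum_add_distrib, ← Finset.mul_sum]
      simp_rw [Finset.sum_add_distrib] at h1
      linarith) j
  obtain ⟨V, hV, hKV, hV1⟩ := mem_nhdsSet_iff_exists.1 hθ1
  refine ⟨V, b, hV, hKV, hb, (hwb.mono (subset_univ V)).congr_ae hV (.of_forall fun x hx => ?_)
    (.of_forall fun x _ => rfl)⟩
  have : θ x = 1 := hV1 hx
  simp [this]

end Regularity

/-! ### Interior regularity for the Stokes problem -/

section Sobolev

variable {d : ℕ} {U : Set (E d)} {w φ : E d → ℝ}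

theorem MemH1.isWeakDeriv (h : MemH1 U w) (j : Fin d) : IsWeakDeriv U j w (weakDeriv U j w) := by
  obtain ⟨g, -, hg⟩ := h.2 j
  exact hg.isWeakDeriv_weakDeriv

theorem MemH1.memL2_weakDeriv (hU : IsOpen U) (h : MemH1 U w) (j : Fin d) :
    MemL2 U (weakDeriv U j w) := by
  obtain ⟨g, hg2, hg⟩ := h.2 j
  refine MemLp.ae_eq ?_ hg2
  refine (ae_restrict_iff' hU.measurableSet).2 ?_
  filter_upwards [hg.weakDeriv_ae hU] with x hx hxU using (hx hxU).symm

theorem weakDeriv_contDiff_ae (hU : IsOpen U) (hφ : ContDiff ℝ ∞ φ) (j : Fin d) :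
    weakDeriv U j φ =ᵐ[volume.restrict U] partialDeriv j φ :=
  (ae_restrict_iff' hU.measurableSet).2 ((isWeakDeriv_of_contDiff hφ j).weakDeriv_ae hU)

theorem IsTestFunction.memH10 (hU : IsOpen U) (hφ : IsTestFunction U φ) : MemH10 U φ := by
  refine ⟨⟨hφ.memLp _ _, fun j => ⟨CutStokes.partialDeriv j φ, (hφ.partialDeriv j).memLp _ _,
    isWeakDeriv_of_contDiff hφ.1 j⟩⟩, fun _ => φ, fun _ => hφ, ?_, fun j => ?_⟩
  · simp
  · have : eLpNorm (fun x => weakDeriv U j φ x - CutStokes.partialDeriv j φ x) 2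
        (volume.restrict U) = 0 := by
      rw [eLpNorm_congr_ae (g := 0) ?_]
      · exact eLpNorm_zero
      · filter_upwards [weakDeriv_contDiff_ae hU hφ.1 j] with x hx
        simp [hx]
    simp [this]

/-- For a test function, integrate by parts against the constant 1. The identity passes to the limit
because finite volume makes this constant square integrable. -/
theorem MemH10.integral_weakDeriv_eq_zero (hU : IsOpen U) (hU' : volume U ≠ ⊤) (h : MemH10 U w)
    (j : Fin d) : ∫ x in U, weakDeriv U j w x = 0 := by
  obtain ⟨h1, ψ, hψ, -, hl⟩ := h
  have : IsFiniteMeasure (volume.restrict U) := ⟨by simpa using hU'.lt_top⟩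
  have hm := h1.memL2_weakDeriv hU j
  have hl' : Tendsto (fun n => eLpNorm (fun x => partialDeriv j (ψ n) x - weakDeriv U j w x) 2
      (volume.restrict U)) atTop (𝓝 0) := by
    refine (hl j).congr fun n => ?_
    exact eLpNorm_sub_comm (weakDeriv U j w) (partialDeriv j (ψ n)) 2 _
  have t := tendsto_integral_mul_of_eLpNorm (g := fun _ => 1)
    (fun n => ((hψ n).partialDeriv j).memLp 2 _) hm (memLp_const 1) hl'
  refine tendsto_nhds_unique (by simpa using t) (tendsto_const_nhds.congr fun n => ?_)
  have h2 := ((hψ n).partialDeriv j).setIntegral_mul (fun _ => 1)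
  have h3 := integral_mul_partialDeriv (θ := fun _ => 1) contDiff_const (hψ n) j
  simp only [one_mul] at h2 h3
  rw [h2, h3]
  simp [partialDeriv]

end Sobolev

/-! ### The Stokes equations in the interior of Ω. -/

section Stokes

variable {d : ℕ} {Ω : Set (E d)} {f u : E d → E d} {p : E d → ℝ}

theorem memV_single (hΩ : IsOpen Ω) {φ : E d → ℝ} (hφ : IsTestFunction Ω φ) (k : Fin d) :
    MemV Ω (fun x => EuclideanSpace.single k (φ x)) := by
  intro i
  by_cases h : i = k
  · subst h; simpa using hφ.memH10 hΩ
  · simpa [h] using isTestFunction_zero.memH10 hΩ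

theorem locL2_zero {U : Set (E d)} : LocL2 U (fun _ => 0) := fun _ _ _ => MemLp.zero

theorem memQ_zero (Ω : Set (E d)) : MemQ Ω (fun _ => 0) := ⟨MemLp.zero, by simp⟩

/-- The k-th momentum equation in the sense of distributions, from the admissible test pair (φ eₖ,
0). -/
theorem IsWeakStokesSolution.momentum (hΩ : IsOpen Ω) (h : IsWeakStokesSolution Ω f u p)
    {φ : E d → ℝ} (hφ : IsTestFunction Ω φ) (k : Fin d) :
    (∑ j, ∫ x, weakDeriv Ω j (fun y => u y k) x * partialDeriv j φ x)
      - ∫ x, p x * partialDeriv k φ x = ∫ x, f x k * φ x := by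
  have h1 := h.2.2 _ _ (memV_single hΩ hφ k) (memQ_zero Ω)
  have hd : ∀ i j, weakDeriv Ω j (fun y => (EuclideanSpace.single k (φ y) : E d) i)
      =ᵐ[volume.restrict Ω] fun x => if i = k then partialDeriv j φ x else 0 := fun i j => by
    by_cases hik : i = k
    · subst hik; simpa using weakDeriv_contDiff_ae hΩ hφ.1 j
    · have := weakDeriv_contDiff_ae hΩ (φ := fun _ => 0) contDiff_const j
      simp only [hik, if_false, PiLp.single_apply]
      refine this.trans (.of_forall fun x => by simp [partialDeriv])
  have e1 : formA Ω u (fun x => EuclideanSpace.single k (φ x))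
      = ∑ j, ∫ x, weakDeriv Ω j (fun y => u y k) x * partialDeriv j φ x := by
    rw [formA, ← integral_finsetSum _ fun j _ => (hφ.partialDeriv j).integrable_mul hΩ
      ((h.1 k).1.isWeakDeriv j).2.1]
    have hz : ∀ x ∉ Ω, ∑ j, weakDeriv Ω j (fun y => u y k) x * partialDeriv j φ x = 0 :=
      fun x hx => Finset.sum_eq_zero fun j _ => by rw [(hφ.partialDeriv j).eq_zero hx, mul_zero]
    rw [← setIntegral_eq_integral_of_forall_compl_eq_zero hz]
    refine integral_congr_ae ?_
    filter_upwards [ae_all_iff.2 fun i => ae_all_iff.2 fun j => hd i j] with x hx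
    simp only [hx]
    simp
  have e2 : formB Ω u (fun _ => 0) = 0 := by simp [formB]
  have e3 : formB Ω (fun x => EuclideanSpace.single k (φ x)) p
      = - ∫ x, p x * partialDeriv k φ x := by
    rw [formB, ← (hφ.partialDeriv k).setIntegral_mul]
    congr 1
    refine integral_congr_ae ?_
    filter_upwards [ae_all_iff.2 fun i => hd i i] with x hx
    simp only [hx]
    simp [mul_comm]
  rw [e1, e2, e3] at h1
  rw [← hφ.setIntegral_mul]
  have e4 : ∀ x, ∑ i, f x i * (EuclideanSpace.single k (φ x) : E d) i = f x k * φ x := fun x => by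
    simp
  simp_rw [e4] at h1
  linarith

/-- The divergence of an H¹₀ field has mean zero, so q = div u is an admissible pressure. With v = 0
the weak equation becomes ∫ (div u)² = 0. -/
theorem IsWeakStokesSolution.div_eq_zero (hΩ : IsOpen Ω) (hΩ' : volume Ω ≠ ⊤)
    (h : IsWeakStokesSolution Ω f u p) :
    ∀ᵐ x, x ∈ Ω → ∑ k, weakDeriv Ω k (fun y => u y k) x = 0 := by
  set q : E d → ℝ := fun x => ∑ k, weakDeriv Ω k (fun y => u y k) x with hq
  have : IsFiniteMeasure (volume.restrict Ω) := ⟨by simpa using hΩ'.lt_top⟩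
  have hm : ∀ k, MemL2 Ω (weakDeriv Ω k (fun y => u y k)) := fun k =>
    (h.1 k).1.memL2_weakDeriv hΩ k
  have hqm : MemL2 Ω q := memLp_finsetSum _ fun k _ => hm k
  have hqQ : MemQ Ω q := by
    refine ⟨hqm, ?_⟩
    rw [hq, integral_finsetSum _ fun k _ => (hm k).integrable (by norm_num)]
    exact Finset.sum_eq_zero fun k _ => (h.1 k).integral_weakDeriv_eq_zero hΩ hΩ' k
  have hV0 : MemV Ω (fun _ => (0 : E d)) := fun i => by
    simpa using isTestFunction_zero.memH10 hΩ
  have h1 := h.2.2 _ _ hV0 hqQ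
  have hd : ∀ j : Fin d, weakDeriv Ω j (fun _ => (0 : ℝ)) =ᵐ[volume.restrict Ω] fun _ => 0 :=
    fun j => (weakDeriv_contDiff_ae hΩ (φ := fun _ => 0) contDiff_const j).trans
      (.of_forall fun x => by simp [partialDeriv])
  have e1 : formA Ω u (fun _ => 0) = 0 := by
    refine integral_eq_zero_of_ae ?_
    filter_upwards [ae_all_iff.2 hd] with x hx
    simp [hx]
  have e2 : formB Ω (fun _ => 0) p = 0 := by
    rw [formB, neg_eq_zero]
    refine integral_eq_zero_of_ae ?_
    filter_upwards [ae_all_iff.2 hd] with x hx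
    simp [hx]
  rw [e1, e2, formB] at h1
  have h2 : ∫ x in Ω, q x * q x = 0 := by simpa using h1
  rw [integral_eq_zero_iff_of_nonneg (fun x => mul_self_nonneg _) (hqm.integrable_mul hqm)] at h2
  have := (ae_restrict_iff' hΩ.measurableSet).1 h2
  filter_upwards [this] with x hx hxΩ using mul_self_eq_zero.1 (hx hxΩ)

/-- A weak solution of the Stokes system with square integrable right-hand side is locally in
`H² × H¹`, and the momentum equation holds almost everywhere. -/
theorem stokes_regularity {U : Set (E d)} (hU : IsOpen U) {u f : Fin d → E d → ℝ} {p : E d → ℝ}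
    {g : Fin d → Fin d → E d → ℝ} (hg : ∀ k j, LocL2 U (g k j))
    (hug : ∀ k j, IsWeakDeriv U j (u k) (g k j)) (hp : LocL2 U p) (hf : ∀ k, LocL2 U (f k))
    (hmom : ∀ φ, IsTestFunction U φ → ∀ k, (∑ j, ∫ x, g k j x * partialDeriv j φ x)
      - ∫ x, p x * partialDeriv k φ x = ∫ x, f k x * φ x)
    (hdiv : ∀ᵐ x, x ∈ U → ∑ k, g k k x = 0) :
    ∃ (H : Fin d → Fin d → Fin d → E d → ℝ) (π : Fin d → E d → ℝ),
      (∀ k j i, LocL2 U (H k j i) ∧ IsWeakDeriv U i (g k j) (H k j i)) ∧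
      (∀ k, LocL2 U (π k) ∧ IsWeakDeriv U k p (π k)) ∧
      ∀ᵐ x, x ∈ U → ∀ k, ∑ j, H k j j x - π k x = - f k x := by
  have I : ∀ {w φ : E d → ℝ}, LocL2 U w → IsTestFunction U φ → Integrable (fun x => w x * φ x) :=
    fun hw hφ => hφ.integrable_mul hU (hw.locallyIntegrableOn hU)
  -- mixed derivatives commute
  have hcomm : ∀ φ, IsTestFunction U φ → ∀ k i j,
      ∫ x, g k i x * partialDeriv j φ x = ∫ x, g k j x * partialDeriv i φ x := by
    intro φ hφ k i j
    have h1 := (hug k i).integral_eq (hφ.partialDeriv j)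
    have h2 := (hug k j).integral_eq (hφ.partialDeriv i)
    rw [partialDeriv_comm hφ.1 i j] at h1
    linarith
  have hlap : ∀ φ, IsTestFunction U φ → ∀ l k,
      ∫ x, g l k x * lap φ x = ∑ j, ∫ x, g l j x * partialDeriv j (partialDeriv k φ) x := by
    intro φ hφ l k
    simp_rw [lap, Finset.mul_sum]
    rw [integral_finsetSum _ fun j _ => I (hg l k) ((hφ.partialDeriv j).partialDeriv j)]
    refine Finset.sum_congr rfl fun j _ => ?_
    rw [hcomm _ (hφ.partialDeriv j) l k j, partialDeriv_comm hφ.1 j k]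
  -- the vorticity
  have hω : ∀ k l j, ∃ b, LocL2 U b ∧ IsWeakDeriv U j (fun x => g l k x - g k l x) b := by
    intro k l j
    -- Testing the l-th momentum equation with ∂ₖφ and the k-th with ∂ₗφ, and subtracting, cancels
    -- the pressure. The vorticity ∂ₖuₗ - ∂ₗuₖ thus has Laplacian ∂ₗfₖ - ∂ₖfₗ, which is the
    -- divergence of this field a.
    refine exists_isWeakDeriv_of_lap_eq_div (a := fun j x =>
      (if j = l then f k x else 0) - (if j = k then f l x else 0)) hU
      ((hg l k).sub (hg k l)) (fun j => ?_) (fun φ hφ => ?_) j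
    · refine LocL2.sub ?_ ?_
      · by_cases h : j = l
        · simpa [h] using hf k
        · simpa [h] using locL2_zero
      · by_cases h : j = k
        · simpa [h] using hf l
        · simpa [h] using locL2_zero
    · have h1 := hmom _ (hφ.partialDeriv k) l
      have h2 := hmom _ (hφ.partialDeriv l) k
      rw [← hlap φ hφ] at h1 h2
      rw [partialDeriv_comm hφ.1 l k] at h1
      have e1 : ∫ x, (g l k x - g k l x) * lap φ x
          = (∫ x, g l k x * lap φ x) - ∫ x, g k l x * lap φ x := by
        rw [← integral_sub (I (hg l k) hφ.lap) (I (hg k l) hφ.lap)]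
        congr 1; ext x; ring
      have e2 : ∀ j, ∫ x, ((if j = l then f k x else 0) - (if j = k then f l x else 0))
            * partialDeriv j φ x
          = (if j = l then ∫ x, f k x * partialDeriv j φ x else 0)
            - (if j = k then ∫ x, f l x * partialDeriv j φ x else 0) := fun j => by
        have i1 := I (hf k) (hφ.partialDeriv j)
        have i2 := I (hf l) (hφ.partialDeriv j)
        split_ifs
        · rw [← integral_sub i1 i2]; simp only [sub_mul]
        · simp
        · rw [zero_sub, ← integral_neg]; simp
        · simp
      simp_rw [e1, e2, Finset.sum_sub_distrib]
      simp only [Finset.sum_ite_eq', Finset.mem_univ, if_true]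
      linarith
  choose b hb hωb using hω
  -- the Laplacian of the velocity
  set L : Fin d → E d → ℝ := fun l x => ∑ j, b j l j x with hL
  have hLL : ∀ l, LocL2 U (L l) := fun l => LocL2.sum fun j _ => hb j l j
  have hΔ : ∀ φ, IsTestFunction U φ → ∀ l,
      ∑ j, ∫ x, g l j x * partialDeriv j φ x = - ∫ x, L l x * φ x := by
    intro φ hφ l
    -- Incompressibility enters here: ∑ⱼ ∂ⱼ∂ₗuⱼ = ∂ₗ div u = 0, hence Δuₗ is the sum over j of the
    -- ∂ⱼ-derivatives of the vorticities ∂ⱼuₗ - ∂ₗuⱼ.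
    have hz : ∑ j, ∫ x, g j l x * partialDeriv j φ x = 0 := by
      simp_rw [fun j => hcomm φ hφ j l j]
      rw [← integral_finsetSum _ fun j _ => I (hg j j) (hφ.partialDeriv l)]
      refine integral_eq_zero_of_ae ?_
      filter_upwards [hdiv] with x hx
      rw [← Finset.sum_mul]
      by_cases hxU : x ∈ U
      · simp [hx hxU]
      · simp [(hφ.partialDeriv l).eq_zero hxU]
    have h1 : ∀ j, (∫ x, g l j x * partialDeriv j φ x) - (∫ x, g j l x * partialDeriv j φ x)
        = - ∫ x, b j l j x * φ x := fun j => by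
      rw [← (hωb j l j).integral_eq hφ, ← integral_sub (I (hg l j) (hφ.partialDeriv j))
        (I (hg j l) (hφ.partialDeriv j))]
      congr 1; ext x; ring
    have h2 := Finset.sum_congr rfl fun j (_ : j ∈ Finset.univ) => h1 j
    rw [Finset.sum_sub_distrib, hz, sub_zero, Finset.sum_neg_distrib,
      ← integral_finsetSum _ fun j _ => I (hb j l j) hφ] at h2
    rw [h2]
    congr 2; ext x; rw [hL, Finset.sum_mul]
  -- Now Δ(∂ₖuₗ) = ∂ₖLₗ with Lₗ locally square integrable, again an equation in divergence form.
  have hH : ∀ l k i, ∃ h, LocL2 U h ∧ IsWeakDeriv U i (g l k) h := by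
    intro l k i
    refine exists_isWeakDeriv_of_lap_eq_div (a := fun j x => if j = k then L l x else 0) hU
      (hg l k) (fun j => ?_) (fun φ hφ => ?_) i
    · by_cases h : j = k
      · simpa [h] using hLL l
      · simpa [h] using locL2_zero
    · rw [hlap φ hφ, hΔ _ (hφ.partialDeriv k)]
      congr 1
      rw [Finset.sum_eq_single k]
      · simp
      · intro j _ hj; simp [hj]
      · simp
  choose H hHL hH using hH
  -- The momentum equation forces the pressure gradient to be Δu + f.
  refine ⟨H, fun k x => L k x + f k x, fun k j i => ⟨hHL k j i, hH k j i⟩, fun k =>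
    ⟨(hLL k).add (hf k), isWeakDeriv_iff.2 ⟨hp.locallyIntegrableOn hU,
      ((hLL k).add (hf k)).locallyIntegrableOn hU, fun φ hφ => ?_⟩⟩, ?_⟩
  · have h1 := hmom φ hφ k
    rw [hΔ φ hφ] at h1
    simp_rw [add_mul]
    rw [integral_add (I (hLL k) hφ) (I (hf k) hφ)]
    linarith
  · have hLH : ∀ k, ∀ᵐ x, x ∈ U → ∑ j, H k j j x = L k x := fun k => by
      have hs : LocL2 U (fun x => ∑ j, H k j j x) := LocL2.sum fun j _ => hHL k j j
      refine ae_eq_of_integral_mul_test hU (hs.locallyIntegrableOn hU)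
        ((hLL k).locallyIntegrableOn hU) fun φ hφ => ?_
      have h1 := hΔ φ hφ k
      simp_rw [fun j => (hH k j j).integral_eq hφ, Finset.sum_neg_distrib] at h1
      rw [← integral_finsetSum _ fun j _ => I (hHL k j j) hφ] at h1
      simp_rw [Finset.sum_mul]
      linarith
    filter_upwards [ae_all_iff.2 hLH] with x hx hxU k
    rw [hx k hxU]; ring

end Stokes

/-! ### Hyperplanes -/

section Hyperplane

variable {d : ℕ} {ν : E d} {c : ℝ}

/-- The hyperplane `{x | ⟪ν, x⟫ = c}`. -/
def hyper (ν : E d) (c : ℝ) : Set (E d) := {x | inner ℝ ν x = c}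

/-- The side of the hyperplane `hyper ν c` into which `ν` points. -/
def above (ν : E d) (c : ℝ) : Set (E d) := {x | c < inner ℝ ν x}

/-- The surface measure in codimension one. -/
def area (d : ℕ) : Measure (E d) := Measure.euclideanHausdorffMeasure (d - 1)

/-- The point with foot point `y` at signed distance `t` from the hyperplane `hyper ν c`. -/
def par (ν : E d) (c : ℝ) (y : (Submodule.span ℝ {ν})ᗮ) (t : ℝ) : E d := (y : E d) + (c + t) • ν

theorem isClosed_hyper (ν : E d) (c : ℝ) : IsClosed (hyper ν c) :=
  isClosed_eq (by fun_prop) continuous_const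

theorem isOpen_above (ν : E d) (c : ℝ) : IsOpen (above ν c) :=
  isOpen_lt continuous_const (by fun_prop)

theorem convex_above (ν : E d) (c : ℝ) : Convex ℝ (above ν c) :=
  convex_halfSpace_gt (f := fun x => inner ℝ ν x)
    ⟨fun x y => inner_add_right ν x y, fun a x => by rw [inner_smul_right]; rfl⟩ c

theorem above_neg (ν : E d) (c : ℝ) : above (-ν) (-c) = {x | inner ℝ ν x < c} := by
  ext x; simp [above, inner_neg_left]

theorem hyper_neg (ν : E d) (c : ℝ) : hyper (-ν) (-c) = hyper ν c := by
  ext x; simp [hyper, inner_neg_left]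

theorem inner_coe_orthogonal (y : (Submodule.span ℝ {ν})ᗮ) : inner ℝ ν (y : E d) = 0 :=
  Submodule.mem_orthogonal_singleton_iff_inner_right.1 y.2

theorem inner_par (hν : ‖ν‖ = 1) (y : (Submodule.span ℝ {ν})ᗮ) (t : ℝ) :
    inner ℝ ν (par ν c y t) = c + t := by
  rw [par, inner_add_right, inner_coe_orthogonal, inner_smul_right, real_inner_self_eq_norm_sq, hν]
  ring

theorem continuous_par : Continuous fun q : (Submodule.span ℝ {ν})ᗮ × ℝ => par ν c q.1 q.2 := by
  unfold par; fun_prop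

theorem dist_par_sq (hν : ‖ν‖ = 1) (y y' : (Submodule.span ℝ {ν})ᗮ) (t t' : ℝ) :
    dist (par ν c y t) (par ν c y' t') ^ 2 = dist y y' ^ 2 + (t - t') ^ 2 := by
  have h : par ν c y t - par ν c y' t' = ((y - y' : (Submodule.span ℝ {ν})ᗮ) : E d)
      + (t - t') • ν := by
    simp only [par, Submodule.coe_sub]; module
  have h0 : inner ℝ ((y - y' : (Submodule.span ℝ {ν})ᗮ) : E d) ν = 0 := by
    rw [real_inner_comm]; exact inner_coe_orthogonal _
  rw [dist_eq_norm, dist_eq_norm, h, norm_add_sq_real, inner_smul_right, h0, norm_smul, hν]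
  simp

theorem isometry_par (hν : ‖ν‖ = 1) (t : ℝ) : Isometry fun y => par ν c y t :=
  Isometry.of_dist_eq fun y y' => by
    have := dist_par_sq (c := c) hν y y' t t
    rw [sub_self, zero_pow two_ne_zero, add_zero] at this
    exact (sq_eq_sq₀ dist_nonneg dist_nonneg).1 this

theorem range_par_zero (hν : ‖ν‖ = 1) : range (fun y => par ν c y 0) = hyper ν c := by
  ext x
  refine ⟨?_, fun hx => ?_⟩
  · rintro ⟨y, rfl⟩
    simp [hyper, inner_par hν]
  · refine ⟨⟨x - c • ν, ?_⟩, ?_⟩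
    · rw [Submodule.mem_orthogonal_singleton_iff_inner_right, inner_sub_right, inner_smul_right,
        real_inner_self_eq_norm_sq, hν]
      have : inner ℝ ν x = c := hx
      simp [this]
    · simp [par]

theorem finrank_orthogonal_span (hν : ‖ν‖ = 1) :
    Module.finrank ℝ (Submodule.span ℝ {ν})ᗮ = d - 1 := by
  have h0 : ν ≠ 0 := by rintro rfl; simp at hν
  have h1 := (Submodule.span ℝ {ν}).finrank_add_finrank_orthogonal
  rw [finrank_span_singleton h0, finrank_euclideanSpace_fin] at h1
  omega

/-- The map y ↦ y + cν is an isometry of ν⊥ onto the hyperplane, and on ν⊥, of dimension d - 1,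
Hausdorff measure of that dimension is Lebesgue measure. -/
theorem area_restrict_hyper (hν : ‖ν‖ = 1) :
    (area d).restrict (hyper ν c) = volume.map fun y => par ν c y 0 := by
  have h := (isometry_par (c := c) hν 0).map_euclideanHausdorffMeasure (d := d - 1)
  rw [range_par_zero hν, ← finrank_orthogonal_span hν,
    InnerProductSpace.euclideanHausdorffMeasure_eq_volume] at h
  rw [h, area, finrank_orthogonal_span hν]

theorem measurableEmbedding_par_zero (hν : ‖ν‖ = 1) :
    MeasurableEmbedding fun y => par ν c y 0 :=
  (isometry_par hν 0).isClosedEmbedding.measurableEmbedding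

/-- Space is the orthogonal sum of ν⊥ and the line ℝν, and a translation by cν does no harm. This is
what makes Fubini along normal lines available. -/
theorem measurePreserving_par (hν : ‖ν‖ = 1) :
    MeasurePreserving (fun q : (Submodule.span ℝ {ν})ᗮ × ℝ => par ν c q.1 q.2)
      (volume.prod volume) volume := by
  have h1 := ((Submodule.span ℝ {ν}).measurePreserving_measurableEquivProd (c • ν)).symm
  rw [InnerProductSpace.euclideanHausdorffMeasure_eq_volume] at h1
  have h2 := (LinearIsometryEquiv.toSpanUnitSingleton (𝕜 := ℝ) ν hν).measurePreserving
  have h3 := h1.comp ((h2.prod (MeasurePreserving.id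
    (volume : Measure (Submodule.span ℝ {ν})ᗮ))).comp Measure.measurePreserving_swap)
  refine (congrArg (fun f => MeasurePreserving f (volume.prod volume) volume) ?_).mp h3
  ext1 q
  change _ = (q.1 : E d) + (c + q.2) • ν
  simp
  module

theorem measurableEquiv_par (hν : ‖ν‖ = 1) :
    MeasurableEmbedding (fun q : (Submodule.span ℝ {ν})ᗮ × ℝ => par ν c q.1 q.2) := by
  refine (Topology.IsClosedEmbedding.measurableEmbedding ?_)
  -- The product carries the maximum metric, so the coordinate map is bi-Lipschitz rather than
  -- isometric.
  refine AntilipschitzWith.isClosedEmbedding (K := 1) ?_ ?_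
  · refine AntilipschitzWith.of_le_mul_dist fun q q' => ?_
    have := dist_par_sq (c := c) hν q.1 q'.1 q.2 q'.2
    rw [NNReal.coe_one, one_mul, Prod.dist_eq]
    refine max_le ?_ ?_
    · exact (sq_le_sq₀ dist_nonneg dist_nonneg).1 (by rw [this]; nlinarith [sq_nonneg (q.2 - q'.2)])
    · refine (sq_le_sq₀ dist_nonneg dist_nonneg).1 ?_
      rw [this, Real.dist_eq, sq_abs]; nlinarith [sq_nonneg (dist q.1 q'.1)]
  · have hl : LipschitzWith 2 (fun q : (Submodule.span ℝ {ν})ᗮ × ℝ => par ν c q.1 q.2) := by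
      refine LipschitzWith.of_dist_le_mul fun q q' => ?_
      have := dist_par_sq (c := c) hν q.1 q'.1 q.2 q'.2
      refine (sq_le_sq₀ dist_nonneg (by positivity)).1 ?_
      have h1 : dist q.1 q'.1 ≤ dist q q' := le_max_left _ _
      have h2 : dist q.2 q'.2 ≤ dist q q' := le_max_right _ _
      rw [this, ← sq_abs (q.2 - q'.2), ← Real.dist_eq]
      have h3 : ((2 : NNReal) : ℝ) = 2 := rfl
      rw [h3]
      nlinarith [dist_nonneg (x := q.1) (y := q'.1), dist_nonneg (x := q.2) (y := q'.2)]
    exact hl.uniformContinuous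

theorem lintegral_hyper (hν : ‖ν‖ = 1) (g : E d → ENNReal) :
    ∫⁻ x in hyper ν c, g x ∂(area d) = ∫⁻ y, g (par ν c y 0) := by
  rw [area_restrict_hyper hν, (measurableEmbedding_par_zero hν).lintegral_map]

theorem integral_hyper (hν : ‖ν‖ = 1) (g : E d → ℝ) :
    ∫ x in hyper ν c, g x ∂(area d) = ∫ y, g (par ν c y 0) := by
  rw [area_restrict_hyper hν, (measurableEmbedding_par_zero hν).integral_map]

theorem ae_hyper_iff (hν : ‖ν‖ = 1) {P : E d → Prop} :
    (∀ᵐ x ∂(area d).restrict (hyper ν c), P x) ↔ ∀ᵐ y, P (par ν c y 0) := by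
  rw [area_restrict_hyper hν, (measurableEmbedding_par_zero hν).ae_map_iff]

theorem ae_par (hν : ‖ν‖ = 1) {P : E d → Prop} (h : ∀ᵐ x, P x) :
    ∀ᵐ q ∂((volume : Measure (Submodule.span ℝ {ν})ᗮ).prod (volume : Measure ℝ)),
      P (par ν c q.1 q.2) :=
  (measurePreserving_par hν).quasiMeasurePreserving.ae h

end Hyperplane

/-! ### Traces on hyperplanes -/

section Trace

variable {d : ℕ} {ν : E d} {c : ℝ} {F : E d → ℝ} {Fn : ℕ → E d → ℝ}

/-- The size of the gradient of the increment of a sequence of functions. -/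
def gap (Fn : ℕ → E d → ℝ) (n : ℕ) (x : E d) : ENNReal :=
  ‖fderiv ℝ (fun y => Fn (n + 1) y - Fn n y) x‖ₑ

/-- Test functions that converge to `F` almost everywhere with summable gradient increments. -/
structure RapidApprox (F : E d → ℝ) (Fn : ℕ → E d → ℝ) : Prop where
  test : ∀ n, IsTestFunction univ (Fn n)
  sum_ne_top : ∑' n, ∫⁻ x, gap Fn n x ≠ ⊤
  ae_tendsto : ∀ᵐ x, Tendsto (fun n => Fn n x) atTop (𝓝 (F x))

/-- The integral of `gap` along the normal line through `y`. -/
def lineGap (ν : E d) (c : ℝ) (Fn : ℕ → E d → ℝ) (n : ℕ) (y : (Submodule.span ℝ {ν})ᗮ) : ENNReal :=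
  ∫⁻ t, gap Fn n (par ν c y t)

/-- The tail sums of `lineGap`. -/
def tailGap (ν : E d) (c : ℝ) (Fn : ℕ → E d → ℝ) (n : ℕ) (y : (Submodule.span ℝ {ν})ᗮ) : ENNReal :=
  ∑' k, lineGap ν c Fn (n + k) y

/-- The precise representative of the limit of a sequence of functions. -/
def preciseLim (Fn : ℕ → E d → ℝ) (x : E d) : ℝ := limUnder atTop fun n => Fn n x

theorem RapidApprox.measurable_gap (h : RapidApprox F Fn) (n : ℕ) : Measurable (gap Fn n) := by
  have : Continuous (fderiv ℝ (fun y => Fn (n + 1) y - Fn n y)) :=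
    ((h.test (n + 1)).1.sub (h.test n).1).continuous_fderiv (by simp)
  exact this.enorm.measurable

theorem RapidApprox.measurable_lineGap (h : RapidApprox F Fn) (n : ℕ) :
    Measurable (lineGap ν c Fn n) :=
  ((h.measurable_gap n).comp continuous_par.measurable).lintegral_prod_right'

theorem RapidApprox.measurable_tailGap (h : RapidApprox F Fn) (n : ℕ) :
    Measurable (tailGap ν c Fn n) :=
  Measurable.tsum fun _ => h.measurable_lineGap _

theorem RapidApprox.lintegral_lineGap (h : RapidApprox F Fn) (hν : ‖ν‖ = 1) (n : ℕ) :
    ∫⁻ y, lineGap ν c Fn n y = ∫⁻ x, gap Fn n x := by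
  rw [← (measurePreserving_par (c := c) hν).lintegral_comp (h.measurable_gap n),
    lintegral_prod (fun q : (Submodule.span ℝ {ν})ᗮ × ℝ => gap Fn n (par ν c q.1 q.2))
      ((h.measurable_gap n).comp continuous_par.measurable).aemeasurable]
  rfl

theorem RapidApprox.lintegral_tailGap (h : RapidApprox F Fn) (hν : ‖ν‖ = 1) (n : ℕ) :
    ∫⁻ y, tailGap ν c Fn n y = ∑' k, ∫⁻ x, gap Fn (n + k) x := by
  simp only [tailGap]
  rw [lintegral_tsum fun _ => (h.measurable_lineGap _).aemeasurable]
  simp only [h.lintegral_lineGap hν]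

theorem RapidApprox.tendsto_lintegral_tailGap (h : RapidApprox F Fn) (hν : ‖ν‖ = 1) :
    Tendsto (fun n => ∫⁻ y, tailGap ν c Fn n y) atTop (𝓝 0) := by
  simp only [h.lintegral_tailGap hν]
  simpa only [add_comm] using ENNReal.tendsto_sum_nat_add _ h.sum_ne_top

theorem RapidApprox.lintegral_tailGap_ne_top (h : RapidApprox F Fn) (hν : ‖ν‖ = 1) (n : ℕ) :
    ∫⁻ y, tailGap ν c Fn n y ≠ ⊤ := by
  rw [h.lintegral_tailGap hν]
  refine ne_top_of_le_ne_top h.sum_ne_top ?_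
  exact ENNReal.tsum_comp_le_tsum_of_injective (add_right_injective n) fun k => ∫⁻ x, gap Fn k x

theorem RapidApprox.ae_tailGap_ne_top (h : RapidApprox F Fn) (hν : ‖ν‖ = 1) :
    ∀ᵐ y, tailGap ν c Fn 0 y ≠ ⊤ :=
  (ae_lt_top (h.measurable_tailGap 0) (h.lintegral_tailGap_ne_top hν 0)).mono fun _ h => h.ne

theorem tendsto_tailGap {y : (Submodule.span ℝ {ν})ᗮ} (hy : tailGap ν c Fn 0 y ≠ ⊤) :
    Tendsto (fun n => tailGap ν c Fn n y) atTop (𝓝 0) := by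
  simp only [tailGap, zero_add] at hy ⊢
  simpa only [add_comm] using ENNReal.tendsto_sum_nat_add _ hy

/-- The fundamental theorem of calculus along the normal line, applied to the compactly supported
increment. The bound is independent of t, so finite sums of `lineGap` give uniform convergence on
the whole line through y. -/
theorem RapidApprox.edist_succ_le (h : RapidApprox F Fn) (hν : ‖ν‖ = 1) (n : ℕ)
    (y : (Submodule.span ℝ {ν})ᗮ) (t : ℝ) :
    edist (Fn n (par ν c y t)) (Fn (n + 1) (par ν c y t)) ≤ lineGap ν c Fn n y := by
  set g : E d → ℝ := fun y => Fn (n + 1) y - Fn n y with hg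
  have hgt : IsTestFunction univ g := (h.test (n + 1)).sub (h.test n)
  have hpd : ∀ t, HasDerivAt (fun t => par ν c y t) ν t := fun t => by
    have : HasDerivAt (fun t : ℝ => (y : E d) + (c + t) • ν) ((1 : ℝ) • ν) t :=
      (((hasDerivAt_id t).const_add c).smul_const ν).const_add _
    simpa [par] using this
  have hpc : ContDiff ℝ ∞ (fun t => par ν c y t) := by unfold par; fun_prop
  have hcs : HasCompactSupport (fun t => g (par ν c y t)) := by
    refine hgt.2.1.comp_isClosedEmbedding ?_
    have : Isometry fun t => par ν c y t := Isometry.of_dist_eq fun t t' => by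
      have := dist_par_sq (c := c) hν y y t t'
      rw [dist_self, zero_pow two_ne_zero, zero_add, ← sq_abs (t - t'), ← Real.dist_eq] at this
      exact (sq_eq_sq₀ dist_nonneg dist_nonneg).1 this
    exact this.isClosedEmbedding
  have hcd : ContDiff ℝ 1 (fun t => g (par ν c y t)) := (hgt.1.comp hpc).of_le (by simp)
  have h1 := hcs.enorm_le_lintegral_Ici_deriv hcd t
  rw [edist_comm, edist_eq_enorm_sub]
  refine (h1.trans (setLIntegral_le_lintegral _ _)).trans (lintegral_mono fun s => ?_)
  have h2 := (hgt.1.differentiable_infty (par ν c y s)).hasFDerivAt.comp_hasDerivAt s (hpd s)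
  rw [show deriv (fun t => g (par ν c y t)) s = _ from h2.deriv]
  refine (ContinuousLinearMap.le_opENorm _ _).trans ?_
  have : ‖ν‖ₑ = 1 := by rw [← ofReal_norm, hν]; simp
  rw [this, mul_one, gap]

theorem RapidApprox.tendsto_preciseLim (h : RapidApprox F Fn) (hν : ‖ν‖ = 1)
    {y : (Submodule.span ℝ {ν})ᗮ} (hy : tailGap ν c Fn 0 y ≠ ⊤) (t : ℝ) :
    Tendsto (fun n => Fn n (par ν c y t)) atTop (𝓝 (preciseLim Fn (par ν c y t))) := by
  exact CauchySeq.tendsto_limUnder (cauchySeq_of_edist_le_of_tsum_ne_top _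
    (fun n => h.edist_succ_le hν n y t) (by simpa [tailGap] using hy))

theorem RapidApprox.edist_preciseLim_le (h : RapidApprox F Fn) (hν : ‖ν‖ = 1)
    {y : (Submodule.span ℝ {ν})ᗮ} (hy : tailGap ν c Fn 0 y ≠ ⊤) (t : ℝ) (n : ℕ) :
    edist (Fn n (par ν c y t)) (preciseLim Fn (par ν c y t)) ≤ tailGap ν c Fn n y :=
  edist_le_tsum_of_edist_le_of_tendsto _ (fun n => h.edist_succ_le hν n y t)
    (h.tendsto_preciseLim hν hy t) n

/-- L¹ convergence on the hyperplane itself: the error at the foot point is at most the tail sum,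
whose integral over ν⊥ is a tail of the convergent series of gradient gaps. -/
theorem RapidApprox.tendsto_lintegral_edist (h : RapidApprox F Fn) (hν : ‖ν‖ = 1) :
    Tendsto (fun n => ∫⁻ x in hyper ν c, edist (Fn n x) (preciseLim Fn x) ∂(area d)) atTop (𝓝 0) := by
  refine tendsto_of_tendsto_of_tendsto_of_le_of_le tendsto_const_nhds
    (h.tendsto_lintegral_tailGap (c := c) hν) (fun _ => zero_le) fun n => ?_
  simp only
  rw [lintegral_hyper hν]
  refine lintegral_mono_ae ?_
  filter_upwards [h.ae_tailGap_ne_top hν] with y hy using h.edist_preciseLim_le hν hy 0 n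

theorem RapidApprox.ae_hyper_tendsto (h : RapidApprox F Fn) (hν : ‖ν‖ = 1) :
    ∀ᵐ x ∂(area d).restrict (hyper ν c),
      Tendsto (fun n => Fn n x) atTop (𝓝 (preciseLim Fn x)) := by
  rw [ae_hyper_iff hν]
  filter_upwards [h.ae_tailGap_ne_top hν] with y hy using h.tendsto_preciseLim hν hy 0

theorem tendsto_average_of_lintegral {A : ℝ → Set (E d)} {a : ℝ}
    (hA : ∀ r, 0 < r → volume (A r) ≠ 0 ∧ volume (A r) ≠ ⊤ ∧ IntegrableOn F (A r))
    (h : Tendsto (fun r => (∫⁻ z in A r, edist (F z) a) / volume (A r)) (𝓝[>] 0) (𝓝 0)) :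
    Tendsto (fun r => ⨍ z in A r, F z) (𝓝[>] 0) (𝓝 a) := by
  rw [tendsto_iff_edist_tendsto_0]
  refine tendsto_of_tendsto_of_tendsto_of_le_of_le' tendsto_const_nhds h
    (.of_forall fun _ => zero_le) ?_
  filter_upwards [self_mem_nhdsWithin] with r hr
  obtain ⟨h0, h1, hi⟩ := hA r hr
  have hfin : IsFiniteMeasure (volume.restrict (A r)) := ⟨by simpa using h1.lt_top⟩
  have hne : NeZero (volume.restrict (A r)) := ⟨by simpa [Measure.restrict_eq_zero] using h0⟩
  have e1 : (⨍ z in A r, F z) - a = ⨍ z in A r, (F z - a) := by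
    rw [average, average, integral_sub, integral_const, probReal_univ, one_smul]
    · exact Integrable.to_average hi
    · exact integrable_const a
  rw [edist_eq_enorm_sub, e1, average]
  refine (enorm_integral_le_lintegral_enorm _).trans ?_
  rw [lintegral_smul_measure, ENNReal.div_eq_inv_mul, Measure.restrict_apply_univ]
  simp only [edist_eq_enorm_sub]
  rfl

theorem subset_preimage_par (hν : ‖ν‖ = 1) (y : (Submodule.span ℝ {ν})ᗮ) {r : ℝ} (hr : 0 < r) :
    Metric.closedBall y (r / 2) ×ˢ Ioo 0 (r / 2) ⊆
      (fun q : (Submodule.span ℝ {ν})ᗮ × ℝ => par ν c q.1 q.2) ⁻¹'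
        (Metric.ball (par ν c y 0) r ∩ above ν c) := by
  rintro ⟨y', t⟩ ⟨h1, h2⟩
  simp only [Metric.mem_closedBall, mem_Ioo] at h1 h2
  refine ⟨?_, ?_⟩
  · simp only [Metric.mem_ball]
    refine (sq_lt_sq₀ dist_nonneg hr.le).1 ?_
    rw [dist_par_sq hν]
    nlinarith [dist_nonneg (x := y') (y := y)]
  · simp only [above, mem_ofPred_eq, inner_par hν]
    linarith

theorem preimage_par_subset (hν : ‖ν‖ = 1) (y : (Submodule.span ℝ {ν})ᗮ) {r : ℝ} (hr : 0 < r) :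
    (fun q : (Submodule.span ℝ {ν})ᗮ × ℝ => par ν c q.1 q.2) ⁻¹'
        (Metric.ball (par ν c y 0) r ∩ above ν c) ⊆ Metric.closedBall y r ×ˢ Icc 0 r := by
  rintro ⟨y', t⟩ ⟨h1, h2⟩
  simp only [Metric.mem_ball] at h1
  have h3 := (sq_lt_sq₀ dist_nonneg hr.le).2 h1
  rw [dist_par_sq hν, sub_zero] at h3
  simp only [above, mem_ofPred_eq, inner_par hν] at h2
  refine ⟨?_, by linarith, ?_⟩
  · rw [Metric.mem_closedBall]
    exact ((sq_lt_sq₀ dist_nonneg hr.le).1 (by nlinarith [sq_nonneg t])).le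
  · exact ((sq_lt_sq₀ (by linarith) hr.le).1 (by nlinarith [dist_nonneg (x := y') (y := y)])).le

/-- The half ball contains a cylinder with radius and height r/2. The power of 2 rescales that
cylinder to radius and height r. -/
theorem volume_half_ball_ge (hν : ‖ν‖ = 1) (y : (Submodule.span ℝ {ν})ᗮ) {r : ℝ} (hr : 0 < r) :
    volume (Metric.closedBall y r) * ENNReal.ofReal r ≤
      2 ^ (Module.finrank ℝ (Submodule.span ℝ {ν})ᗮ + 1) *
        volume (Metric.ball (par ν c y 0) r ∩ above ν c) := by
  have hm : MeasurableSet (Metric.ball (par ν c y 0) r ∩ above ν c) :=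
    (Metric.isOpen_ball.inter (isOpen_above ν c)).measurableSet
  rw [← (measurePreserving_par (c := c) hν).measure_preimage hm.nullMeasurableSet]
  have h1 := measure_mono (μ := (volume : Measure (Submodule.span ℝ {ν})ᗮ).prod volume)
    (subset_preimage_par (c := c) hν y hr)
  rw [Measure.prod_prod, Real.volume_Ioo, sub_zero] at h1
  refine le_trans ?_ (mul_le_mul_right h1 _)
  have h2 : volume (Metric.closedBall y r)
      = 2 ^ Module.finrank ℝ (Submodule.span ℝ {ν})ᗮ * volume (Metric.closedBall y (r / 2)) := by
    have e : r = 2 * (r / 2) := by ring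
    rw [e, Measure.addHaar_closedBall_mul _ _ zero_le_two (by positivity),
      Measure.addHaar_closedBall_center _ y, ENNReal.ofReal_pow zero_le_two]
    simp
  have h3 : ENNReal.ofReal r = 2 * ENNReal.ofReal (r / 2) := by
    rw [← ENNReal.ofReal_ofNat 2, ← ENNReal.ofReal_mul zero_le_two]
    congr 1; ring
  rw [h2, h3, pow_succ]
  apply le_of_eq; ring

/-- Inside the half ball, F differs from Fₙ by at most `tailGap`, a function of the foot point only,
while Fₙ is continuous. The half ball lies in a cylinder over a ball of ν⊥, so averages of `tailGap`
are controlled by Lebesgue differentiation on ν⊥, at almost every foot point for all n at once. Then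
n is chosen with a small tail at y, and r is small depending on n. -/
theorem RapidApprox.ae_average_above (h : RapidApprox F Fn) (hF : LocallyIntegrable F)
    (hν : ‖ν‖ = 1) :
    ∀ᵐ x ∂(area d).restrict (hyper ν c),
      Tendsto (fun r => ⨍ z in Metric.ball x r ∩ above ν c, F z) (𝓝[>] 0) (𝓝 (preciseLim Fn x)) := by
  rw [ae_hyper_iff hν]
  have hleb : ∀ᵐ y, ∀ n, Tendsto (fun r => (∫⁻ z in Metric.closedBall y r, tailGap ν c Fn n z) /
      volume (Metric.closedBall y r)) (𝓝[>] 0) (𝓝 (tailGap ν c Fn n y)) := by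
    rw [ae_all_iff]
    intro n
    filter_upwards [(Besicovitch.vitaliFamily volume).ae_tendsto_lintegral_div
      (h.measurable_tailGap (ν := ν) (c := c) n).aemeasurable
      (h.lintegral_tailGap_ne_top hν n)] with y hy
    exact hy.comp (Besicovitch.tendsto_filterAt volume y)
  filter_upwards [hleb, h.ae_tailGap_ne_top hν] with y hy hy0
  set x := par ν c y 0 with hx
  set m := Module.finrank ℝ (Submodule.span ℝ {ν})ᗮ with hm
  have hvol : ∀ r, 0 < r → volume (Metric.ball x r ∩ above ν c) ≠ 0 ∧
      volume (Metric.ball x r ∩ above ν c) ≠ ⊤ ∧ IntegrableOn F (Metric.ball x r ∩ above ν c) := by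
    intro r hr
    refine ⟨fun h0 => ?_, ((measure_mono inter_subset_left).trans_lt measure_ball_lt_top).ne, ?_⟩
    · have := volume_half_ball_ge (c := c) hν y hr
      rw [← hx, h0, mul_zero, nonpos_iff_eq_zero, mul_eq_zero] at this
      rcases this with h1 | h1
      · exact (Metric.measure_closedBall_pos volume y hr).ne' h1
      · exact absurd h1 (by simpa using hr)
    · exact (hF.integrableOn_isCompact (isCompact_closedBall x r)).mono_set
        (inter_subset_left.trans Metric.ball_subset_closedBall)
  refine tendsto_average_of_lintegral hvol ?_
  rw [ENNReal.tendsto_nhds_zero]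
  intro δ hδ
  by_cases hδt : δ = ⊤
  · simp [hδt]
  set K : ENNReal := 2 ^ (m + 1) with hK
  have hK1 : K + 1 ≠ ⊤ := by simp [hK]
  -- The pointwise error contributes 2ε: ε from the continuity of Fₙ and ε from its distance to the
  -- limit at x. The averaged tail is at most 2ε over the ball in ν⊥ and at most 2Kε over the half
  -- ball. The total is (K + 1) · 2ε = δ.
  set ε := δ / (2 * (K + 1)) with hε
  have hε0 : 0 < ε := ENNReal.div_pos hδ.ne' (ENNReal.mul_ne_top (by simp) hK1)
  have hεδ : (K + 1) * (ε + ε) = δ := by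
    rw [← two_mul, ← mul_assoc, mul_comm (K + 1), hε, ENNReal.mul_div_cancel (by simp)
      (ENNReal.mul_ne_top (by simp) hK1)]
  have hεt : ε ≠ ⊤ := fun h => by
    rw [h] at hεδ; simp at hεδ; exact hδt hεδ.symm
  obtain ⟨n, hn⟩ := ((ENNReal.tendsto_nhds_zero.1 (tendsto_tailGap hy0)) ε hε0).exists
  have hcont : ∀ᶠ z in 𝓝 x, edist (Fn n z) (Fn n x) < ε := by
    have h1 := ((h.test n).continuous.tendsto x).eventually (Metric.eball_mem_nhds (Fn n x) hε0)
    exact h1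
  obtain ⟨ρ, hρ, hρx⟩ := Metric.eventually_nhds_iff_ball.1 hcont
  have hlt : tailGap ν c Fn n y < tailGap ν c Fn n y + ε :=
    ENNReal.lt_add_right (ne_top_of_le_ne_top hεt hn) hε0.ne'
  filter_upwards [(hy n).eventually (gt_mem_nhds hlt), self_mem_nhdsWithin,
    mem_nhdsWithin_of_mem_nhds (Iio_mem_nhds hρ)] with r hr1 hr0 hr2
  have hr0' : 0 < r := hr0
  have hA : MeasurableSet (Metric.ball x r ∩ above ν c) :=
    (Metric.isOpen_ball.inter (isOpen_above ν c)).measurableSet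
  obtain ⟨v0, vt, -⟩ := hvol r hr0'
  set Φ := fun q : (Submodule.span ℝ {ν})ᗮ × ℝ => par ν c q.1 q.2 with hΦ
  have hmp : MeasurePreserving Φ (volume.prod volume) volume := measurePreserving_par hν
  have hpt : ∀ᵐ q ∂(volume.prod volume).restrict (Φ ⁻¹' (Metric.ball x r ∩ above ν c)),
      edist (F (Φ q)) (preciseLim Fn x) ≤ tailGap ν c Fn n q.1 + (ε + ε) := by
    rw [ae_restrict_iff' (hmp.measurable hA)]
    have h1 := ae_par (c := c) hν h.ae_tendsto
    have h2 : ∀ᵐ q ∂((volume : Measure (Submodule.span ℝ {ν})ᗮ).prod (volume : Measure ℝ)),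
        tailGap ν c Fn 0 q.1 ≠ ⊤ :=
      Measure.quasiMeasurePreserving_fst.ae (h.ae_tailGap_ne_top hν)
    filter_upwards [h1, h2] with q hq1 hq2 hq
    have e1 : F (Φ q) = preciseLim Fn (Φ q) :=
      tendsto_nhds_unique hq1 (h.tendsto_preciseLim hν hq2 q.2)
    have b1 : edist (preciseLim Fn (Φ q)) (Fn n (Φ q)) ≤ tailGap ν c Fn n q.1 := by
      rw [edist_comm]; exact h.edist_preciseLim_le hν hq2 q.2 n
    have b2 : edist (Fn n (Φ q)) (Fn n x) ≤ ε :=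
      (hρx _ (Metric.ball_subset_ball (le_of_lt hr2) hq.1)).le
    have b3 : edist (Fn n x) (preciseLim Fn x) ≤ ε := (h.edist_preciseLim_le hν hy0 0 n).trans hn
    rw [e1]
    calc edist (preciseLim Fn (Φ q)) (preciseLim Fn x)
        ≤ edist (preciseLim Fn (Φ q)) (Fn n (Φ q)) + edist (Fn n (Φ q)) (preciseLim Fn x) :=
          edist_triangle _ _ _
      _ ≤ edist (preciseLim Fn (Φ q)) (Fn n (Φ q)) +
          (edist (Fn n (Φ q)) (Fn n x) + edist (Fn n x) (preciseLim Fn x)) := by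
          gcongr; exact edist_triangle _ _ _
      _ ≤ _ := by gcongr
  have hint : ∫⁻ z in Metric.ball x r ∩ above ν c, edist (F z) (preciseLim Fn x)
      ≤ (∫⁻ z in Metric.closedBall y r, tailGap ν c Fn n z) * ENNReal.ofReal r
        + (ε + ε) * volume (Metric.ball x r ∩ above ν c) := by
    rw [← hmp.setLIntegral_comp_preimage_emb (measurableEquiv_par hν)]
    refine (lintegral_mono_ae hpt).trans ?_
    rw [lintegral_add_right _ measurable_const, lintegral_const, Measure.restrict_apply_univ,
      hmp.measure_preimage hA.nullMeasurableSet]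
    gcongr
    refine (lintegral_mono_set (preimage_par_subset hν y hr0')).trans ?_
    rw [← Measure.prod_restrict, lintegral_prod (fun q : (Submodule.span ℝ {ν})ᗮ × ℝ =>
      tailGap ν c Fn n q.1) ((h.measurable_tailGap n).comp measurable_fst).aemeasurable]
    simp only [lintegral_const, Measure.restrict_apply_univ, Real.volume_Icc, sub_zero]
    rw [lintegral_mul_const _ (h.measurable_tailGap n)]
  have hcb0 := (Metric.measure_closedBall_pos volume y hr0').ne'
  have hcbt : volume (Metric.closedBall y r) ≠ ⊤ := measure_closedBall_lt_top.ne
  have hI : (∫⁻ z in Metric.closedBall y r, tailGap ν c Fn n z) * ENNReal.ofReal r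
      ≤ K * (ε + ε) * volume (Metric.ball x r ∩ above ν c) := by
    calc (∫⁻ z in Metric.closedBall y r, tailGap ν c Fn n z) * ENNReal.ofReal r
        = (∫⁻ z in Metric.closedBall y r, tailGap ν c Fn n z) / volume (Metric.closedBall y r) *
            (volume (Metric.closedBall y r) * ENNReal.ofReal r) := by
          rw [← mul_assoc, ENNReal.div_mul_cancel hcb0 hcbt]
      _ ≤ (ε + ε) * (K * volume (Metric.ball x r ∩ above ν c)) := by
          exact mul_le_mul' (hr1.le.trans (by gcongr)) (volume_half_ball_ge hν y hr0')
      _ = _ := by ring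
  refine ENNReal.div_le_of_le_mul ((hint.trans (add_le_add_left hI _)).trans ?_)
  rw [← hεδ]
  apply le_of_eq; ring

/-- Replacing (ν, c) by (-ν, -c) exchanges the sides, whereas `preciseLim` refers to neither. This
is why the two one-sided traces of a Sobolev function coincide. -/
theorem RapidApprox.ae_average_below (h : RapidApprox F Fn) (hF : LocallyIntegrable F)
    (hν : ‖ν‖ = 1) :
    ∀ᵐ x ∂(area d).restrict (hyper ν c),
      Tendsto (fun r => ⨍ z in Metric.ball x r ∩ {z | inner ℝ ν z < c}, F z) (𝓝[>] 0)
        (𝓝 (preciseLim Fn x)) := by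
  have := h.ae_average_above (ν := -ν) (c := -c) hF (by rwa [norm_neg])
  rwa [above_neg, hyper_neg] at this

end Trace

/-! ### Rapid approximation of compactly supported H¹ functions. -/

section Approx

variable {d : ℕ} {F : E d → ℝ}

theorem enorm_fderiv_le_sum (φ : E d → ℝ) (x : E d) :
    ‖fderiv ℝ φ x‖ₑ ≤ ∑ j, ‖partialDeriv j φ x‖ₑ := by
  have h : ‖fderiv ℝ φ x‖ ≤ ∑ j, ‖partialDeriv j φ x‖ := by
    refine ContinuousLinearMap.opNorm_le_bound _ (Finset.sum_nonneg fun _ _ => norm_nonneg _)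
      fun v => ?_
    have hv : v = ∑ j, v j • EuclideanSpace.single j (1 : ℝ) := by
      ext i; simp [Finset.sum_apply, Pi.single_apply]
    conv_lhs => rw [hv]
    rw [map_sum, Finset.sum_mul]
    refine (norm_sum_le _ _).trans (Finset.sum_le_sum fun j _ => ?_)
    rw [map_smul, norm_smul, mul_comm]
    gcongr
    · rfl
    · exact PiLp.norm_apply_le v j
  simp only [← ofReal_norm]
  rw [← ENNReal.ofReal_sum_of_nonneg fun _ _ => norm_nonneg _]
  exact ENNReal.ofReal_le_ofReal h

theorem lintegral_enorm_le_eLpNorm_two {K : Set (E d)} (hK : MeasurableSet K) {g : E d → ℝ}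
    (hg : AEStronglyMeasurable g) (hgK : ∀ x ∉ K, g x = 0) :
    ∫⁻ x, ‖g x‖ₑ ≤ eLpNorm g 2 volume * (volume K) ^ (1 / 2 : ℝ) := by
  have h1 : ∫⁻ x, ‖g x‖ₑ = eLpNorm g 1 (volume.restrict K) := by
    rw [eLpNorm_one_eq_lintegral_enorm, ← lintegral_indicator hK]
    congr 1; ext x
    by_cases hx : x ∈ K
    · simp [hx]
    · simp [hx, hgK x hx]
  rw [h1]
  refine (eLpNorm_le_eLpNorm_mul_rpow_measure_univ (p := 1) (q := 2) (by norm_num)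
    hg.restrict).trans ?_
  rw [Measure.restrict_apply_univ]
  have : (1 / (1 : ENNReal).toReal - 1 / (2 : ENNReal).toReal : ℝ) = 1 / 2 := by norm_num
  rw [this]
  gcongr
  exact Measure.restrict_le_self

/-- A subsequence of the mollifications is taken whose n-th total gradient error in L² is at most
2⁻ⁿ. All supports lie in one compact set, so by Cauchy–Schwarz the gradient gaps are summable in L¹.
-/
theorem exists_rapidApprox {b : Fin d → E d → ℝ} (hF : MemLp F 2) (hF' : HasCompactSupport F)
    (hb : ∀ j, MemLp (b j) 2) (hw : ∀ j, IsWeakDeriv univ j F (b j)) :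
    ∃ Fn, RapidApprox F Fn ∧
      Tendsto (fun n => eLpNorm (fun x => Fn n x - F x) 2 volume) atTop (𝓝 0) ∧
      ∀ j, Tendsto (fun n => eLpNorm (fun x => partialDeriv j (Fn n) x - b j x) 2 volume) atTop
        (𝓝 0) := by
  have hloc := hF.locallyIntegrable_two
  set K := Metric.cthickening 1 (tsupport F) with hK
  have hKc : IsCompact K := hF'.isCompact.cthickening
  have hKt : (volume K) ^ (1 / 2 : ℝ) ≠ ⊤ :=
    ENNReal.rpow_ne_top_of_nonneg (by norm_num) hKc.measure_lt_top.ne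
  have htK : ∀ n, ∀ x ∉ K, x ∉ tsupport (moll n F) := fun n x hx h => hx <|
    Metric.cthickening_mono (by
      rw [div_le_one (by positivity)]; linarith [(Nat.cast_nonneg n : (0 : ℝ) ≤ n)]) _
      (tsupport_moll_subset n F h)
  set err : ℕ → ENNReal := fun n => ∑ j, eLpNorm (fun x => moll n (b j) x - b j x) 2 volume with herr
  have herr0 : Tendsto err atTop (𝓝 0) := by
    have := tendsto_finsetSum Finset.univ fun j (_ : j ∈ Finset.univ) => tendsto_moll (hb j)
    simpa using this
  obtain ⟨s, hs, hse⟩ := extraction_forall_of_eventually (P := fun n k => err k ≤ 2⁻¹ ^ n)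
    fun n => (ENNReal.tendsto_nhds_zero.1 herr0) _ (ENNReal.pow_pos (by simp) n)
  have htest : ∀ n, IsTestFunction univ (moll (s n) F) := fun n => isTestFunction_moll _ hloc hF'
  refine ⟨fun n => moll (s n) F, ⟨htest, ?_, ?_⟩, (tendsto_moll hF).comp hs.tendsto_atTop,
    fun j => ?_⟩
  · have hbd : ∀ n, ∫⁻ x, gap (fun n => moll (s n) F) n x ≤
        (2⁻¹ ^ n + 2⁻¹ ^ n) * (volume K) ^ (1 / 2 : ℝ) := by
      intro n
      have e : ∀ j, partialDeriv j (fun y => moll (s (n + 1)) F y - moll (s n) F y)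
          = fun x => (moll (s (n + 1)) (b j) x - b j x) - (moll (s n) (b j) x - b j x) := fun j => by
        ext x
        rw [partialDeriv_sub (htest _).1.differentiable_infty (htest _).1.differentiable_infty,
          partialDeriv_moll _ (hw j), partialDeriv_moll _ (hw j)]
        ring
      have hj : ∀ j, ∫⁻ x, ‖partialDeriv j (fun y => moll (s (n + 1)) F y - moll (s n) F y) x‖ₑ
          ≤ (eLpNorm (fun x => moll (s (n + 1)) (b j) x - b j x) 2 volume
            + eLpNorm (fun x => moll (s n) (b j) x - b j x) 2 volume)
            * (volume K) ^ (1 / 2 : ℝ) := fun j => by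
        have ht := ((htest (n + 1)).sub (htest n)).partialDeriv j
        refine (lintegral_enorm_le_eLpNorm_two hKc.measurableSet
          ht.continuous.aestronglyMeasurable fun x hx => ?_).trans ?_
        · refine image_eq_zero_of_notMem_tsupport fun h => ?_
          have h1 := tsupport_sub (moll (s (n + 1)) F) (moll (s n) F)
            (tsupport_partialDeriv_subset j _ h)
          exact h1.elim (htK _ x hx) (htK _ x hx)
        · gcongr
          rw [e]
          exact eLpNorm_sub_le ((memLp_moll _ (hb j)).sub (hb j)).aestronglyMeasurable
            ((memLp_moll _ (hb j)).sub (hb j)).aestronglyMeasurable (by norm_num)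
      calc ∫⁻ x, gap (fun n => moll (s n) F) n x
          ≤ ∫⁻ x, ∑ j, ‖partialDeriv j (fun y => moll (s (n + 1)) F y - moll (s n) F y) x‖ₑ :=
            lintegral_mono fun x => enorm_fderiv_le_sum _ x
        _ = ∑ j, ∫⁻ x, ‖partialDeriv j (fun y => moll (s (n + 1)) F y - moll (s n) F y) x‖ₑ :=
            lintegral_finsetSum _ fun j _ =>
              (((htest (n + 1)).sub (htest n)).partialDeriv j).continuous.enorm.measurable
        _ ≤ ∑ j, (eLpNorm (fun x => moll (s (n + 1)) (b j) x - b j x) 2 volume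
            + eLpNorm (fun x => moll (s n) (b j) x - b j x) 2 volume)
            * (volume K) ^ (1 / 2 : ℝ) := Finset.sum_le_sum fun j _ => hj j
        _ = (err (s (n + 1)) + err (s n)) * (volume K) ^ (1 / 2 : ℝ) := by
            rw [← Finset.sum_mul, Finset.sum_add_distrib]
        _ ≤ _ := by
            gcongr
            · refine (hse (n + 1)).trans ?_
              rw [pow_succ]
              exact mul_le_of_le_one_right' (by simp)
            · exact hse n
    refine ne_top_of_le_ne_top ?_ (ENNReal.tsum_le_tsum hbd)
    rw [ENNReal.tsum_mul_right, ENNReal.tsum_add, ENNReal.tsum_geometric]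
    exact ENNReal.mul_ne_top (by simp) hKt
  -- Convergence at Lebesgue points needs the outer radius of the kernel to be bounded by a fixed
  -- multiple of the inner one; the ratio here is 2.
  · have h := ContDiffBump.ae_convolution_tendsto_right_of_locallyIntegrable (μ := volume)
      (φ := fun n => mollifier d (s n)) (l := atTop) (K := 2) (g := F) ?_ ?_ hloc
    · exact h
    · exact tendsto_one_div_add_atTop_nhds_zero_nat.comp hs.tendsto_atTop
    · refine .of_forall fun n => ?_
      simp only [mollifier]
      rw [mul_one_div, div_le_div_iff₀ (by positivity) (by positivity)]
      linarith
  · refine ((tendsto_moll (hb j)).comp hs.tendsto_atTop).congr fun n => ?_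
    simp only [Function.comp, partialDeriv_moll _ (hw j)]

end Approx

/-! ### Hyperplane arrangements -/

section Arrangement

variable {d : ℕ} {𝓗 : Finset (Set (E d))} {G : E d → ℝ}

/-- Every member is a hyperplane. -/
def IsArrangement (𝓗 : Finset (Set (E d))) : Prop :=
  ∀ H ∈ 𝓗, ∃ (ν : E d) (c : ℝ), ‖ν‖ = 1 ∧ H = hyper ν c

/-- The union of an arrangement. -/
def skel (𝓗 : Finset (Set (E d))) : Set (E d) := ⋃ H ∈ 𝓗, H

/-- The points that lie on at least two members of the arrangement. -/
def edges (𝓗 : Finset (Set (E d))) : Set (E d) :=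
  ⋃ H ∈ 𝓗, ⋃ H' ∈ 𝓗, ⋃ (_ : H ≠ H'), H ∩ H'

theorem mem_skel {x : E d} : x ∈ skel 𝓗 ↔ ∃ H ∈ 𝓗, x ∈ H := by simp [skel]

theorem mem_edges {x : E d} : x ∈ edges 𝓗 ↔ ∃ H ∈ 𝓗, ∃ H' ∈ 𝓗, H ≠ H' ∧ x ∈ H ∧ x ∈ H' := by
  simp only [edges, mem_iUnion, mem_inter_iff, exists_prop]

theorem IsArrangement.isClosed (h : IsArrangement 𝓗) {H : Set (E d)} (hH : H ∈ 𝓗) : IsClosed H := by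
  obtain ⟨ν, c, -, rfl⟩ := h H hH
  exact isClosed_hyper ν c

theorem IsArrangement.isClosed_skel (h : IsArrangement 𝓗) : IsClosed (skel 𝓗) :=
  isClosed_biUnion_finset fun _ hH => h.isClosed hH

theorem IsArrangement.isClosed_edges (h : IsArrangement 𝓗) : IsClosed (edges 𝓗) :=
  isClosed_biUnion_finset fun _ hH => isClosed_biUnion_finset fun _ hH' =>
    isClosed_iUnion_of_finite fun _ => (h.isClosed hH).inter (h.isClosed hH')

theorem volume_hyper {ν : E d} (hν : ‖ν‖ = 1) (c : ℝ) : volume (hyper ν c) = 0 := by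
  rw [← (measurePreserving_par (c := c) hν).measure_preimage
    (isClosed_hyper ν c).measurableSet.nullMeasurableSet]
  have : (fun q : (Submodule.span ℝ {ν})ᗮ × ℝ => par ν c q.1 q.2) ⁻¹' hyper ν c = univ ×ˢ {0} := by
    ext q; simp [hyper, inner_par hν]
  rw [this, Measure.prod_prod]
  simp

theorem IsArrangement.volume_skel (h : IsArrangement 𝓗) : volume (skel 𝓗) = 0 := by
  refine (measure_biUnion_null_iff 𝓗.countable_toSet).2 fun H hH => ?_
  obtain ⟨ν, c, hν, rfl⟩ := h H hH
  exact volume_hyper hν c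

theorem volume_level_set {W : Type*} [NormedAddCommGroup W] [InnerProductSpace ℝ W]
    [FiniteDimensional ℝ W] [MeasurableSpace W] [BorelSpace W] {f : W →ₗ[ℝ] ℝ} (hf : f ≠ 0) (k : ℝ) :
    volume {y | f y = k} = 0 := by
  rcases eq_empty_or_nonempty {y | f y = k} with h | ⟨p, hp⟩
  · rw [h, measure_empty]
  · have h1 : {y | f y = k} = (fun y => -p + y) ⁻¹' (LinearMap.ker f : Set W) := by
      ext y
      have hp' : f p = k := hp
      simp only [mem_ofPred_eq, mem_preimage, SetLike.mem_coe, LinearMap.mem_ker, map_add, map_neg, hp']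
      constructor <;> intro h <;> linarith
    rw [h1, measure_preimage_add]
    exact Measure.addHaar_submodule _ _ fun h => hf (LinearMap.ker_eq_top.1 h)

/-- In the coordinates of the first hyperplane the second is a level set of a linear functional.
This is a null set unless the functional vanishes; then the hyperplanes are parallel, and being
distinct they do not meet. -/
theorem area_hyper_inter {ν ν' : E d} {c c' : ℝ} (hν : ‖ν‖ = 1) (hν' : ‖ν'‖ = 1)
    (h : hyper ν c ≠ hyper ν' c') : area d (hyper ν c ∩ hyper ν' c') = 0 := by
  rw [inter_comm, ← Measure.restrict_apply (isClosed_hyper ν' c').measurableSet,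
    area_restrict_hyper hν, (measurableEmbedding_par_zero hν).map_apply]
  let f : (Submodule.span ℝ {ν})ᗮ →ₗ[ℝ] ℝ :=
    (innerₛₗ ℝ ν').comp (Submodule.span ℝ {ν})ᗮ.subtype
  have hset : (fun y => par ν c y 0) ⁻¹' hyper ν' c' = {y | f y = c' - c * inner ℝ ν' ν} := by
    ext y
    simp only [hyper, par, mem_preimage, mem_ofPred_eq, inner_add_right, inner_smul_right, add_zero,
      f, LinearMap.comp_apply, Submodule.subtype_apply, innerₛₗ_apply_apply]
    constructor <;> intro h <;> linarith
  rw [hset]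
  by_cases hf : f = 0
  · -- the hyperplanes are parallel
    have hpar : ∃ a : ℝ, a • ν = ν' := by
      have : ν' ∈ (Submodule.span ℝ {ν})ᗮᗮ := fun y hy => by
        have := LinearMap.congr_fun hf ⟨y, hy⟩
        rw [real_inner_comm]
        simpa [f] using this
      rw [Submodule.orthogonal_orthogonal] at this
      exact Submodule.mem_span_singleton.1 this
    obtain ⟨a, rfl⟩ := hpar
    have ha : a * a = 1 := by
      rw [norm_smul, hν, mul_one] at hν'
      rw [← abs_mul_abs_self, ← Real.norm_eq_abs, hν', mul_one]
    have hne : c' - c * inner ℝ (a • ν) ν ≠ 0 := by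
      rw [inner_smul_left, real_inner_self_eq_norm_sq, hν]
      intro h0
      apply h
      have hc : c' = c * a := by simpa [sub_eq_zero] using h0
      ext x
      simp only [hyper, mem_ofPred_eq, inner_smul_left, hc]
      have ha0 : a ≠ 0 := by rintro rfl; simp at ha
      simp only [conj_trivial]
      constructor
      · intro h; rw [h]; ring
      · intro h; exact mul_left_cancel₀ ha0 (by rw [h]; ring)
    have : {y | f y = c' - c * inner ℝ (a • ν) ν} = ∅ := by
      ext y; simpa [hf] using hne.symm
    rw [this, measure_empty]
  · exact volume_level_set hf _

theorem IsArrangement.area_edges (h : IsArrangement 𝓗) : area d (edges 𝓗) = 0 := by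
  refine (measure_biUnion_null_iff 𝓗.countable_toSet).2 fun H hH =>
    (measure_biUnion_null_iff 𝓗.countable_toSet).2 fun H' hH' => measure_iUnion_null fun hne => ?_
  obtain ⟨ν, c, hν, rfl⟩ := h H hH
  obtain ⟨ν', c', hν', rfl⟩ := h H' hH'
  exact area_hyper_inter hν hν' hne

/-- On open connected sets that avoid the arrangement, `G` coincides with one of finitely many
smooth functions. -/
def PiecewiseSmooth (𝓗 : Finset (Set (E d))) (G : E d → ℝ) : Prop :=
  ∃ Ps : Finset (E d → ℝ), (∀ P ∈ Ps, ContDiff ℝ ∞ P) ∧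
    ∀ A, IsOpen A → IsPreconnected A → Disjoint A (skel 𝓗) → ∃ P ∈ Ps, EqOn G P A

/-- The open set is a connected component of the complement of the arrangement; it allows
`PiecewiseSmooth`, which speaks of open sets, to be applied at a point. -/
theorem IsArrangement.exists_open_of_segment (h : IsArrangement 𝓗) {S : Set (E d)}
    (hS : IsPreconnected S) (hd : Disjoint S (skel 𝓗)) :
    ∃ A, IsOpen A ∧ IsPreconnected A ∧ Disjoint A (skel 𝓗) ∧ S ⊆ A := by
  rcases S.eq_empty_or_nonempty with rfl | ⟨x, hx⟩
  · exact ⟨∅, isOpen_empty, isPreconnected_empty, empty_disjoint _, le_rfl⟩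
  · exact ⟨connectedComponentIn (skel 𝓗)ᶜ x, h.isClosed_skel.isOpen_compl.connectedComponentIn,
      isPreconnected_connectedComponentIn, disjoint_left.2 fun y hy =>
        connectedComponentIn_subset _ _ hy,
      hS.subset_connectedComponentIn hx fun y hy => disjoint_left.1 hd hy⟩

theorem PiecewiseSmooth.exists_nhds (h𝓗 : IsArrangement 𝓗) (hG : PiecewiseSmooth 𝓗 G) {x : E d}
    (hx : x ∉ skel 𝓗) : ∃ P, ContDiff ℝ ∞ P ∧ G =ᶠ[𝓝 x] P := by
  obtain ⟨Ps, hP, hA⟩ := hG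
  obtain ⟨A, hAo, hAc, hAd, hxA⟩ := h𝓗.exists_open_of_segment
    (isPreconnected_singleton (x := x)) (disjoint_singleton_left.2 hx)
  obtain ⟨P, hPPs, hPA⟩ := hA A hAo hAc hAd
  exact ⟨P, hP P hPPs, hPA.eventuallyEq_of_mem (hAo.mem_nhds (hxA rfl))⟩

theorem PiecewiseSmooth.continuousOn (h𝓗 : IsArrangement 𝓗) (hG : PiecewiseSmooth 𝓗 G) :
    ContinuousOn G (skel 𝓗)ᶜ := fun x hx => by
  obtain ⟨P, hP, hPx⟩ := hG.exists_nhds h𝓗 hx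
  exact (hP.continuous.continuousAt.congr hPx.symm).continuousWithinAt

theorem PiecewiseSmooth.aestronglyMeasurable (h𝓗 : IsArrangement 𝓗) (hG : PiecewiseSmooth 𝓗 G) :
    AEStronglyMeasurable G volume := by
  have h1 : AEStronglyMeasurable G (volume.restrict (skel 𝓗)ᶜ) :=
    (hG.continuousOn h𝓗).aestronglyMeasurable h𝓗.isClosed_skel.measurableSet.compl
  have h2 : volume.restrict (skel 𝓗)ᶜ = volume := by
    rw [Measure.restrict_eq_self_of_ae_mem]
    exact measure_eq_zero_iff_ae_notMem.1 h𝓗.volume_skel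
  rwa [h2] at h1

/-- The finiteness of the family of branches makes the bound uniform up to the hyperplanes, where G
itself may jump. -/
theorem PiecewiseSmooth.exists_bound (h𝓗 : IsArrangement 𝓗) (hG : PiecewiseSmooth 𝓗 G) (R : ℝ) :
    ∃ B, 0 ≤ B ∧ ∀ x ∉ skel 𝓗, ‖x‖ ≤ R → |G x| ≤ B := by
  obtain ⟨Ps, hP, hA⟩ := hG
  have : ∀ P : E d → ℝ, ∃ B, 0 ≤ B ∧ (P ∈ Ps → ∀ x ∈ Metric.closedBall (0 : E d) R, ‖P x‖ ≤ B) := by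
    intro P
    by_cases hPPs : P ∈ Ps
    · obtain ⟨C, hC⟩ := (isCompact_closedBall (0 : E d) R).exists_bound_of_continuousOn
        (hP P hPPs).continuous.continuousOn
      exact ⟨max C 0, le_max_right _ _, fun _ x hx => (hC x hx).trans (le_max_left _ _)⟩
    · exact ⟨0, le_rfl, fun h => absurd h hPPs⟩
  choose B hB0 hB using this
  refine ⟨∑ P ∈ Ps, B P, Finset.sum_nonneg fun P _ => hB0 P, fun x hx hxR => ?_⟩
  obtain ⟨A, hAo, hAc, hAd, hxA⟩ := h𝓗.exists_open_of_segment
    (isPreconnected_singleton (x := x)) (disjoint_singleton_left.2 hx)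
  obtain ⟨P, hPPs, hPA⟩ := hA A hAo hAc hAd
  rw [hPA (hxA rfl)]
  exact (hB P hPPs x (by simpa using hxR)).trans
    (Finset.single_le_sum (fun P _ => hB0 P) hPPs)

theorem PiecewiseSmooth.partialDeriv (hG : PiecewiseSmooth 𝓗 G) (j : Fin d) :
    PiecewiseSmooth 𝓗 (partialDeriv j G) := by
  classical
  obtain ⟨Ps, hP, hA⟩ := hG
  refine ⟨Ps.image (CutStokes.partialDeriv j), ?_, fun A hAo hAc hAd => ?_⟩
  · simp only [Finset.mem_image]
    rintro _ ⟨P, hPPs, rfl⟩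
    exact (hP P hPPs).partialDeriv j
  · obtain ⟨P, hPPs, hPA⟩ := hA A hAo hAc hAd
    refine ⟨_, Finset.mem_image_of_mem _ hPPs, fun x hx => ?_⟩
    simp only [CutStokes.partialDeriv]
    rw [(hPA.eventuallyEq_of_mem (hAo.mem_nhds hx)).fderiv_eq]

theorem PiecewiseSmooth.comp (hG : PiecewiseSmooth 𝓗 G) {T : ℝ → ℝ} (hT : ContDiff ℝ ∞ T) :
    PiecewiseSmooth 𝓗 (fun x => T (G x)) := by
  classical
  obtain ⟨Ps, hP, hA⟩ := hG
  refine ⟨Ps.image fun P x => T (P x), ?_, fun A hAo hAc hAd => ?_⟩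
  · simp only [Finset.mem_image]
    rintro _ ⟨P, hPPs, rfl⟩
    exact hT.comp (hP P hPPs)
  · obtain ⟨P, hPPs, hPA⟩ := hA A hAo hAc hAd
    exact ⟨_, Finset.mem_image_of_mem _ hPPs, fun x hx => congrArg T (hPA hx)⟩

theorem _root_.IsPreconnected.subset_or_disjoint_of_frontier {X : Type*} [TopologicalSpace X]
    {A S : Set X} (hA : IsPreconnected A) (h : Disjoint A (frontier S)) : A ⊆ S ∨ Disjoint A S := by
  by_contra! hn
  obtain ⟨⟨y, hyA, hyS⟩, ⟨z, hzA, hzS⟩⟩ :=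
    And.intro (not_subset.1 hn.1) (not_disjoint_iff.1 hn.2)
  have hc : A ⊆ interior S ∪ interior Sᶜ := by
    rw [← compl_frontier_eq_union_interior]
    exact fun x hx => disjoint_left.1 h hx
  obtain ⟨w, -, hw, hw'⟩ := hA _ _ isOpen_interior isOpen_interior hc
    ⟨z, hzA, (hc hzA).resolve_right fun h => interior_subset h hzS⟩
    ⟨y, hyA, (hc hyA).resolve_left fun h => hyS (interior_subset h)⟩
  exact interior_subset hw' (interior_subset hw)

theorem PiecewiseSmooth.ite {G' : E d → ℝ} (hG : PiecewiseSmooth 𝓗 G) (hG' : PiecewiseSmooth 𝓗 G')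
    {S : Set (E d)} [DecidablePred (· ∈ S)] (hS : frontier S ⊆ skel 𝓗) :
    PiecewiseSmooth 𝓗 (fun x => if x ∈ S then G x else G' x) := by
  classical
  obtain ⟨Ps, hP, hA⟩ := hG
  obtain ⟨Ps', hP', hA'⟩ := hG'
  refine ⟨Ps ∪ Ps', ?_, fun A hAo hAc hAd => ?_⟩
  · intro P h
    exact (Finset.mem_union.1 h).elim (hP P) (hP' P)
  · rcases hAc.subset_or_disjoint_of_frontier (hAd.mono_right hS) with hAS | hAS
    · obtain ⟨P, hPPs, hPA⟩ := hA A hAo hAc hAd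
      exact ⟨P, Finset.mem_union_left _ hPPs, fun x hx => by simp [hAS hx, hPA hx]⟩
    · obtain ⟨P, hPPs, hPA⟩ := hA' A hAo hAc hAd
      refine ⟨P, Finset.mem_union_right _ hPPs, fun x hx => ?_⟩
      simp [disjoint_left.1 hAS hx, hPA hx]

theorem piecewiseSmooth_const (a : ℝ) : PiecewiseSmooth 𝓗 (fun _ => a) :=
  ⟨{fun _ => a}, by simpa using contDiff_const, fun _ _ _ _ => ⟨_, Finset.mem_singleton_self _,
    fun _ _ => rfl⟩⟩

end Arrangement

/-! ### The Gauss–Green formula for piecewise smooth functions -/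

section GaussGreen

variable {d : ℕ} {𝓗 : Finset (Set (E d))} {G : E d → ℝ}

theorem norm_coe_le_norm_par {ν : E d} (hν : ‖ν‖ = 1) (c : ℝ) (y : (Submodule.span ℝ {ν})ᗮ)
    (t : ℝ) : ‖y‖ ≤ ‖par ν c y t‖ := by
  have h : ‖par ν c y t‖ ^ 2 = ‖y‖ ^ 2 + (c + t) ^ 2 := by
    have := dist_par_sq (c := c) hν y 0 t (-c)
    simpa [par, dist_eq_norm, add_comm] using this
  exact (sq_le_sq₀ (norm_nonneg _) (norm_nonneg _)).1 (by nlinarith [sq_nonneg (c + t)])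

/-- A blow-up at the hyperplane: in normal coordinates the substitution t = δs absorbs the factor
δ⁻¹, and K tends to b for s > 0 and to a for s < 0. Dominated convergence is used twice, over s in
[-2, 2] and over a ball of ν⊥. Continuity is required only of the product with ρ, because K may jump
where ρ vanishes. -/
theorem tendsto_integral_slab {ν : E d} {c B R : ℝ} (hν : ‖ν‖ = 1) {K : ℝ → E d → ℝ} {ρ : ℝ → ℝ}
    {a b : (Submodule.span ℝ {ν})ᗮ → ℝ} (hρ : ∀ s, 2 < |s| → ρ s = 0)
    (hK : ∀ δ, 0 < δ → Continuous fun x => K δ x * ρ ((inner ℝ ν x - c) / δ))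
    (hB : ∀ δ x, 0 < δ → |K δ x * ρ ((inner ℝ ν x - c) / δ)| ≤ B)
    (hR : ∀ δ x, R < ‖x‖ → K δ x = 0)
    (hb : ∀ᵐ y, ∀ s, 0 < s → Tendsto (fun δ => K δ (par ν c y (δ * s))) (𝓝[>] 0) (𝓝 (b y)))
    (ha : ∀ᵐ y, ∀ s, s < 0 → Tendsto (fun δ => K δ (par ν c y (δ * s))) (𝓝[>] 0) (𝓝 (a y)))
    (hρi : Integrable ρ) :
    Tendsto (fun δ => ∫ x, K δ x * (δ⁻¹ * ρ ((inner ℝ ν x - c) / δ))) (𝓝[>] 0)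
      (𝓝 (∫ y, a y * (∫ s in Iic 0, ρ s) + b y * (∫ s in Ioi 0, ρ s))) := by
  have hB0 : 0 ≤ B := (abs_nonneg _).trans (hB 1 0 one_pos)
  have hcs : ∀ δ, HasCompactSupport fun x => K δ x * ρ ((inner ℝ ν x - c) / δ) := fun δ =>
    HasCompactSupport.intro (isCompact_closedBall 0 R) fun x hx => by
      rw [hR δ x (by simpa using hx), zero_mul]
  have hint : ∀ δ, 0 < δ → Integrable (fun q : (Submodule.span ℝ {ν})ᗮ × ℝ =>
      K δ (par ν c q.1 q.2) * ρ (q.2 / δ)) (volume.prod volume) := fun δ hδ => by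
    have := (measurePreserving_par (c := c) hν).integrable_comp_of_integrable
      ((hK δ hδ).integrable_of_hasCompactSupport (hcs δ))
    refine this.congr (ae_of_all _ fun q => ?_)
    simp [inner_par hν]
  have hsub : ∀ δ, 0 < δ → ∀ y : (Submodule.span ℝ {ν})ᗮ,
      ∫ t, K δ (par ν c y t) * ρ (t / δ) = δ * ∫ s, K δ (par ν c y (δ * s)) * ρ s := by
    intro δ hδ y
    have := Measure.integral_comp_mul_left (fun t => K δ (par ν c y t) * ρ (t / δ)) δ
    simp only [mul_div_cancel_left₀ _ hδ.ne', abs_inv, abs_of_pos hδ, smul_eq_mul] at this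
    rw [this, mul_inv_cancel_left₀ hδ.ne']
  have heq : ∀ δ, 0 < δ → ∫ x, K δ x * (δ⁻¹ * ρ ((inner ℝ ν x - c) / δ))
      = ∫ y : (Submodule.span ℝ {ν})ᗮ, ∫ s, K δ (par ν c y (δ * s)) * ρ s := by
    intro δ hδ
    rw [← (measurePreserving_par (c := c) hν).integral_comp (measurableEquiv_par hν)]
    have : (fun q : (Submodule.span ℝ {ν})ᗮ × ℝ => K δ (par ν c q.1 q.2)
        * (δ⁻¹ * ρ ((inner ℝ ν (par ν c q.1 q.2) - c) / δ)))
        = fun q => δ⁻¹ * (K δ (par ν c q.1 q.2) * ρ (q.2 / δ)) := by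
      ext q; rw [inner_par hν, add_sub_cancel_left]; ring
    rw [this, integral_const_mul, integral_prod _ (hint δ hδ), ← integral_const_mul]
    congr 1 with y
    rw [hsub δ hδ, inv_mul_cancel_left₀ hδ.ne']
  have hbound : ∀ δ, 0 < δ → ∀ (y : (Submodule.span ℝ {ν})ᗮ) (s : ℝ),
      ‖K δ (par ν c y (δ * s)) * ρ s‖ ≤ (Icc (-2) 2).indicator (fun _ => B) s := by
    intro δ hδ y s
    by_cases hs : s ∈ Icc (-2 : ℝ) 2
    · rw [indicator_of_mem hs]
      have := hB δ (par ν c y (δ * s)) hδ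
      rwa [inner_par hν, add_sub_cancel_left, mul_div_cancel_left₀ _ hδ.ne'] at this
    · rw [indicator_of_notMem hs, hρ s (by rw [mem_Icc, ← abs_le] at hs; exact not_le.1 hs)]
      simp
  have hbi : Integrable ((Icc (-2 : ℝ) 2).indicator fun _ => B) :=
    (integrable_indicator_iff measurableSet_Icc).2 (by simp)
  refine (tendsto_congr' ?_).2 (tendsto_integral_filter_of_dominated_convergence
    ((Metric.closedBall (0 : (Submodule.span ℝ {ν})ᗮ) R).indicator fun _ => 4 * B)
    (F := fun δ y => ∫ s, K δ (par ν c y (δ * s)) * ρ s) ?_ ?_ ?_ ?_)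
  · filter_upwards [self_mem_nhdsWithin] with δ hδ using heq δ hδ
  · filter_upwards [self_mem_nhdsWithin] with δ (hδ : 0 < δ)
    have := (hint δ hδ).integral_prod_left.aestronglyMeasurable.const_mul δ⁻¹
    refine this.congr (ae_of_all _ fun y => ?_)
    simp only [hsub δ hδ, inv_mul_cancel_left₀ hδ.ne']
  · filter_upwards [self_mem_nhdsWithin] with δ (hδ : 0 < δ)
    refine ae_of_all _ fun y => ?_
    by_cases hy : y ∈ Metric.closedBall (0 : (Submodule.span ℝ {ν})ᗮ) R
    · rw [indicator_of_mem hy]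
      refine (norm_integral_le_of_norm_le hbi (ae_of_all _ (hbound δ hδ y))).trans ?_
      rw [integral_indicator measurableSet_Icc]
      simp; norm_num
    · rw [indicator_of_notMem hy]
      have : ∀ s, K δ (par ν c y (δ * s)) = 0 := fun s => hR _ _
        ((not_le.1 (by simpa using hy)).trans_le (norm_coe_le_norm_par hν c y _))
      simp [this]
  · exact (integrable_indicator_iff Metric.isClosed_closedBall.measurableSet).2
      (integrableOn_const (isCompact_closedBall _ _).measure_lt_top.ne)
  · filter_upwards [ha, hb] with y hay hby
    have e : a y * (∫ s in Iic 0, ρ s) + b y * (∫ s in Ioi 0, ρ s)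
        = ∫ s, (if s ≤ 0 then a y else b y) * ρ s := by
      have h1 : ∫ s in Iic 0, (if s ≤ 0 then a y else b y) * ρ s = a y * ∫ s in Iic 0, ρ s := by
        rw [← integral_const_mul]
        refine setIntegral_congr_fun measurableSet_Iic fun s hs => ?_
        simp only [mem_Iic] at hs; simp [hs]
      have h2 : ∫ s in Ioi 0, (if s ≤ 0 then a y else b y) * ρ s = b y * ∫ s in Ioi 0, ρ s := by
        rw [← integral_const_mul]
        refine setIntegral_congr_fun measurableSet_Ioi fun s hs => ?_
        simp only [mem_Ioi] at hs; simp [not_le.2 hs]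
      have hi : Integrable fun s => (if s ≤ 0 then a y else b y) * ρ s := by
        refine hρi.bdd_mul (c := max |a y| |b y|) ?_ (ae_of_all _ fun s => ?_)
        · exact (Measurable.ite measurableSet_Iic measurable_const
            measurable_const).aestronglyMeasurable
        · split_ifs
          exacts [le_max_left _ _, le_max_right _ _]
      rw [← h1, ← h2, ← compl_Iic, integral_add_compl measurableSet_Iic hi]
    rw [e]
    refine tendsto_integral_filter_of_dominated_convergence _ ?_ ?_ hbi ?_
    · filter_upwards [self_mem_nhdsWithin] with δ (hδ : 0 < δ)
      have h1 := (hK δ hδ).comp (g := fun x => K δ x * ρ ((inner ℝ ν x - c) / δ))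
        (f := fun s : ℝ => par ν c y (δ * s)) (by unfold par; fun_prop)
      refine h1.aestronglyMeasurable.congr (ae_of_all _ fun s => ?_)
      simp [inner_par hν, mul_div_cancel_left₀ _ hδ.ne']
    · filter_upwards [self_mem_nhdsWithin] with δ (hδ : 0 < δ)
      exact ae_of_all _ fun s => hbound δ hδ y s
    · have h0 : ∀ᵐ s : ℝ, s ≠ 0 := by simp [ae_iff]
      filter_upwards [h0] with s hs
      refine Tendsto.mul_const _ ?_
      rcases lt_or_gt_of_ne hs with h | h
      · simpa [h.le] using hay s h
      · simpa [not_le.2 h] using hby s h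

/-- A smooth function that vanishes near the origin and equals `1` away from it. -/
def step (s : ℝ) : ℝ := 1 - (⟨1, 2, one_pos, one_lt_two⟩ : ContDiffBump (0 : ℝ)) s

theorem contDiff_step : ContDiff ℝ ∞ step :=
  contDiff_const.sub (ContDiffBump.contDiff _)

theorem step_eq_zero {s : ℝ} (hs : |s| ≤ 1) : step s = 0 := by
  rw [step, ContDiffBump.one_of_mem_closedBall _ (by simpa using hs), sub_self]

theorem step_eq_one {s : ℝ} (hs : 2 ≤ |s|) : step s = 1 := by
  rw [step, ContDiffBump.zero_of_le_dist _ (by simpa using hs), sub_zero]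

theorem step_mem_Icc (s : ℝ) : step s ∈ Icc (0 : ℝ) 1 :=
  ⟨by rw [step, sub_nonneg]; exact ContDiffBump.le_one _,
    by rw [step, sub_le_self_iff]; exact ContDiffBump.nonneg _⟩

theorem deriv_step_eq_zero {s : ℝ} (hs : 2 < |s|) : deriv step s = 0 := by
  have : step =ᶠ[𝓝 s] fun _ => 1 := by
    filter_upwards [(continuous_abs.isOpen_preimage _ isOpen_Ioi).mem_nhds hs] with r hr
    exact step_eq_one (le_of_lt hr)
  rw [this.deriv_eq, deriv_const]

theorem deriv_step_eq_zero' {s : ℝ} (hs : |s| < 1) : deriv step s = 0 := by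
  have : step =ᶠ[𝓝 s] fun _ => 0 := by
    filter_upwards [(continuous_abs.isOpen_preimage _ isOpen_Iio).mem_nhds hs] with r hr
    exact step_eq_zero (le_of_lt hr)
  rw [this.deriv_eq, deriv_const]

theorem continuous_deriv_step : Continuous (deriv step) :=
  contDiff_step.continuous_deriv (by simp)

theorem hasDerivAt_step (s : ℝ) : HasDerivAt step (deriv step s) s :=
  (contDiff_step.differentiable (by simp) s).hasDerivAt

theorem integrable_deriv_step : Integrable (deriv step) :=
  continuous_deriv_step.integrable_of_hasCompactSupport
    (HasCompactSupport.intro (isCompact_closedBall 0 2) fun s hs =>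
      deriv_step_eq_zero (by simpa using hs))

theorem integral_deriv_step_Ioi : ∫ s in Ioi 0, deriv step s = 1 := by
  rw [integral_Ioi_of_hasDerivAt_of_tendsto (m := 1) contDiff_step.continuous.continuousWithinAt
    (fun s _ => hasDerivAt_step s) integrable_deriv_step.integrableOn, step_eq_zero (by simp),
    sub_zero]
  refine tendsto_const_nhds.congr' ?_
  filter_upwards [eventually_ge_atTop 2] with s hs
  exact (step_eq_one (hs.trans (le_abs_self _))).symm

theorem integral_deriv_step_Iic : ∫ s in Iic 0, deriv step s = -1 := by
  rw [integral_Iic_of_hasDerivAt_of_tendsto (m := 1) contDiff_step.continuous.continuousWithinAt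
    (fun s _ => hasDerivAt_step s) integrable_deriv_step.integrableOn, step_eq_zero (by simp),
    zero_sub]
  refine tendsto_const_nhds.congr' ?_
  filter_upwards [eventually_le_atBot (-2)] with s hs
  exact (step_eq_one ((by linarith : (2:ℝ) ≤ -s).trans (neg_le_abs s))).symm

theorem PiecewiseSmooth.contDiff_mul (h𝓗 : IsArrangement 𝓗) (hG : PiecewiseSmooth 𝓗 G)
    {χ : E d → ℝ} (hχ : ContDiff ℝ ∞ χ) (h0 : ∀ x ∈ skel 𝓗, χ =ᶠ[𝓝 x] 0) :
    ContDiff ℝ ∞ fun x => G x * χ x := by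
  refine contDiff_iff_contDiffAt.2 fun x => ?_
  by_cases hx : x ∈ skel 𝓗
  · exact (contDiffAt_const (c := (0 : ℝ))).congr_of_eventuallyEq
      ((h0 x hx).mono fun y hy => by simp [hy])
  · obtain ⟨P, hP, hPx⟩ := hG.exists_nhds h𝓗 hx
    exact (hP.mul hχ).contDiffAt.congr_of_eventuallyEq (hPx.mono fun y hy => by simp [hy])

theorem PiecewiseSmooth.partialDeriv_mul (h𝓗 : IsArrangement 𝓗) (hG : PiecewiseSmooth 𝓗 G)
    {χ : E d → ℝ} (hχ : ContDiff ℝ ∞ χ) (h0 : ∀ x ∈ skel 𝓗, χ =ᶠ[𝓝 x] 0) (j : Fin d) (x : E d) :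
    CutStokes.partialDeriv j (fun x => G x * χ x) x
      = CutStokes.partialDeriv j G x * χ x + G x * CutStokes.partialDeriv j χ x := by
  by_cases hx : x ∈ skel 𝓗
  · have h1 : (fun x => G x * χ x) =ᶠ[𝓝 x] fun _ => 0 := (h0 x hx).mono fun y hy => by simp [hy]
    have h2 : χ =ᶠ[𝓝 x] fun _ => 0 := h0 x hx
    rw [CutStokes.partialDeriv, h1.fderiv_eq, h2.eq_of_nhds, CutStokes.partialDeriv,
      CutStokes.partialDeriv, h2.fderiv_eq]
    simp
  · obtain ⟨P, hP, hPx⟩ := hG.exists_nhds h𝓗 hx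
    have h1 : (fun x => G x * χ x) =ᶠ[𝓝 x] fun x => P x * χ x := hPx.mono fun y hy => by simp [hy]
    rw [CutStokes.partialDeriv, h1.fderiv_eq, hPx.eq_of_nhds, CutStokes.partialDeriv, hPx.fderiv_eq]
    have := CutStokes.partialDeriv_mul hP.differentiable_infty hχ.differentiable_infty j x
    simp only [CutStokes.partialDeriv] at this ⊢
    rw [this]; ring

end GaussGreen

/-! ### Jumps over the hyperplanes as limits of slab integrals. -/

section GaussGreenFormula

variable {d : ℕ} {𝓗 : Finset (Set (E d))} {G : E d → ℝ}

theorem IsArrangement.exists_ball_inter_skel (h𝓗 : IsArrangement 𝓗) {H : Set (E d)} {y : E d}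
    (hy : y ∈ H) (hH : H ∈ 𝓗) (hy' : y ∉ edges 𝓗) :
    ∃ r, 0 < r ∧ Metric.ball y r ∩ skel 𝓗 ⊆ H := by
  classical
  have hcl : IsClosed (⋃ H' ∈ 𝓗.erase H, H') :=
    isClosed_biUnion_finset fun H' hH' => h𝓗.isClosed (Finset.mem_of_mem_erase hH')
  have hyc : y ∈ (⋃ H' ∈ 𝓗.erase H, H')ᶜ := by
    simp only [mem_compl_iff, mem_iUnion, not_exists]
    exact fun H' hH' hyH' => hy' (mem_edges.2 ⟨H, hH, H', Finset.mem_of_mem_erase hH',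
      (Finset.ne_of_mem_erase hH').symm, hy, hyH'⟩)
  obtain ⟨r, hr, hball⟩ := Metric.isOpen_iff.1 hcl.isOpen_compl y hyc
  refine ⟨r, hr, fun x hx => ?_⟩
  obtain ⟨H', hH', hxH'⟩ := mem_skel.1 hx.2
  by_contra hxH
  refine hball hx.1 (mem_iUnion₂.2 ⟨H', Finset.mem_erase.2 ⟨?_, hH'⟩, hxH'⟩)
  rintro rfl
  exact hxH hxH'

theorem PiecewiseSmooth.exists_above (hG : PiecewiseSmooth 𝓗 G) {ν : E d}
    {c r : ℝ} {y : E d} (hr : Metric.ball y r ∩ skel 𝓗 ⊆ hyper ν c) :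
    ∃ P, ContDiff ℝ ∞ P ∧ EqOn G P (Metric.ball y r ∩ above ν c) := by
  obtain ⟨Ps, hP, hA⟩ := hG
  obtain ⟨P, hPs, hPA⟩ := hA (Metric.ball y r ∩ above ν c) (Metric.isOpen_ball.inter
    (isOpen_above ν c)) ((convex_ball y r).inter (convex_above ν c)).isPreconnected
    (disjoint_left.2 fun x hx hxs => (ne_of_gt hx.2 : inner ℝ ν x ≠ c) (hr ⟨hx.1, hxs⟩))
  exact ⟨P, hP P hPs, hPA⟩

theorem PiecewiseSmooth.exists_below (hG : PiecewiseSmooth 𝓗 G) {ν : E d}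
    {c r : ℝ} {y : E d} (hr : Metric.ball y r ∩ skel 𝓗 ⊆ hyper ν c) :
    ∃ P, ContDiff ℝ ∞ P ∧ EqOn G P (Metric.ball y r ∩ {x | inner ℝ ν x < c}) := by
  rw [← above_neg]
  exact hG.exists_above (by rwa [hyper_neg])

theorem ball_mem_nhdsWithin {s : Set (E d)} {y : E d} {r : ℝ} (hr : 0 < r) :
    Metric.ball y r ∩ s ∈ 𝓝[s] y :=
  inter_mem (mem_nhdsWithin_of_mem_nhds (Metric.ball_mem_nhds y hr)) self_mem_nhdsWithin

theorem tendsto_of_eqOn_ball {s : Set (E d)} {y : E d} {r : ℝ} (hr : 0 < r) {P : E d → ℝ}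
    (hP : Continuous P) (h : EqOn G P (Metric.ball y r ∩ s)) : Tendsto G (𝓝[s] y) (𝓝 (P y)) :=
  (hP.continuousAt.tendsto.mono_left nhdsWithin_le_nhds).congr'
    (h.symm.eventuallyEq_of_mem (ball_mem_nhdsWithin hr))

theorem tendsto_par_above {ν : E d} (hν : ‖ν‖ = 1) (c : ℝ) (y : (Submodule.span ℝ {ν})ᗮ) {s : ℝ}
    (hs : 0 < s) : Tendsto (fun δ => par ν c y (δ * s)) (𝓝[>] 0) (𝓝[above ν c] (par ν c y 0)) := by
  refine tendsto_nhdsWithin_iff.2 ⟨?_, ?_⟩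
  · have : Continuous fun δ : ℝ => par ν c y (δ * s) := by unfold par; fun_prop
    simpa using this.tendsto 0 |>.mono_left nhdsWithin_le_nhds
  · filter_upwards [self_mem_nhdsWithin] with δ (hδ : 0 < δ)
    simp only [above, mem_ofPred_eq, inner_par hν]
    linarith [mul_pos hδ hs]

theorem tendsto_par_below {ν : E d} (hν : ‖ν‖ = 1) (c : ℝ) (y : (Submodule.span ℝ {ν})ᗮ) {s : ℝ}
    (hs : s < 0) :
    Tendsto (fun δ => par ν c y (δ * s)) (𝓝[>] 0) (𝓝[{x | inner ℝ ν x < c}] (par ν c y 0)) := by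
  refine tendsto_nhdsWithin_iff.2 ⟨?_, ?_⟩
  · have : Continuous fun δ : ℝ => par ν c y (δ * s) := by unfold par; fun_prop
    simpa using this.tendsto 0 |>.mono_left nhdsWithin_le_nhds
  · filter_upwards [self_mem_nhdsWithin] with δ (hδ : 0 < δ)
    simp only [inner_par hν]
    linarith [mul_neg_of_pos_of_neg hδ hs]

theorem PiecewiseSmooth.integrable_mul (h𝓗 : IsArrangement 𝓗) (hG : PiecewiseSmooth 𝓗 G)
    {φ : E d → ℝ} (hφ : IsTestFunction univ φ) : Integrable fun x => G x * φ x := by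
  obtain ⟨R, hR⟩ := hφ.2.1.isCompact.isBounded.exists_norm_le
  obtain ⟨B, hB0, hB⟩ := hG.exists_bound h𝓗 R
  have h1 : Integrable fun x => B * |φ x| :=
    ((hφ.continuous.integrable_of_hasCompactSupport hφ.2.1).abs).const_mul B
  refine h1.mono' ((hG.aestronglyMeasurable h𝓗).mul hφ.continuous.aestronglyMeasurable) ?_
  filter_upwards [measure_eq_zero_iff_ae_notMem.1 h𝓗.volume_skel] with x hx
  by_cases hxR : x ∈ tsupport φ
  · rw [norm_mul]
    exact mul_le_mul_of_nonneg_right (hB x hx (hR x hxR)) (norm_nonneg _)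
  · simp [image_eq_zero_of_notMem_tsupport hxR]

/-- The level function of a hyperplane, cut off at scale `δ`. -/
def levelStep (ν : E d) (c δ : ℝ) (x : E d) : ℝ := step ((inner ℝ ν x - c) / δ)

theorem contDiff_level (ν : E d) (c δ : ℝ) : ContDiff ℝ ∞ fun x : E d => (inner ℝ ν x - c) / δ :=
  ((contDiff_const.inner ℝ contDiff_id).sub contDiff_const).div_const δ

theorem contDiff_levelStep (ν : E d) (c δ : ℝ) : ContDiff ℝ ∞ (levelStep ν c δ) :=
  contDiff_step.comp (contDiff_level ν c δ)

theorem eventually_abs_lt_one {ν : E d} {c δ : ℝ} {x : E d} (hx : x ∈ hyper ν c) :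
    ∀ᶠ y in 𝓝 x, |(inner ℝ ν y - c) / δ| < 1 := by
  have : Continuous fun y : E d => |(inner ℝ ν y - c) / δ| := by fun_prop
  refine this.continuousAt.eventually_lt continuousAt_const ?_
  have : inner ℝ ν x = c := hx
  simp [this]

theorem partialDeriv_levelStep (ν : E d) (c δ : ℝ) (j : Fin d) (x : E d) :
    partialDeriv j (levelStep ν c δ) x = δ⁻¹ * deriv step ((inner ℝ ν x - c) / δ) * ν j := by
  have h1 : HasFDerivAt (fun x : E d => (inner ℝ ν x - c) / δ) (δ⁻¹ • innerSL ℝ ν) x := by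
    have := ((innerSL ℝ ν).hasFDerivAt (x := x)).sub_const c |>.const_mul δ⁻¹
    refine this.congr_of_eventuallyEq (Eventually.of_forall fun y => ?_)
    simp [div_eq_inv_mul]
  have h2 := (hasDerivAt_step ((inner ℝ ν x - c) / δ)).comp_hasFDerivAt x h1
  rw [partialDeriv, show levelStep ν c δ = step ∘ fun x : E d => (inner ℝ ν x - c) / δ from rfl,
    h2.fderiv]
  simp [EuclideanSpace.inner_single_right]
  ring

theorem eventually_levelStep_eq_one {ν : E d} {c : ℝ} {X : ℝ → E d} {x : E d} (hx : x ∉ hyper ν c)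
    (hX : Tendsto X (𝓝[>] 0) (𝓝 x)) : ∀ᶠ δ in 𝓝[>] 0, levelStep ν c δ (X δ) = 1 := by
  have hne : inner ℝ ν x - c ≠ 0 := sub_ne_zero.2 hx
  have h1 : Tendsto (fun δ => |inner ℝ ν (X δ) - c|) (𝓝[>] 0) (𝓝 |inner ℝ ν x - c|) := by
    have : Continuous fun y : E d => |inner ℝ ν y - c| := by fun_prop
    exact (this.tendsto x).comp hX
  have h2 : Tendsto (fun δ : ℝ => 2 * δ) (𝓝[>] 0) (𝓝 0) := by
    have : Continuous fun δ : ℝ => 2 * δ := by fun_prop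
    simpa using this.tendsto 0 |>.mono_left nhdsWithin_le_nhds
  filter_upwards [self_mem_nhdsWithin, h2.eventually_lt h1 (abs_pos.2 hne)] with δ (hδ : 0 < δ) h
  refine step_eq_one ?_
  rw [abs_div, abs_of_pos hδ, le_div_iff₀ hδ]
  exact h.le

/-- The Gauss–Green formula for a function that is smooth off an arrangement of hyperplanes. -/
theorem integral_gaussGreen (h𝓗 : IsArrangement 𝓗) (hG : PiecewiseSmooth 𝓗 G)
    {φ J : E d → ℝ} (hφ : IsTestFunction univ φ) (j : Fin d)
    (hJ : ∀ ν c, ‖ν‖ = 1 → hyper ν c ∈ 𝓗 → ∀ y ∈ hyper ν c, y ∉ edges 𝓗 → ∀ a b,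
      Tendsto G (𝓝[{x | inner ℝ ν x < c}] y) (𝓝 a) → Tendsto G (𝓝[above ν c] y) (𝓝 b) →
        J y = (a - b) * ν j * φ y) :
    (∫ x, G x * partialDeriv j φ x) + (∫ x, partialDeriv j G x * φ x)
      = ∑ H ∈ 𝓗, ∫ x in H, J x ∂(area d) := by
  classical
  have hex : ∀ H : Set (E d), ∃ (ν : E d) (c : ℝ), H ∈ 𝓗 → ‖ν‖ = 1 ∧ H = hyper ν c := by
    intro H
    by_cases hH : H ∈ 𝓗
    · obtain ⟨ν, c, h⟩ := h𝓗 H hH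
      exact ⟨ν, c, fun _ => h⟩
    · exact ⟨0, 0, fun h => absurd h hH⟩
  choose N C hNC using hex
  have hskel : ∀ x, x ∈ skel 𝓗 ↔ ∃ H ∈ 𝓗, x ∈ hyper (N H) (C H) := fun x => by
    rw [mem_skel]
    exact exists_congr fun H => and_congr_right fun hH => by rw [← (hNC H hH).2]
  -- χ vanishes near every hyperplane, so G χ is smooth and ordinary integration by parts applies.
  -- As δ → 0, χ tends to 1 off the arrangement, while its gradient concentrates in slabs of width
  -- of order δ and produces the jumps.
  set χ : ℝ → E d → ℝ := fun δ x => ∏ H ∈ 𝓗, levelStep (N H) (C H) δ x with hχ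
  have hχs : ∀ δ, ContDiff ℝ ∞ (χ δ) := fun δ => contDiff_prod fun H _ => contDiff_levelStep _ _ _
  have hχ0 : ∀ δ, ∀ x ∈ skel 𝓗, χ δ =ᶠ[𝓝 x] 0 := fun δ x hx => by
    obtain ⟨H, hH, hxH⟩ := (hskel x).1 hx
    filter_upwards [eventually_abs_lt_one (δ := δ) hxH] with y hy
    exact Finset.prod_eq_zero hH (step_eq_zero hy.le)
  have hχ1 : ∀ δ x, |χ δ x| ≤ 1 := fun δ x => by
    have h0 : 0 ≤ χ δ x := Finset.prod_nonneg fun H _ => (step_mem_Icc _).1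
    rw [abs_of_nonneg h0]
    exact Finset.prod_le_one (fun H _ => (step_mem_Icc _).1) fun H _ => (step_mem_Icc _).2
  -- The weight left over when the derivative falls on the factor of χ that belongs to H.
  set K : Set (E d) → ℝ → E d → ℝ := fun H δ x =>
    G x * φ x * ∏ H' ∈ 𝓗.erase H, levelStep (N H') (C H') δ x with hKdef
  have hχd : ∀ δ x, partialDeriv j (χ δ) x = ∑ H ∈ 𝓗,
      (∏ H' ∈ 𝓗.erase H, levelStep (N H') (C H') δ x) *
        (δ⁻¹ * deriv step ((inner ℝ (N H) x - C H) / δ) * N H j) := fun δ x => by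
    simp only [partialDeriv, hχ]
    rw [fderiv_finsetProd fun H _ =>
      (contDiff_levelStep _ _ _).differentiable_infty x]
    simp only [sum_apply, smul_apply, smul_eq_mul]
    refine Finset.sum_congr rfl fun H _ => ?_
    rw [← partialDeriv_levelStep]; rfl
  obtain ⟨R, hR⟩ := hφ.2.1.isCompact.isBounded.exists_norm_le
  have hφR : ∀ x, R < ‖x‖ → φ x = 0 := fun x hx =>
    image_eq_zero_of_notMem_tsupport fun h => (hR x h).not_gt hx
  obtain ⟨B, hB0, hB⟩ := hG.exists_bound h𝓗 R
  obtain ⟨Cφ, hCφ⟩ := hφ.continuous.bounded_above_of_compact_support hφ.2.1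
  obtain ⟨Cs, hCs⟩ := continuous_deriv_step.bounded_above_of_compact_support
    (HasCompactSupport.intro (isCompact_closedBall 0 2) fun s hs =>
      deriv_step_eq_zero (by simpa using hs))
  have hCs0 : 0 ≤ Cs := (norm_nonneg _).trans (hCs 0)
  have hCφ0 : 0 ≤ Cφ := (norm_nonneg _).trans (hCφ 0)
  have hsmooth' : ContDiff ℝ ∞ (deriv step) := (contDiff_infty_iff_deriv.1 contDiff_step).2
  -- the weights near `H`
  have hψ : ∀ H ∈ 𝓗, ∀ δ, ContDiff ℝ ∞ (fun x => φ x *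
      (∏ H' ∈ 𝓗.erase H, levelStep (N H') (C H') δ x) *
        deriv step ((inner ℝ (N H) x - C H) / δ)) := fun H _ δ =>
    (hφ.1.mul (contDiff_prod fun H _ => contDiff_levelStep _ _ _)).mul (hsmooth'.comp (contDiff_level _ _ _))
  -- Near H the derivative of `step` vanishes, and near any other hyperplane the remaining product
  -- does. Multiplication by the discontinuous G therefore stays smooth.
  have hψ0 : ∀ H ∈ 𝓗, ∀ δ, ∀ x ∈ skel 𝓗, (fun x => φ x *
      (∏ H' ∈ 𝓗.erase H, levelStep (N H') (C H') δ x) *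
        deriv step ((inner ℝ (N H) x - C H) / δ)) =ᶠ[𝓝 x] 0 := fun H hH δ x hx => by
    obtain ⟨H', hH', hxH'⟩ := (hskel x).1 hx
    filter_upwards [eventually_abs_lt_one (δ := δ) hxH'] with y hy
    by_cases h : H' = H
    · subst h
      simp [deriv_step_eq_zero' hy]
    · have : ∏ H' ∈ 𝓗.erase H, levelStep (N H') (C H') δ y = 0 :=
        Finset.prod_eq_zero (Finset.mem_erase.2 ⟨h, hH'⟩) (step_eq_zero hy.le)
      simp [this]
  have hKc : ∀ H ∈ 𝓗, ∀ δ, Continuous fun x =>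
      K H δ x * deriv step ((inner ℝ (N H) x - C H) / δ) := fun H hH δ => by
    refine (hG.contDiff_mul h𝓗 (hψ H hH δ) (hψ0 H hH δ)).continuous.congr fun x => ?_
    simp only [hKdef]; ring
  have hKcs : ∀ H δ, HasCompactSupport fun x =>
      K H δ x * deriv step ((inner ℝ (N H) x - C H) / δ) := fun H δ =>
    HasCompactSupport.intro (isCompact_closedBall 0 R) fun x hx => by
      simp [hKdef, hφR x (by simpa using hx)]
  have hslab : ∀ H ∈ 𝓗, Tendsto (fun δ => ∫ x, K H δ x *
      (δ⁻¹ * deriv step ((inner ℝ (N H) x - C H) / δ)) * N H j) (𝓝[>] 0)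
      (𝓝 (- ∫ x in H, J x ∂(area d))) := by
    intro H hH
    obtain ⟨hN, hHe⟩ := hNC H hH
    have hHe' : hyper (N H) (C H) ∈ 𝓗 := hHe ▸ hH
    set a : (Submodule.span ℝ {N H})ᗮ → ℝ := fun y =>
      limUnder (𝓝[{x | inner ℝ (N H) x < C H}] (par (N H) (C H) y 0)) G * φ (par (N H) (C H) y 0)
    set b : (Submodule.span ℝ {N H})ᗮ → ℝ := fun y =>
      limUnder (𝓝[above (N H) (C H)] (par (N H) (C H) y 0)) G * φ (par (N H) (C H) y 0)
    have hreg : ∀ᵐ y : (Submodule.span ℝ {N H})ᗮ, par (N H) (C H) y 0 ∉ edges 𝓗 := by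
      refine (ae_hyper_iff (P := fun x => x ∉ edges 𝓗) hN).1 (ae_restrict_of_ae ?_)
      exact measure_eq_zero_iff_ae_notMem.1 h𝓗.area_edges
    have hmem : ∀ y, par (N H) (C H) y 0 ∈ hyper (N H) (C H) := fun y => by
      simp [hyper, inner_par hN]
    -- the behaviour of `K` along normal lines through regular points
    have hlim : ∀ y, par (N H) (C H) y 0 ∉ edges 𝓗 → ∀ X : ℝ → E d, ∀ A, ∀ g,
        Tendsto X (𝓝[>] 0) (𝓝[A] (par (N H) (C H) y 0)) →
        Tendsto G (𝓝[A] (par (N H) (C H) y 0)) (𝓝 g) →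
        Tendsto (fun δ => K H δ (X δ)) (𝓝[>] 0) (𝓝 (g * φ (par (N H) (C H) y 0))) := by
      intro y hy X A g hX hg
      have hX' := hX.mono_right nhdsWithin_le_nhds
      have h1 : ∀ᶠ δ in 𝓝[>] 0, ∏ H' ∈ 𝓗.erase H, levelStep (N H') (C H') δ (X δ) = 1 := by
        have : ∀ H' ∈ 𝓗.erase H, ∀ᶠ δ in 𝓝[>] 0, levelStep (N H') (C H') δ (X δ) = 1 := by
          intro H' hH'
          have hm := Finset.mem_of_mem_erase hH'
          refine eventually_levelStep_eq_one (fun hyH' => hy ?_) hX'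
          refine mem_edges.2 ⟨H, hH, H', hm, (Finset.ne_of_mem_erase hH').symm, ?_, ?_⟩
          · exact hHe.symm.subset (hmem y)
          · exact (hNC H' hm).2.symm.subset hyH'
        filter_upwards [(Finset.eventually_all _).2 this] with δ h
        exact Finset.prod_eq_one h
      refine ((hg.comp hX).mul ((hφ.continuous.tendsto _).comp hX')).congr' ?_
      filter_upwards [h1] with δ h
      simp [hKdef, h]
    have hsides : ∀ y, par (N H) (C H) y 0 ∉ edges 𝓗 →
        Tendsto G (𝓝[{x | inner ℝ (N H) x < C H}] (par (N H) (C H) y 0))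
          (𝓝 (limUnder (𝓝[{x | inner ℝ (N H) x < C H}] (par (N H) (C H) y 0)) G)) ∧
        Tendsto G (𝓝[above (N H) (C H)] (par (N H) (C H) y 0))
          (𝓝 (limUnder (𝓝[above (N H) (C H)] (par (N H) (C H) y 0)) G)) := by
      intro y hy
      obtain ⟨r, hr, hball⟩ := h𝓗.exists_ball_inter_skel (hmem y) hHe' hy
      obtain ⟨P, hP, hPe⟩ := hG.exists_above hball
      obtain ⟨Q, hQ, hQe⟩ := hG.exists_below hball
      exact ⟨tendsto_nhds_limUnder ⟨_, tendsto_of_eqOn_ball hr hQ.continuous hQe⟩,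
        tendsto_nhds_limUnder ⟨_, tendsto_of_eqOn_ball hr hP.continuous hPe⟩⟩
    have key := tendsto_integral_slab (c := C H) (K := K H) (ρ := deriv step) (a := a) (b := b)
      (B := B * Cφ * Cs) (R := R) hN
      (fun s => deriv_step_eq_zero) (fun δ _ => hKc H hH δ) ?_ ?_ ?_ ?_ integrable_deriv_step
    -- The derivative of `step` has integral -1 over the negative half line and 1 over the positive
    -- one, so the limit is ∫ (b - a) νⱼ φ = -∫ J.
    · have := key.mul_const (N H j)
      refine (tendsto_congr fun δ => ?_).1 (this.trans (le_of_eq ?_))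
      · rw [integral_mul_const]
      · congr 1
        have e0 : ∫ x in H, J x ∂(area d) = ∫ x in hyper (N H) (C H), J x ∂(area d) := by
          rw [← hHe]
        rw [e0, integral_hyper hN, ← integral_neg, ← integral_mul_const,
          integral_deriv_step_Ioi, integral_deriv_step_Iic]
        refine integral_congr_ae ?_
        filter_upwards [hreg] with y hy
        rw [hJ (N H) (C H) hN hHe' _ (hmem y) hy _ _ (hsides y hy).1 (hsides y hy).2]
        simp only [a, b]
        ring
    · intro δ x hδ
      by_cases hx : x ∈ skel 𝓗
      · have := (hψ0 H hH δ x hx).eq_of_nhds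
        simp only [Pi.zero_apply] at this
        simp only [hKdef]
        rw [show G x * φ x * (∏ H' ∈ 𝓗.erase H, levelStep (N H') (C H') δ x) *
          deriv step ((inner ℝ (N H) x - C H) / δ) = G x * (φ x *
          (∏ H' ∈ 𝓗.erase H, levelStep (N H') (C H') δ x) *
          deriv step ((inner ℝ (N H) x - C H) / δ)) by ring, this, mul_zero, abs_zero]
        positivity
      · by_cases hxR : R < ‖x‖
        · simp only [hKdef, hφR x hxR]
          simp; positivity
        · simp only [hKdef]
          have hp0 : 0 ≤ ∏ H' ∈ 𝓗.erase H, levelStep (N H') (C H') δ x :=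
            Finset.prod_nonneg fun H _ => (step_mem_Icc _).1
          have hp1 : ∏ H' ∈ 𝓗.erase H, levelStep (N H') (C H') δ x ≤ 1 :=
            Finset.prod_le_one (fun H _ => (step_mem_Icc _).1) fun H _ => (step_mem_Icc _).2
          rw [abs_mul, abs_mul, abs_mul, abs_of_nonneg hp0]
          have e1 := hB x hx (not_lt.1 hxR)
          have e2 := hCφ x
          have e3 := hCs ((inner ℝ (N H) x - C H) / δ)
          rw [Real.norm_eq_abs] at e2 e3
          calc _ ≤ B * Cφ * 1 * Cs := by gcongr
            _ = _ := by ring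
    · intro δ x hx
      simp [hKdef, hφR x hx]
    · filter_upwards [hreg] with y hy s hs
      exact hlim y hy _ _ _ (tendsto_par_above hN _ y hs) (hsides y hy).2
    · filter_upwards [hreg] with y hy s hs
      exact hlim y hy _ _ _ (tendsto_par_below hN _ y hs) (hsides y hy).1
  -- the identity for the cut off function
  have hid : ∀ δ, 0 < δ → (∫ x, G x * partialDeriv j φ x * χ δ x)
      + (∫ x, partialDeriv j G x * φ x * χ δ x)
      = - ∑ H ∈ 𝓗, ∫ x, K H δ x * (δ⁻¹ * deriv step ((inner ℝ (N H) x - C H) / δ)) * N H j := by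
    intro δ hδ
    have h1 := integral_mul_partialDeriv (hG.contDiff_mul h𝓗 (hχs δ) (hχ0 δ)) hφ j
    have i1 : Integrable fun x => partialDeriv j G x * φ x * χ δ x :=
      (((hG.partialDeriv j).integrable_mul h𝓗 hφ).mul_bdd (c := 1)
        (hχs δ).continuous.aestronglyMeasurable (ae_of_all _ fun x => hχ1 δ x))
    have i2 : ∀ H ∈ 𝓗, Integrable fun x =>
        K H δ x * (δ⁻¹ * deriv step ((inner ℝ (N H) x - C H) / δ)) * N H j := fun H hH => by
      refine (((hKc H hH δ).integrable_of_hasCompactSupport (hKcs H δ)).const_mul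
        (δ⁻¹ * N H j)).congr (ae_of_all _ fun x => ?_)
      ring
    rw [← integral_finsetSum _ i2]
    have e1 : ∫ x, G x * partialDeriv j φ x * χ δ x
        = ∫ x, G x * χ δ x * partialDeriv j φ x := by congr 1 with x; ring
    rw [e1, h1, neg_add_eq_iff_eq_add, ← sub_eq_add_neg, eq_sub_iff_add_eq,
      ← integral_add i1 (integrable_finsetSum _ i2)]
    congr 1 with x
    rw [hG.partialDeriv_mul h𝓗 (hχs δ) (hχ0 δ), hχd, add_mul, Finset.mul_sum, Finset.sum_mul]
    congr 1
    · ring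
    · refine Finset.sum_congr rfl fun H _ => ?_
      simp only [hKdef]; ring
  have hpt : ∀ x ∉ skel 𝓗, Tendsto (fun δ => χ δ x) (𝓝[>] 0) (𝓝 1) := by
    intro x hx
    refine tendsto_const_nhds.congr' ?_
    have : ∀ H ∈ 𝓗, ∀ᶠ δ in 𝓝[>] 0, levelStep (N H) (C H) δ x = 1 := fun H hH =>
      eventually_levelStep_eq_one (fun h => hx ((hskel x).2 ⟨H, hH, h⟩)) tendsto_const_nhds
    filter_upwards [(Finset.eventually_all _).2 this] with δ h
    exact (Finset.prod_eq_one h).symm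
  have hdom : ∀ g : E d → ℝ, Integrable g →
      Tendsto (fun δ => ∫ x, g x * χ δ x) (𝓝[>] 0) (𝓝 (∫ x, g x)) := by
    intro g hg
    refine tendsto_integral_filter_of_dominated_convergence (fun x => ‖g x‖) ?_ ?_ hg.norm ?_
    · exact Eventually.of_forall fun δ => hg.1.mul (hχs δ).continuous.aestronglyMeasurable
    · refine Eventually.of_forall fun δ => ae_of_all _ fun x => ?_
      rw [norm_mul]
      exact mul_le_of_le_one_right (norm_nonneg _) (hχ1 δ x)
    · filter_upwards [measure_eq_zero_iff_ae_notMem.1 h𝓗.volume_skel] with x hx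
      simpa using (hpt x hx).const_mul (g x)
  have hl := (hdom _ (hG.integrable_mul h𝓗 (hφ.partialDeriv j))).add
    (hdom _ ((hG.partialDeriv j).integrable_mul h𝓗 hφ))
  have hr := (tendsto_finsetSum _ hslab).neg
  simp only [Finset.sum_neg_distrib, neg_neg] at hr
  refine tendsto_nhds_unique hl (hr.congr' ?_)
  filter_upwards [self_mem_nhdsWithin] with δ hδ
  exact (hid δ hδ).symm

end GaussGreenFormula

/-! ### Polytopes and composite meshes -/

section Geometry

variable {d : ℕ}

theorem IsPolytope.isCompact {K : Set (E d)} (hK : IsPolytope K) : IsCompact K := by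
  obtain ⟨⟨s, rfl⟩, -⟩ := hK
  exact s.finite_toSet.isCompact_convexHull (𝕜 := ℝ)

theorem IsPolytope.convex {K : Set (E d)} (hK : IsPolytope K) : Convex ℝ K := by
  obtain ⟨⟨s, rfl⟩, -⟩ := hK
  exact convex_convexHull ℝ _

/-- At a boundary point x take a supporting functional; x is a convex combination of generators that
all lie on its supporting hyperplane. One hyperplane is fixed in advance for each set of generators
that lies on some hyperplane. Since the hyperplane fixed for the supporting set contains these
generators, it contains x as well, and finitely many hyperplanes suffice. -/
theorem IsPolytope.exists_arrangement {K : Set (E d)} (hK : IsPolytope K) :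
    ∃ 𝓗 : Finset (Set (E d)), IsArrangement 𝓗 ∧ frontier K ⊆ skel 𝓗 := by
  classical
  have hcl := hK.isCompact.isClosed
  have hconv := hK.convex
  obtain ⟨⟨s, hs⟩, hint⟩ := hK
  let Ok : Finset (E d) → Set (E d) → Prop := fun t H =>
    ∃ (ν : E d) (c : ℝ), ‖ν‖ = 1 ∧ H = hyper ν c ∧ ∀ z ∈ t, z ∈ hyper ν c
  let ch : Finset (E d) → Set (E d) := fun t => if h : ∃ H, Ok t H then h.choose else ∅
  refine ⟨(s.powerset.filter fun t => ∃ H, Ok t H).image ch, ?_, ?_⟩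
  · simp only [IsArrangement, Finset.mem_image, Finset.mem_filter]
    rintro _ ⟨t, ⟨-, ht⟩, rfl⟩
    simp only [ch, dif_pos ht]
    obtain ⟨ν, c, hν, hH, -⟩ := ht.choose_spec
    exact ⟨ν, c, hν, hH⟩
  · intro x hx
    rw [hcl.frontier_eq] at hx
    obtain ⟨f, hf⟩ := geometric_hahn_banach_open_point hconv.interior isOpen_interior hx.2
    have hle : ∀ y ∈ K, f y ≤ f x := by
      have h1 : closure (interior K) ⊆ {y | f y ≤ f x} :=
        closure_minimal (fun y hy => (hf y hy).le) (isClosed_le f.continuous continuous_const)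
      rw [hconv.closure_interior_eq_closure_of_nonempty_interior hint] at h1
      exact fun y hy => h1 (subset_closure hy)
    have hf0 : f ≠ 0 := by
      rintro rfl
      obtain ⟨a, ha⟩ := hint
      simpa using hf a ha
    have ht : ∃ H, Ok (s.filter fun z => f z = f x) H := by
      set ν₀ := (InnerProductSpace.toDual ℝ (E d)).symm f
      have hν₀ : ν₀ ≠ 0 := by simpa [ν₀] using hf0
      refine ⟨_, ‖ν₀‖⁻¹ • ν₀, ‖ν₀‖⁻¹ * f x, norm_smul_inv_norm hν₀, rfl, fun z hz => ?_⟩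
      have hz' := (Finset.mem_filter.1 hz).2
      rw [hyper, mem_ofPred_eq, inner_smul_left, InnerProductSpace.toDual_symm_apply, hz']
      rfl
    refine mem_skel.2 ⟨_, Finset.mem_image_of_mem _ (Finset.mem_filter.2
      ⟨Finset.mem_powerset.2 (Finset.filter_subset (fun z => f z = f x) s), ht⟩), ?_⟩
    simp only [ch, dif_pos ht]
    obtain ⟨ν, c, -, hH, hz⟩ := ht.choose_spec
    rw [hH]
    have hxK := hx.1
    rw [hs, Finset.mem_convexHull'] at hxK
    obtain ⟨w, hw0, hw1, hwx⟩ := hxK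
    have hmem : ∀ z ∈ s, w z * f x = w z * f z → w z * inner ℝ ν z = w z * c := by
      intro z hzs h
      rcases eq_or_ne (w z) 0 with h0 | h0
      · simp [h0]
      · rw [hz z (Finset.mem_filter.2 ⟨hzs, (mul_left_cancel₀ h0 h).symm⟩)]
    have hsum : ∑ z ∈ s, w z * f z = ∑ z ∈ s, w z * f x := by
      rw [← Finset.sum_mul, hw1, one_mul]
      conv_rhs => rw [← hwx]
      simp
    -- The functional is maximal at x, so a convex combination equal to x can give positive weight
    -- only to maximizing generators.
    have hall := (Finset.sum_eq_sum_iff_of_le (fun z hz => mul_le_mul_of_nonneg_left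
      (hle z (hs ▸ subset_convexHull ℝ _ hz)) (hw0 z hz))).1 hsum
    rw [hyper, mem_ofPred_eq, ← hwx, inner_sum]
    simp only [inner_smul_right]
    rw [Finset.sum_congr rfl fun z hz => hmem z hz (hall z hz).symm, ← Finset.sum_mul, hw1, one_mul]

theorem frontier_biUnion_finset_subset {ι : Type*} (T : Finset ι) (K : ι → Set (E d)) :
    frontier (⋃ i ∈ T, K i) ⊆ ⋃ i ∈ T, frontier (K i) := by
  classical
  induction T using Finset.induction_on with
  | empty => simp
  | insert a T _ ih =>
    rw [Finset.set_biUnion_insert, Finset.set_biUnion_insert]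
    exact (frontier_union_subset _ _).trans (union_subset_union inter_subset_left
      (inter_subset_right.trans ih))

theorem frontier_eq_of_interior_closure {U : Set (E d)} (hU : IsOpen U)
    (h : interior (closure U) = U) : frontier U = frontier (closure U) := by
  rw [frontier, frontier, closure_closure, h, hU.interior_eq]

namespace CompositeMesh

variable (M : CompositeMesh d)

/-- A finite family of hyperplanes that contains the boundaries of all mesh elements. -/
def Adapted (M : CompositeMesh d) (𝓗 : Finset (Set (E d))) : Prop :=
  IsArrangement 𝓗 ∧ ∀ i, ∀ K ∈ M.mesh i, frontier K ⊆ skel 𝓗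

theorem exists_adapted : ∃ 𝓗, M.Adapted 𝓗 := by
  classical
  have h : ∀ K : Set (E d), ∃ 𝓗 : Finset (Set (E d)), IsArrangement 𝓗 ∧
      (IsPolytope K → frontier K ⊆ skel 𝓗) := fun K => by
    by_cases hK : IsPolytope K
    · obtain ⟨𝓗, h1, h2⟩ := hK.exists_arrangement
      exact ⟨𝓗, h1, fun _ => h2⟩
    · exact ⟨∅, by simp [IsArrangement], fun h => absurd h hK⟩
  choose 𝓕 h1 h2 using h
  refine ⟨(M.mesh 0 ∪ M.mesh 1).biUnion 𝓕, fun H hH => ?_, fun i K hK x hx => ?_⟩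
  · obtain ⟨K, -, hHK⟩ := Finset.mem_biUnion.1 hH
    exact h1 K H hHK
  · obtain ⟨H, hH, hxH⟩ := mem_skel.1 (h2 K ((M.isMesh i).1 K hK) hx)
    refine mem_skel.2 ⟨H, Finset.mem_biUnion.2 ⟨K, ?_, hH⟩, hxH⟩
    fin_cases i
    exacts [Finset.mem_union_left _ hK, Finset.mem_union_right _ hK]

theorem isOpen_Ω : IsOpen M.Ω := M.isPolyhedralDomain.1

theorem isOpen_pre (i : Fin 2) : IsOpen (M.pre i) := (M.isPolyhedralDomain_pre i).1

theorem pre_subset (i : Fin 2) : M.pre i ⊆ M.Ω := by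
  rw [← M.pre_union]
  fin_cases i
  exacts [subset_union_left, subset_union_right]

theorem interior_closure_pre (i : Fin 2) : interior (closure (M.pre i)) = M.pre i :=
  (M.isPolyhedralDomain_pre i).2.2.1

theorem isBounded_closure_pre (i : Fin 2) : Bornology.IsBounded (closure (M.pre i)) := by
  rw [(M.isMesh i).2.2]
  exact (Bornology.isBounded_biUnion_finset _).2 fun K hK =>
    ((M.isMesh i).1 K hK).isCompact.isBounded

theorem isBounded_Ω : Bornology.IsBounded M.Ω := by
  rw [← M.pre_union]
  exact ((M.isBounded_closure_pre 0).subset subset_closure).union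
    ((M.isBounded_closure_pre 1).subset subset_closure)

theorem volume_Ω_ne_top : volume M.Ω ≠ ⊤ := M.isBounded_Ω.measure_lt_top.ne

theorem part_one : M.part 1 = M.pre 1 := rfl

theorem part_subset (i : Fin 2) : M.part i ⊆ M.Ω := by
  fin_cases i
  exacts [sdiff_subset, M.pre_subset 1]

theorem part_subset_pre (i : Fin 2) : M.part i ⊆ M.pre i := by
  fin_cases i
  · intro x hx
    have h : x ∈ M.pre 0 ∪ M.pre 1 := M.pre_union ▸ hx.1
    exact h.resolve_right hx.2
  · exact le_rfl

theorem measurableSet_part (i : Fin 2) : MeasurableSet (M.part i) := by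
  fin_cases i
  · exact M.isOpen_Ω.measurableSet.diff (M.isOpen_pre 1).measurableSet
  · exact (M.isOpen_pre 1).measurableSet

/-- The elements that make up `Ω_{h,i}`, as a finset. -/
def subFinset (i : Fin 2) : Finset (Set (E d)) := by
  classical exact (M.mesh i).filter fun K => (K ∩ M.part i).Nonempty

theorem mem_subFinset {i : Fin 2} {K : Set (E d)} :
    K ∈ M.subFinset i ↔ K ∈ M.mesh i ∧ (K ∩ M.part i).Nonempty := by
  simp [subFinset]

theorem Ωh_eq (i : Fin 2) : M.Ωh i = ⋃ K ∈ M.subFinset i, K := by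
  simp only [Ωh, mem_subFinset]; rfl

theorem isCompact_mesh {i : Fin 2} {K : Set (E d)} (hK : K ∈ M.mesh i) : IsCompact K :=
  ((M.isMesh i).1 K hK).isCompact

theorem isClosed_Ωh (i : Fin 2) : IsClosed (M.Ωh i) := by
  rw [Ωh_eq]
  exact isClosed_biUnion_finset fun K hK => (M.isCompact_mesh (M.mem_subFinset.1 hK).1).isClosed

theorem mesh_subset_closure {i : Fin 2} {K : Set (E d)} (hK : K ∈ M.mesh i) :
    K ⊆ closure (M.pre i) := by
  rw [(M.isMesh i).2.2]
  exact subset_biUnion_of_mem (u := fun K => K) hK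

theorem interior_mesh_subset {i : Fin 2} {K : Set (E d)} (hK : K ∈ M.mesh i) :
    interior K ⊆ M.pre i := by
  rw [← M.interior_closure_pre i]
  exact interior_mono (M.mesh_subset_closure hK)

theorem Ωh_subset_closure (i : Fin 2) : M.Ωh i ⊆ closure (M.pre i) :=
  iUnion₂_subset fun _ hK => M.mesh_subset_closure hK.1

theorem interior_Ωh_subset (i : Fin 2) : interior (M.Ωh i) ⊆ M.pre i := by
  rw [← M.interior_closure_pre i]
  exact interior_mono (M.Ωh_subset_closure i)

theorem interior_Ωh_subset_Ω (i : Fin 2) : interior (M.Ωh i) ⊆ M.Ω :=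
  (M.interior_Ωh_subset i).trans (M.pre_subset i)

theorem part_subset_Ωh (i : Fin 2) : M.part i ⊆ M.Ωh i := by
  intro x hx
  have hx' : x ∈ closure (M.pre i) := subset_closure (M.part_subset_pre i hx)
  rw [(M.isMesh i).2.2] at hx'
  obtain ⟨K, hK, hxK⟩ := mem_iUnion₂.1 hx'
  exact mem_iUnion₂.2 ⟨K, ⟨hK, x, hxK, hx⟩, hxK⟩

variable {M} {𝓗 : Finset (Set (E d))}

/-- The absence of slits matters here: a predomain is the interior of its closure, so its boundary
is that of the union of its elements. -/
theorem Adapted.frontier_pre (h : M.Adapted 𝓗) (i : Fin 2) : frontier (M.pre i) ⊆ skel 𝓗 := by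
  rw [frontier_eq_of_interior_closure (M.isOpen_pre i) (M.interior_closure_pre i),
    (M.isMesh i).2.2]
  exact (frontier_biUnion_finset_subset _ _).trans (iUnion₂_subset fun K hK => h.2 i K hK)

theorem Adapted.frontier_Ω (h : M.Adapted 𝓗) : frontier M.Ω ⊆ skel 𝓗 := by
  rw [← M.pre_union]
  exact (frontier_union_subset _ _).trans (union_subset (inter_subset_left.trans (h.frontier_pre 0))
    (inter_subset_right.trans (h.frontier_pre 1)))

theorem Adapted.frontier_Ωh (h : M.Adapted 𝓗) (i : Fin 2) : frontier (M.Ωh i) ⊆ skel 𝓗 := by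
  rw [Ωh_eq]
  exact (frontier_biUnion_finset_subset _ _).trans
    (iUnion₂_subset fun K hK => h.2 i K (M.mem_subFinset.1 hK).1)

theorem Adapted.ae_notMem_skel (h : M.Adapted 𝓗) : ∀ᵐ x, x ∉ skel 𝓗 :=
  measure_eq_zero_iff_ae_notMem.1 h.1.volume_skel

theorem Adapted.ae_mem_interior (h : M.Adapted 𝓗) (i : Fin 2) :
    ∀ᵐ x, x ∈ M.Ωh i → x ∈ interior (M.Ωh i) := by
  filter_upwards [h.ae_notMem_skel] with x hx hxi
  by_contra hn
  exact hx (h.frontier_Ωh i ⟨subset_closure hxi, hn⟩)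

theorem Adapted.Γ_subset_skel (h : M.Adapted 𝓗) : M.Γ ⊆ skel 𝓗 :=
  sdiff_subset.trans (h.frontier_pre 1)

variable (M) in
theorem Γ_subset_Ω : M.Γ ⊆ M.Ω := by
  intro x hx
  by_contra hn
  refine hx.2 ⟨closure_mono (M.pre_subset 1) (frontier_subset_closure hx.1), ?_⟩
  rwa [M.isOpen_Ω.interior_eq]

variable (M) in
theorem measurableSet_Γ : MeasurableSet M.Γ :=
  isClosed_frontier.measurableSet.diff isClosed_frontier.measurableSet

/-- In the ball `B(x,r)` the arrangement is the hyperplane `hyper ν c` through `x`, and `pre 1` is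
the side of it from which `ν` points outward. -/
structure RegularAt (M : CompositeMesh d) (𝓗 : Finset (Set (E d))) (x ν : E d) (c r : ℝ) :
    Prop where
  pos : 0 < r
  norm_eq : ‖ν‖ = 1
  hyper_mem : hyper ν c ∈ 𝓗
  mem : x ∈ hyper ν c
  ball_subset : Metric.ball x r ⊆ M.Ω
  ball_inter_skel : Metric.ball x r ∩ skel 𝓗 ⊆ hyper ν c
  below_subset : Metric.ball x r ∩ {z | inner ℝ ν z < c} ⊆ M.pre 1
  above_disjoint : Disjoint (Metric.ball x r ∩ above ν c) (M.pre 1)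

theorem RegularAt.of_mem_ball {x ν y : E d} {c r : ℝ} (h : RegularAt M 𝓗 x ν c r)
    (hy : y ∈ hyper ν c) (hyx : y ∈ Metric.ball x r) :
    RegularAt M 𝓗 y ν c (r - dist y x) := by
  have hs : Metric.ball y (r - dist y x) ⊆ Metric.ball x r :=
    Metric.ball_subset_ball' (by linarith)
  exact ⟨sub_pos.2 hyx, h.norm_eq, h.hyper_mem, hy, hs.trans h.ball_subset,
    (inter_subset_inter_left _ hs).trans h.ball_inter_skel,
    (inter_subset_inter_left _ hs).trans h.below_subset,
    h.above_disjoint.mono_left (inter_subset_inter_left _ hs)⟩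

/-- Off the edges the arrangement is locally a single hyperplane. Each half ball is connected and
avoids the boundary of the upper predomain, hence lies wholly inside or wholly outside it; exactly
one of them must be inside, and this fixes the sign of ν. -/
theorem Adapted.exists_regularAt (h : M.Adapted 𝓗) {x : E d} (hx : x ∈ M.Γ) (hx' : x ∉ edges 𝓗) :
    ∃ ν c r, RegularAt M 𝓗 x ν c r := by
  obtain ⟨H, hH, hxH⟩ := mem_skel.1 (h.Γ_subset_skel hx)
  obtain ⟨r₁, hr₁, hball⟩ := h.1.exists_ball_inter_skel hxH hH hx'
  obtain ⟨r₂, hr₂, hball₂⟩ := Metric.isOpen_iff.1 M.isOpen_Ω x (M.Γ_subset_Ω hx)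
  obtain ⟨ν, c, hν, rfl⟩ := h.1 H hH
  set r := min r₁ r₂
  have hr : 0 < r := lt_min hr₁ hr₂
  have hB : Metric.ball x r ∩ skel 𝓗 ⊆ hyper ν c :=
    (inter_subset_inter_left _ (Metric.ball_subset_ball (min_le_left _ _))).trans hball
  have hΩ : Metric.ball x r ⊆ M.Ω := (Metric.ball_subset_ball (min_le_right _ _)).trans hball₂
  have side : ∀ (ν : E d) (c : ℝ), Metric.ball x r ∩ skel 𝓗 ⊆ hyper ν c →
      Metric.ball x r ∩ above ν c ⊆ M.pre 1 ∨ Disjoint (Metric.ball x r ∩ above ν c) (M.pre 1) :=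
    fun ν c hB => ((convex_ball x r).inter (convex_above ν c)).isPreconnected
      |>.subset_or_disjoint_of_frontier (disjoint_left.2 fun z hz hzf =>
        (ne_of_gt hz.2 : inner ℝ ν z ≠ c) (hB ⟨hz.1, h.frontier_pre 1 hzf⟩))
  have hx1 : x ∈ closure (M.pre 1) ∧ x ∉ M.pre 1 := by
    have := hx.1
    rwa [M.part_one, (M.isOpen_pre 1).frontier_eq] at this
  have hnull : ∀ U : Set (E d), IsOpen U → U ⊆ hyper ν c → U = ∅ := fun U hU hs =>
    (hU.measure_eq_zero_iff volume).1 (measure_mono_null hs (volume_hyper hν c))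
  have hB' : Metric.ball x r ∩ skel 𝓗 ⊆ hyper (-ν) (-c) := by rwa [hyper_neg]
  have hν' : ‖-ν‖ = 1 := by rwa [norm_neg]
  have hbb : {z : E d | inner ℝ (-ν) z < -c} = above ν c := by
    ext z; simp [above, inner_neg_left]
  rcases side ν c hB with ha | ha <;> rcases side (-ν) (-c) hB' with hb | hb
  -- With both half balls inside, the ball lies in the closure of the predomain, so x is interior to
  -- the closure and hence in the open predomain: Γ would be a slit.
  · exfalso
    apply hx1.2
    rw [← M.interior_closure_pre 1, mem_interior_iff_mem_nhds]
    refine mem_of_superset (Metric.ball_mem_nhds x hr) fun z hz => ?_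
    by_contra hn
    have hzc : (closure (M.pre 1))ᶜ ∩ Metric.ball x r = ∅ := by
      refine hnull _ (isClosed_closure.isOpen_compl.inter Metric.isOpen_ball) fun w hw => ?_
      rcases lt_trichotomy (inner ℝ ν w) c with h1 | h1 | h1
      · exact absurd (subset_closure (hb ⟨hw.2, by rw [above_neg]; exact h1⟩)) hw.1
      · exact h1
      · exact absurd (subset_closure (ha ⟨hw.2, h1⟩)) hw.1
    exact (hzc ▸ (⟨hn, hz⟩ : z ∈ (closure (M.pre 1))ᶜ ∩ Metric.ball x r) : z ∈ (∅ : Set (E d)))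
  · exact ⟨-ν, -c, r, hr, hν', by rwa [hyper_neg], by rwa [hyper_neg], hΩ, hB',
      by rwa [hbb], hb⟩
  · exact ⟨ν, c, r, hr, hν, hH, hxH, hΩ, hB, by rwa [above_neg] at hb, ha⟩
  -- With both half balls outside, the open predomain would meet the ball only in the hyperplane,
  -- hence not at all, although x is in its closure.
  · exfalso
    obtain ⟨z, hz, hz1⟩ := mem_closure_iff.1 hx1.1 _ Metric.isOpen_ball (Metric.mem_ball_self hr)
    have hzc : M.pre 1 ∩ Metric.ball x r = ∅ := by
      refine hnull _ ((M.isOpen_pre 1).inter Metric.isOpen_ball) fun w hw => ?_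
      rcases lt_trichotomy (inner ℝ ν w) c with h1 | h1 | h1
      · exact absurd hw.1 (disjoint_left.1 hb ⟨hw.2, by rw [above_neg]; exact h1⟩)
      · exact h1
      · exact absurd hw.1 (disjoint_left.1 ha ⟨hw.2, h1⟩)
    exact (hzc ▸ (⟨hz1, hz⟩ : z ∈ M.pre 1 ∩ Metric.ball x r) : z ∈ (∅ : Set (E d)))

end CompositeMesh

/-- A small step from x in the direction ν' - ν enters A according to ν and leaves it according to
ν'. -/
theorem IsExteriorNormal.unique {A : Set (E d)} {x ν ν' : E d} (h : IsExteriorNormal A x ν)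
    (h' : IsExteriorNormal A x ν') : ν = ν' := by
  by_contra hne
  have h1 : inner ℝ ν ν' < 1 :=
    (inner_lt_one_iff_real_of_norm_eq_one h.1 h'.1).2 hne
  have hX : Tendsto (fun t : ℝ => x + t • (ν' - ν)) (𝓝[>] 0) (𝓝 x) := by
    have : Continuous fun t : ℝ => x + t • (ν' - ν) := by fun_prop
    simpa using (this.tendsto 0).mono_left nhdsWithin_le_nhds
  have hpos : ∀ᶠ t : ℝ in 𝓝[>] 0, 0 < t := self_mem_nhdsWithin
  obtain ⟨t, ht0, ht1, ht2⟩ := (hpos.and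
    ((hX.eventually h.2).and (hX.eventually h'.2))).exists
  have e1 : inner ℝ (x + t • (ν' - ν) - x) ν = t * (inner ℝ ν ν' - 1) := by
    rw [add_sub_cancel_left, inner_smul_left, inner_sub_left, real_inner_self_eq_norm_sq, h.1,
      real_inner_comm]
    simp
  have e2 : inner ℝ (x + t • (ν' - ν) - x) ν' = t * (1 - inner ℝ ν ν') := by
    rw [add_sub_cancel_left, inner_smul_left, inner_sub_left, real_inner_self_eq_norm_sq, h'.1]
    simp
  refine ht2.2 ?_ (ht1.1 ?_)
  · rw [e2]; exact mul_pos ht0 (by linarith)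
  · rw [e1]; exact mul_neg_of_pos_of_neg ht0 (by linarith)

theorem CompositeMesh.RegularAt.n_eq {M : CompositeMesh d} {𝓗 : Finset (Set (E d))} {x ν : E d}
    {c r : ℝ} (h : RegularAt M 𝓗 x ν c r) : M.n x = ν := by
  have hn : IsExteriorNormal (M.part 1) x ν := by
    refine ⟨h.norm_eq, ?_⟩
    filter_upwards [Metric.ball_mem_nhds x h.pos] with y hy
    have hx : inner ℝ ν x = c := h.mem
    rw [real_inner_comm, inner_sub_right, hx, sub_neg, sub_pos]
    exact ⟨fun hlt => h.below_subset ⟨hy, hlt⟩, fun hgt => disjoint_left.1 h.above_disjoint ⟨hy, hgt⟩⟩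
  have hex : ∃ ν, IsExteriorNormal (M.part 1) x ν := ⟨ν, hn⟩
  rw [CompositeMesh.n, exteriorNormal, dif_pos hex]
  exact hex.choose_spec.unique hn

end Geometry

/-! ### Traces on the interface -/

section Traces

variable {d : ℕ}

/-- `w` has the one-sided trace `a` at `x` from `A`. -/
def HasTrace (A : Set (E d)) (w : E d → ℝ) (x : E d) (a : ℝ) : Prop :=
  (∀ᶠ r in 𝓝[>] (0 : ℝ), IntegrableOn w (Metric.ball x r ∩ A)) ∧
    Tendsto (fun r => ⨍ y in Metric.ball x r ∩ A, w y) (𝓝[>] 0) (𝓝 a)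

variable {A A' : Set (E d)} {w w' : E d → ℝ} {x : E d} {a b : ℝ}

theorem HasTrace.trace_eq (h : HasTrace A w x a) : trace A w x = a := h.2.limUnder_eq

theorem HasTrace.sub (h : HasTrace A w x a) (h' : HasTrace A w' x b) :
    HasTrace A (fun y => w y - w' y) x (a - b) := by
  refine ⟨by filter_upwards [h.1, h'.1] with r h1 h2 using h1.sub h2, ?_⟩
  refine (h.2.sub h'.2).congr' ?_
  filter_upwards [h.1, h'.1] with r h1 h2
  rw [setAverage_eq, setAverage_eq, setAverage_eq, integral_sub h1 h2, smul_sub]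

theorem HasTrace.congr_ae {ρ : ℝ} (hρ : 0 < ρ) (hA : MeasurableSet A) (h : HasTrace A w x a)
    (hw : ∀ᵐ y, y ∈ A → y ∈ Metric.ball x ρ → w y = w' y) : HasTrace A w' x a := by
  have key : ∀ r ≤ ρ, w =ᵐ[volume.restrict (Metric.ball x r ∩ A)] w' := fun r hr => by
    refine (ae_restrict_iff' (Metric.isOpen_ball.measurableSet.inter hA)).2 ?_
    filter_upwards [hw] with y hy hyr using hy hyr.2 (Metric.ball_subset_ball hr hyr.1)
  have hev : ∀ᶠ r in 𝓝[>] (0 : ℝ), r ≤ ρ :=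
    mem_of_superset (Ioc_mem_nhdsGT hρ) fun r hr => hr.2
  refine ⟨by filter_upwards [h.1, hev] with r h1 h2 using h1.congr (key r h2), h.2.congr' ?_⟩
  filter_upwards [hev] with r hr
  rw [setAverage_eq, setAverage_eq, integral_congr_ae (key r hr)]

theorem HasTrace.congr_set {ρ : ℝ} (hρ : 0 < ρ) (h : HasTrace A w x a)
    (hA : ∀ r ≤ ρ, (Metric.ball x r ∩ A : Set (E d)) =ᵐ[volume] (Metric.ball x r ∩ A' : Set (E d))) :
    HasTrace A' w x a := by
  have hev : ∀ᶠ r in 𝓝[>] (0 : ℝ), r ≤ ρ :=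
    mem_of_superset (Ioc_mem_nhdsGT hρ) fun r hr => hr.2
  refine ⟨by filter_upwards [h.1, hev] with r h1 h2 using h1.congr_set_ae (hA r h2).symm,
    h.2.congr' ?_⟩
  filter_upwards [hev] with r hr
  rw [setAverage_congr (hA r hr)]

/-- The two sides of a hyperplane, numbered as the parts of a domain with exterior normal `ν`. -/
def side (ν : E d) (c : ℝ) (i : Fin 2) : Set (E d) := ![above ν c, {z | inner ℝ ν z < c}] i

theorem isOpen_side (ν : E d) (c : ℝ) (i : Fin 2) : IsOpen (side ν c i) := by
  fin_cases i
  · exact isOpen_above ν c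
  · exact isOpen_lt (by fun_prop) continuous_const

theorem volume_ball_inter_side_pos {ν : E d} {c r : ℝ} (hν : ‖ν‖ = 1) (hx : x ∈ hyper ν c)
    (hr : 0 < r) (i : Fin 2) : 0 < volume (Metric.ball x r ∩ side ν c i) := by
  have hx' : inner ℝ ν x = c := hx
  refine (Metric.isOpen_ball.inter (isOpen_side ν c i)).measure_pos _ ?_
  fin_cases i
  · refine ⟨x + (r / 2) • ν, ?_, ?_⟩
    · rw [mem_ball_iff_norm, add_sub_cancel_left, norm_smul, hν, Real.norm_eq_abs,
        abs_of_pos (by linarith)]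
      linarith
    · change c < inner ℝ ν (x + (r / 2) • ν)
      rw [inner_add_right, inner_smul_right, real_inner_self_eq_norm_sq, hν, hx']
      linarith
  · refine ⟨x - (r / 2) • ν, ?_, ?_⟩
    · rw [mem_ball_iff_norm, sub_sub_cancel_left, norm_neg, norm_smul, hν, Real.norm_eq_abs,
        abs_of_pos (by linarith)]
      linarith
    · change inner ℝ ν (x - (r / 2) • ν) < c
      rw [inner_sub_right, inner_smul_right, real_inner_self_eq_norm_sq, hν, hx']
      linarith

theorem hasTrace_side_of_continuous {ν : E d} {c : ℝ} (hν : ‖ν‖ = 1) (hx : x ∈ hyper ν c)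
    (i : Fin 2) {P : E d → ℝ} (hP : Continuous P) : HasTrace (side ν c i) P x (P x) := by
  have hint : ∀ r, IntegrableOn P (Metric.ball x r ∩ side ν c i) := fun r =>
    (hP.continuousOn.integrableOn_compact (isCompact_closedBall x r)).mono_set
      (inter_subset_left.trans Metric.ball_subset_closedBall)
  refine ⟨Eventually.of_forall hint, Metric.tendsto_nhds.2 fun ε hε => ?_⟩
  obtain ⟨δ, hδ, hball⟩ := Metric.continuousAt_iff.1 hP.continuousAt (ε / 2) (half_pos hε)
  filter_upwards [Ioc_mem_nhdsGT hδ] with r hr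
  have hmem := (convex_closedBall (P x) (ε / 2)).set_average_mem (μ := volume) (f := P)
    (t := Metric.ball x r ∩ side ν c i)
    Metric.isClosed_closedBall (volume_ball_inter_side_pos hν hx hr.1 i).ne'
    ((measure_mono inter_subset_left).trans_lt measure_ball_lt_top).ne ?_ (hint r)
  · exact (Metric.mem_closedBall.1 hmem).trans_lt (half_lt_self hε)
  · refine (ae_restrict_iff' (Metric.isOpen_ball.measurableSet.inter
      (isOpen_side ν c i).measurableSet)).2 (ae_of_all _ fun y hy => ?_)
    exact (hball (lt_of_lt_of_le hy.1 hr.2)).le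

namespace CompositeMesh

variable {M : CompositeMesh d} {𝓗 : Finset (Set (E d))} {ν : E d} {c r : ℝ} {G : E d → ℝ}

theorem RegularAt.ball_inter_part (h : RegularAt M 𝓗 x ν c r) (i : Fin 2) {ρ : ℝ} (hρ : ρ ≤ r) :
    (Metric.ball x ρ ∩ M.part i : Set (E d)) =ᵐ[volume]
      (Metric.ball x ρ ∩ side ν c i : Set (E d)) := by
  filter_upwards [measure_eq_zero_iff_ae_notMem.1 (volume_hyper h.norm_eq c)] with z hz
  have hs := Metric.ball_subset_ball (x := x) hρ
  refine propext (and_congr_right fun hzb => ?_)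
  have hzb' := hs hzb
  have hzc : inner ℝ ν z ≠ c := hz
  fin_cases i
  · change (z ∈ M.Ω ∧ z ∉ M.pre 1) ↔ c < inner ℝ ν z
    refine ⟨fun hz1 => ?_, fun hz1 => ⟨h.ball_subset hzb',
      disjoint_left.1 h.above_disjoint ⟨hzb', hz1⟩⟩⟩
    exact (hzc.lt_or_gt).resolve_left fun hlt => hz1.2 (h.below_subset ⟨hzb', hlt⟩)
  · change z ∈ M.pre 1 ↔ inner ℝ ν z < c
    refine ⟨fun hz1 => ?_, fun hz1 => h.below_subset ⟨hzb', hz1⟩⟩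
    exact (hzc.lt_or_gt).resolve_right fun hgt => disjoint_left.1 h.above_disjoint ⟨hzb', hgt⟩ hz1

theorem RegularAt.hasTrace_part (h : RegularAt M 𝓗 x ν c r) {i : Fin 2}
    (hw : HasTrace (side ν c i) w x a) : HasTrace (M.part i) w x a :=
  hw.congr_set h.pos fun _ hρ => (h.ball_inter_part i hρ).symm

theorem RegularAt.exists_smooth (h : RegularAt M 𝓗 x ν c r) (hG : PiecewiseSmooth 𝓗 G)
    (i : Fin 2) : ∃ P, ContDiff ℝ ∞ P ∧ EqOn G P (Metric.ball x r ∩ side ν c i) := by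
  fin_cases i
  exacts [hG.exists_above h.ball_inter_skel, hG.exists_below h.ball_inter_skel]

theorem RegularAt.hasTrace_of_eqOn (h : RegularAt M 𝓗 x ν c r) {i : Fin 2} {P : E d → ℝ}
    (hP : Continuous P) (hGP : EqOn G P (Metric.ball x r ∩ side ν c i)) :
    HasTrace (M.part i) G x (P x) := by
  refine h.hasTrace_part ((hasTrace_side_of_continuous h.norm_eq h.mem i hP).congr_ae h.pos
    (isOpen_side ν c i).measurableSet (ae_of_all _ fun y hy hyb => (hGP ⟨hyb, hy⟩).symm))

theorem RegularAt.hasTrace (h : RegularAt M 𝓗 x ν c r) (hG : PiecewiseSmooth 𝓗 G) (i : Fin 2) :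
    HasTrace (M.part i) G x (trace (M.part i) G x) := by
  obtain ⟨P, hP, hGP⟩ := h.exists_smooth hG i
  have := h.hasTrace_of_eqOn hP.continuous hGP
  rwa [this.trace_eq]

theorem RegularAt.tendsto_side (h : RegularAt M 𝓗 x ν c r) (hG : PiecewiseSmooth 𝓗 G) (i : Fin 2) :
    Tendsto G (𝓝[side ν c i] x) (𝓝 (trace (M.part i) G x)) := by
  obtain ⟨P, hP, hGP⟩ := h.exists_smooth hG i
  rw [(h.hasTrace_of_eqOn hP.continuous hGP).trace_eq]
  exact tendsto_of_eqOn_ball h.pos hP.continuous hGP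

theorem neBot_side {ν : E d} {c : ℝ} (hν : ‖ν‖ = 1) (hx : x ∈ hyper ν c) (i : Fin 2) :
    (𝓝[side ν c i] x).NeBot := by
  refine mem_closure_iff_nhdsWithin_neBot.1 (Metric.mem_closure_iff.2 fun ε hε => ?_)
  obtain ⟨y, hy⟩ := nonempty_of_measure_ne_zero (volume_ball_inter_side_pos hν hx hε i).ne'
  exact ⟨y, hy.2, by rw [dist_comm]; exact hy.1⟩

/-- A trace is a limit of averages, so its measurability on Γ is not evident; away from the null set
of edges it is locally the restriction of one smooth branch. -/
theorem Adapted.continuousOn_trace (h𝓗 : M.Adapted 𝓗) (hG : PiecewiseSmooth 𝓗 G) (i : Fin 2) :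
    ContinuousOn (trace (M.part i) G) (M.Γ \ edges 𝓗) := fun x hx => by
  obtain ⟨ν, c, r, h⟩ := h𝓗.exists_regularAt hx.1 hx.2
  obtain ⟨P, hP, hGP⟩ := h.exists_smooth hG i
  refine (hP.continuous.continuousAt.continuousWithinAt (s := M.Γ \ edges 𝓗)).congr_of_eventuallyEq
    ?_ (h.hasTrace_of_eqOn hP.continuous hGP).trace_eq
  filter_upwards [self_mem_nhdsWithin, mem_nhdsWithin_of_mem_nhds (Metric.ball_mem_nhds x h.pos)]
    with y hy hyb
  have hy' := h.of_mem_ball (h.ball_inter_skel ⟨hyb, h𝓗.Γ_subset_skel hy.1⟩) hyb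
  refine (hy'.hasTrace_of_eqOn hP.continuous (hGP.mono (inter_subset_inter_left _ ?_))).trace_eq
  exact Metric.ball_subset_ball' (by linarith)

theorem Adapted.continuousOn_n (h𝓗 : M.Adapted 𝓗) : ContinuousOn M.n (M.Γ \ edges 𝓗) :=
  fun x hx => by
  obtain ⟨ν, c, r, h⟩ := h𝓗.exists_regularAt hx.1 hx.2
  refine (continuousWithinAt_const (b := ν)).congr_of_eventuallyEq ?_ h.n_eq
  filter_upwards [self_mem_nhdsWithin, mem_nhdsWithin_of_mem_nhds (Metric.ball_mem_nhds x h.pos)]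
    with y hy hyb
  exact (h.of_mem_ball (h.ball_inter_skel ⟨hyb, h𝓗.Γ_subset_skel hy.1⟩) hyb).n_eq

theorem Adapted.ae_surf (h𝓗 : M.Adapted 𝓗) : ∀ᵐ x ∂M.surf, x ∈ M.Γ ∧ x ∉ edges 𝓗 :=
  (ae_restrict_mem M.measurableSet_Γ).and (ae_restrict_of_ae
    (measure_eq_zero_iff_ae_notMem.1 h𝓗.1.area_edges))

theorem Adapted.ae_regularAt (h𝓗 : M.Adapted 𝓗) :
    ∀ᵐ x ∂M.surf, ∃ ν c r, RegularAt M 𝓗 x ν c r := by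
  filter_upwards [h𝓗.ae_surf] with x hx using h𝓗.exists_regularAt hx.1 hx.2

theorem Adapted.aestronglyMeasurable_surf {F : Type*} [TopologicalSpace F]
    [TopologicalSpace.PseudoMetrizableSpace F] [SecondCountableTopology F]
    (h𝓗 : M.Adapted 𝓗) {g : E d → F}
    (hg : ContinuousOn g (M.Γ \ edges 𝓗)) : AEStronglyMeasurable g M.surf := by
  borelize F
  have hm : MeasurableSet (M.Γ \ edges 𝓗) :=
    M.measurableSet_Γ.diff h𝓗.1.isClosed_edges.measurableSet
  have h1 : AEStronglyMeasurable g ((area d).restrict (M.Γ \ edges 𝓗)) :=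
    hg.aestronglyMeasurable hm
  have h2 : (area d).restrict (M.Γ \ edges 𝓗) = M.surf :=
    Measure.restrict_congr_set (sdiff_null_ae_eq_self h𝓗.1.area_edges)
  rwa [h2] at h1

theorem Adapted.memLp_trace (h𝓗 : M.Adapted 𝓗) (hG : PiecewiseSmooth 𝓗 G) (i : Fin 2) :
    MemLp (trace (M.part i) G) ⊤ M.surf := by
  obtain ⟨R, hR⟩ := M.isBounded_Ω.exists_norm_le
  obtain ⟨B, hB0, hB⟩ := hG.exists_bound h𝓗.1 R
  refine memLp_top_of_bound (h𝓗.aestronglyMeasurable_surf (h𝓗.continuousOn_trace hG i)) B ?_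
  filter_upwards [h𝓗.ae_regularAt] with x ⟨ν, c, r, h⟩
  have := neBot_side h.norm_eq h.mem i
  refine le_of_tendsto (h.tendsto_side hG i).norm ?_
  filter_upwards [ball_mem_nhdsWithin (s := side ν c i) h.pos] with y hy
  refine hB y (fun hys => ?_) (hR y (h.ball_subset hy.1))
  have h1 : inner ℝ ν y = c := h.ball_inter_skel ⟨hy.1, hys⟩
  have h2 := hy.2
  fin_cases i
  · exact (ne_of_gt h2 : inner ℝ ν y ≠ c) h1
  · exact (ne_of_lt h2 : inner ℝ ν y ≠ c) h1

theorem Adapted.memLp_n (h𝓗 : M.Adapted 𝓗) (j : Fin d) : MemLp (fun x => M.n x j) ⊤ M.surf := by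
  refine memLp_top_of_bound (h𝓗.aestronglyMeasurable_surf ?_) 1 ?_
  · exact (EuclideanSpace.proj j : E d →L[ℝ] ℝ).continuous.comp_continuousOn h𝓗.continuousOn_n
  · filter_upwards [h𝓗.ae_regularAt] with x ⟨ν, c, r, h⟩
    rw [h.n_eq, ← h.norm_eq]
    exact PiLp.norm_apply_le ν j

theorem area_hyper_inter_closedBall_lt_top {ν : E d} {c : ℝ} (hν : ‖ν‖ = 1) (R : ℝ) :
    area d (hyper ν c ∩ Metric.closedBall 0 R) < ⊤ := by
  rw [inter_comm, ← Measure.restrict_apply Metric.isClosed_closedBall.measurableSet,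
    area_restrict_hyper hν, (measurableEmbedding_par_zero hν).map_apply]
  refine (measure_mono (t := Metric.closedBall 0 R) fun y hy => ?_).trans_lt
    (isCompact_closedBall _ _).measure_lt_top
  simp only [mem_preimage, mem_closedBall_zero_iff] at hy ⊢
  exact (norm_coe_le_norm_par hν c y 0).trans hy

theorem Adapted.isFiniteMeasure_surf (h𝓗 : M.Adapted 𝓗) : IsFiniteMeasure M.surf := by
  refine ⟨?_⟩
  change (area d).restrict M.Γ univ < ⊤
  rw [Measure.restrict_apply_univ]
  obtain ⟨R, hR⟩ := M.isBounded_Ω.exists_norm_le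
  have hs : M.Γ ⊆ ⋃ H ∈ 𝓗, H ∩ Metric.closedBall 0 R := fun x hx => by
    obtain ⟨H, hH, hxH⟩ := mem_skel.1 (h𝓗.Γ_subset_skel hx)
    exact mem_iUnion₂.2 ⟨H, hH, hxH, by simpa using hR x (M.Γ_subset_Ω hx)⟩
  refine (measure_mono hs).trans_lt ((measure_biUnion_lt_top 𝓗.finite_toSet) fun H hH => ?_)
  obtain ⟨ν, c, hν, rfl⟩ := h𝓗.1 H hH
  exact area_hyper_inter_closedBall_lt_top hν R

end CompositeMesh

end Traces

/-! ### Traces of local Sobolev functions on Γ. -/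

section SobolevTraces

variable {d : ℕ} {𝓗 : Finset (Set (E d))}

theorem eq_or_neg_of_hyper_eq {ν ν' : E d} {c c' : ℝ} (hν : ‖ν‖ = 1) (hν' : ‖ν'‖ = 1)
    (h : hyper ν c = hyper ν' c') : (ν' = ν ∧ c' = c) ∨ (ν' = -ν ∧ c' = -c) := by
  have hx : c • ν ∈ hyper ν c := by
    simp [hyper, inner_smul_right, hν]
  have hpar : ν' ∈ Submodule.span ℝ {ν} := by
    rw [← Submodule.orthogonal_orthogonal (Submodule.span ℝ {ν})]
    intro w hw
    have hw' : inner ℝ ν w = 0 := Submodule.mem_orthogonal_singleton_iff_inner_right.1 hw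
    have h1 : c • ν + w ∈ hyper ν' c' := h ▸ (by
      rw [hyper, mem_ofPred_eq, inner_add_right, hw', add_zero]; exact hx)
    have h2 : inner ℝ ν' (c • ν) = c' := (h ▸ hx : c • ν ∈ hyper ν' c')
    rw [hyper, mem_ofPred_eq, inner_add_right, h2, add_eq_left] at h1
    rw [real_inner_comm]; exact h1
  obtain ⟨a, rfl⟩ := Submodule.mem_span_singleton.1 hpar
  have h2 : inner ℝ (a • ν) (c • ν) = c' := (h ▸ hx : c • ν ∈ hyper (a • ν) c')
  rw [inner_smul_left, inner_smul_right, real_inner_self_eq_norm_sq, hν] at h2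
  rw [norm_smul, hν, mul_one, Real.norm_eq_abs] at hν'
  rcases eq_or_eq_neg_of_abs_eq hν' with rfl | rfl
  · left; simpa using h2.symm
  · right; simpa using h2.symm

theorem RapidApprox.ae_hasTrace_side {F : E d → ℝ} {Fn : ℕ → E d → ℝ} (h : RapidApprox F Fn)
    (hF : LocallyIntegrable F) {ν : E d} {c : ℝ} (hν : ‖ν‖ = 1) :
    ∀ᵐ x ∂(area d).restrict (hyper ν c), ∀ i, HasTrace (side ν c i) F x (preciseLim Fn x) := by
  filter_upwards [h.ae_average_above hF hν, h.ae_average_below hF hν] with x h0 h1 i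
  refine ⟨Eventually.of_forall fun r => (hF.integrableOn_isCompact
    (isCompact_closedBall x r)).mono_set (inter_subset_left.trans Metric.ball_subset_closedBall), ?_⟩
  fin_cases i
  exacts [h0, h1]

theorem lintegral_biUnion_finset_le {α : Type*} [MeasurableSpace α] {μ : Measure α}
    (f : α → ENNReal) (T : Finset (Set α)) :
    ∫⁻ x in ⋃ H ∈ T, H, f x ∂μ ≤ ∑ H ∈ T, ∫⁻ x in H, f x ∂μ := by
  classical
  induction T using Finset.induction_on with
  | empty => simp
  | insert a T ha ih =>
    rw [Finset.set_biUnion_insert, Finset.sum_insert ha]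
    exact (lintegral_union_le _ _ _).trans (by gcongr)

namespace CompositeMesh

variable {M : CompositeMesh d}

theorem Adapted.ae_surf_of_ae_hyper (h𝓗 : M.Adapted 𝓗) {p : E d → Prop}
    (h : ∀ ν c, ‖ν‖ = 1 → hyper ν c ∈ 𝓗 → ∀ᵐ x ∂(area d).restrict (hyper ν c), p x) :
    ∀ᵐ x ∂M.surf, p x := by
  have h1 : ∀ᵐ x ∂(area d).restrict (⋃ H ∈ 𝓗, H), p x := by
    refine (ae_restrict_biUnion_finset_iff (fun H : Set (E d) => H) 𝓗 p).2 fun H hH => ?_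
    obtain ⟨ν, c, hν, rfl⟩ := h𝓗.1 H hH
    exact h ν c hν hH
  exact ae_restrict_of_ae_restrict_of_subset h𝓗.Γ_subset_skel h1

/-- Each hyperplane is represented by two pairs (ν, c), and a point off the edges lies on only one
hyperplane; treating both signs gives a single null set for all representations. The condition F = σ
near x serves for F = θσ with a cut-off θ. -/
theorem Adapted.ae_hasTrace_of_rapidApprox (h𝓗 : M.Adapted 𝓗) {F σ : E d → ℝ} {Fn : ℕ → E d → ℝ}
    (h : RapidApprox F Fn) (hF : LocallyIntegrable F) :
    ∀ᵐ x ∂M.surf, F =ᶠ[𝓝 x] σ → ∀ i, HasTrace (M.part i) σ x (preciseLim Fn x) := by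
  have h1 : ∀ᵐ x ∂M.surf, ∀ ν c, ‖ν‖ = 1 → hyper ν c ∈ 𝓗 → x ∈ hyper ν c → x ∉ edges 𝓗 →
      ∀ i, HasTrace (side ν c i) F x (preciseLim Fn x) := by
    refine h𝓗.ae_surf_of_ae_hyper fun ν c hν hH => ?_
    have h2 := h.ae_hasTrace_side hF (ν := -ν) (c := -c) (by rwa [norm_neg])
    rw [hyper_neg] at h2
    filter_upwards [h.ae_hasTrace_side hF (c := c) hν, h2,
      ae_restrict_mem (isClosed_hyper ν c).measurableSet] with x hx1 hx2 hxH ν' c' hν' hH' hx' hxe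
    have he : hyper ν c = hyper ν' c' := by
      by_contra hne
      exact hxe (mem_edges.2 ⟨_, hH, _, hH', hne, hxH, hx'⟩)
    rcases eq_or_neg_of_hyper_eq hν hν' he with ⟨rfl, rfl⟩ | ⟨rfl, rfl⟩
    exacts [hx1, hx2]
  filter_upwards [h1, h𝓗.ae_surf] with x hx hxΓ hFσ i
  obtain ⟨ν, c, r, hr⟩ := h𝓗.exists_regularAt hxΓ.1 hxΓ.2
  obtain ⟨ρ, hρ, hball⟩ := Metric.eventually_nhds_iff_ball.1 hFσ
  exact hr.hasTrace_part ((hx ν c hr.norm_eq hr.hyper_mem hr.mem hxΓ.2 i).congr_ae hρ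
    (isOpen_side ν c i).measurableSet (ae_of_all _ fun y _ hy => hball y hy))

/-- A local Sobolev function has equal traces from both sides almost everywhere on `Γ`. -/
theorem Adapted.ae_exists_hasTrace (h𝓗 : M.Adapted 𝓗) {σ : E d → ℝ} {τ : Fin d → E d → ℝ}
    (hσ : LocL2 M.Ω σ) (hτ : ∀ j, LocL2 M.Ω (τ j)) (hd : ∀ j, IsWeakDeriv M.Ω j σ (τ j)) :
    ∀ᵐ x ∂M.surf, ∃ a, ∀ i, HasTrace (M.part i) σ x a := by
  obtain ⟨K, hK, hKΩ, hKL⟩ := exists_open_cover_compact M.isOpen_Ω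
  -- Near K n the function agrees with its cut-off product, which has a rapid approximation;
  -- countably many such sets exhaust Ω.
  have key : ∀ n, ∀ᵐ x ∂M.surf, x ∈ K n → ∃ a, ∀ i, HasTrace (M.part i) σ x a := by
    intro n
    obtain ⟨θ, hθ, hθ1, -⟩ := exists_isTestFunction_eq_one (hK n) M.isOpen_Ω (hKΩ n)
    have hF := hσ.memLp_mul hθ
    obtain ⟨Fn, hFn, -, -⟩ := exists_rapidApprox hF hθ.2.1.mul_right
      (fun j => ((hτ j).memLp_mul hθ).add (hσ.memLp_mul (hθ.partialDeriv j)))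
      (fun j => (hd j).test_mul M.isOpen_Ω hθ)
    filter_upwards [h𝓗.ae_hasTrace_of_rapidApprox (σ := σ) hFn hF.locallyIntegrable_two]
      with x hx hxK
    refine ⟨_, hx ?_⟩
    filter_upwards [eventually_nhdsSet_iff_forall.1 hθ1 x hxK] with y hy
    rw [hy, one_mul]
  filter_upwards [ae_all_iff.2 key, h𝓗.ae_surf] with x hx hxΓ
  obtain ⟨n, hn⟩ := hKL {x} isCompact_singleton (singleton_subset_iff.2 (M.Γ_subset_Ω hxΓ.1))
  exact hx n (hn rfl)

/-- Distinct hyperplanes meet only in the edges, which have zero area, so nothing is counted twice.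
-/
theorem Adapted.sum_integral_hyper (h𝓗 : M.Adapted 𝓗) {f : E d → ℝ} (hf : Integrable f M.surf) :
    ∑ H ∈ 𝓗, ∫ x in H, M.Γ.indicator f x ∂(area d) = ∫ x, f x ∂M.surf := by
  have hfi : Integrable (M.Γ.indicator f) (area d) :=
    (integrable_indicator_iff M.measurableSet_Γ).2 hf
  have h1 : ∀ H : Set (E d), ∫ x in H, M.Γ.indicator f x ∂(area d)
      = ∫ x in H \ edges 𝓗, M.Γ.indicator f x ∂(area d) := fun H =>
    (setIntegral_congr_set (sdiff_null_ae_eq_self h𝓗.1.area_edges)).symm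
  rw [Finset.sum_congr rfl fun H _ => h1 H, ← integral_biUnion_finset]
  · have h2 : (⋃ H ∈ 𝓗, H \ edges 𝓗) = skel 𝓗 \ edges 𝓗 := by
      simp only [skel, iUnion_sdiff]
    rw [h2, setIntegral_congr_set (sdiff_null_ae_eq_self h𝓗.1.area_edges),
      setIntegral_indicator M.measurableSet_Γ, inter_eq_right.2 h𝓗.Γ_subset_skel]
    rfl
  · exact fun H hH => (h𝓗.1.isClosed hH).measurableSet.diff h𝓗.1.isClosed_edges.measurableSet
  · intro H hH H' hH' hne
    exact disjoint_left.2 fun x hx hx' => hx.2 (mem_edges.2 ⟨H, hH, H', hH', hne, hx.1, hx'.1⟩)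
  · exact fun H _ => hfi.integrableOn

theorem Adapted.tendsto_lintegral_surf (h𝓗 : M.Adapted 𝓗) {F : E d → ℝ} {Fn : ℕ → E d → ℝ}
    (h : RapidApprox F Fn) :
    Tendsto (fun n => ∫⁻ x, edist (Fn n x) (preciseLim Fn x) ∂M.surf) atTop (𝓝 0) := by
  have h1 : Tendsto (fun n => ∑ H ∈ 𝓗, ∫⁻ x in H, edist (Fn n x) (preciseLim Fn x) ∂(area d)) atTop
      (𝓝 (∑ H ∈ 𝓗, 0)) := tendsto_finsetSum _ fun H hH => by
    obtain ⟨ν, c, hν, rfl⟩ := h𝓗.1 H hH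
    exact h.tendsto_lintegral_edist hν
  rw [Finset.sum_const_zero] at h1
  refine tendsto_of_tendsto_of_tendsto_of_le_of_le tendsto_const_nhds h1 (fun _ => bot_le)
    fun n => ?_
  exact (lintegral_mono' (Measure.restrict_mono h𝓗.Γ_subset_skel le_rfl) le_rfl).trans
    (lintegral_biUnion_finset_le _ _)

/-- A bounded weight against L¹ convergence. Integrability of the limit comes from one approximant
at finite L¹ distance. -/
theorem Adapted.tendsto_integral_surf (h𝓗 : M.Adapted 𝓗) {F g : E d → ℝ} {Fn : ℕ → E d → ℝ}
    (h : RapidApprox F Fn) (hg : MemLp g ⊤ M.surf) :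
    (∀ n, Integrable (fun x => g x * Fn n x) M.surf) ∧
    Integrable (fun x => g x * preciseLim Fn x) M.surf ∧
    Tendsto (fun n => ∫ x, g x * Fn n x ∂M.surf) atTop
      (𝓝 (∫ x, g x * preciseLim Fn x ∂M.surf)) := by
  have := h𝓗.isFiniteMeasure_surf
  have hFi : ∀ n, Integrable (Fn n) M.surf := fun n =>
    memLp_one_iff_integrable.1 ((h.test n).memLp 1 M.surf)
  have hae : ∀ᵐ x ∂M.surf, Tendsto (fun n => Fn n x) atTop (𝓝 (preciseLim Fn x)) :=
    h𝓗.ae_surf_of_ae_hyper fun ν c hν _ => h.ae_hyper_tendsto hν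
  have hL := h𝓗.tendsto_lintegral_surf h
  have hm : AEStronglyMeasurable (preciseLim Fn) M.surf :=
    aestronglyMeasurable_of_tendsto_ae _ (fun n => (hFi n).1) hae
  have hPi : Integrable (preciseLim Fn) M.surf := by
    obtain ⟨n, hn⟩ := (hL.eventually_lt_const zero_lt_one).exists
    have h1 : Integrable (fun x => Fn n x - preciseLim Fn x) M.surf := by
      refine ⟨(hFi n).1.sub hm, ?_⟩
      rw [hasFiniteIntegral_iff_enorm]
      simpa only [edist_eq_enorm_sub] using hn.trans ENNReal.one_lt_top
    exact ((hFi n).sub h1).congr (ae_of_all _ fun x => by simp)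
  have hmul : ∀ f, Integrable f M.surf → Integrable (fun x => g x * f x) M.surf := fun f hf =>
    hf.essSup_smul hg.1 hg.2.ne
  refine ⟨fun n => hmul _ (hFi n), hmul _ hPi, ?_⟩
  refine tendsto_integral_of_L1 _ (hmul _ hPi).1 (Eventually.of_forall fun n => hmul _ (hFi n)) ?_
  have hb : ∀ᵐ x ∂M.surf, ‖g x‖ₑ ≤ eLpNorm g ⊤ M.surf := by
    rw [eLpNorm_exponent_top]; exact ae_le_eLpNormEssSup
  have h0 := ENNReal.Tendsto.const_mul (a := eLpNorm g ⊤ M.surf) hL (Or.inr hg.2.ne)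
  rw [mul_zero] at h0
  refine tendsto_of_tendsto_of_tendsto_of_le_of_le tendsto_const_nhds h0 (fun _ => bot_le)
    fun n => ?_
  rw [← lintegral_const_mul' _ _ hg.2.ne]
  refine lintegral_mono_ae ?_
  filter_upwards [hb] with x hx
  rw [← mul_sub, enorm_mul, edist_eq_enorm_sub]
  gcongr

end CompositeMesh

end SobolevTraces

/-! ### Green's formula for compactly supported piecewise smooth functions. -/

section Green

variable {d : ℕ} {𝓗 : Finset (Set (E d))}

theorem PiecewiseSmooth.memLp {G : E d → ℝ} (h𝓗 : IsArrangement 𝓗) (hG : PiecewiseSmooth 𝓗 G)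
    (hc : HasCompactSupport G) (q : ENNReal) : MemLp G q := by
  obtain ⟨R, hR⟩ := hc.isCompact.isBounded.exists_norm_le
  obtain ⟨B, hB0, hB⟩ := hG.exists_bound h𝓗 R
  refine (memLp_indicator_const q (Metric.isClosed_closedBall (x := (0 : E d)) (ε := R)).measurableSet
    B (Or.inr (isCompact_closedBall _ _).measure_lt_top.ne)).mono (hG.aestronglyMeasurable h𝓗) ?_
  filter_upwards [measure_eq_zero_iff_ae_notMem.1 h𝓗.volume_skel] with x hx
  by_cases hxR : x ∈ Metric.closedBall (0 : E d) R
  · rw [indicator_of_mem hxR, Real.norm_eq_abs, Real.norm_eq_abs, abs_of_nonneg hB0]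
    exact hB x hx (by simpa using hxR)
  · have h0 : G x = 0 := image_eq_zero_of_notMem_tsupport fun h => hxR (by simpa using hR x h)
    rw [h0, norm_zero]
    exact norm_nonneg _

/-- Green's formula on a composite mesh: a piecewise smooth function with compact support in `Ω`
whose jumps lie on `Γ` against a local Sobolev function. -/
theorem CompositeMesh.Adapted.integral_green {M : CompositeMesh d} (h𝓗 : M.Adapted 𝓗)
    {σ : E d → ℝ} {τ : Fin d → E d → ℝ} (hσ : LocL2 M.Ω σ) (hτ : ∀ j, LocL2 M.Ω (τ j))
    (hd : ∀ j, IsWeakDeriv M.Ω j σ (τ j)) {G g : E d → ℝ} (hG : PiecewiseSmooth 𝓗 G)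
    (hGc : HasCompactSupport G) (hGΩ : tsupport G ⊆ M.Ω) (hg : MemLp g ⊤ M.surf) (j : Fin d)
    (hJ : ∀ ν c, ‖ν‖ = 1 → hyper ν c ∈ 𝓗 → ∀ y ∈ hyper ν c, y ∉ edges 𝓗 → ∀ a b,
      Tendsto G (𝓝[{x | inner ℝ ν x < c}] y) (𝓝 a) → Tendsto G (𝓝[above ν c] y) (𝓝 b) →
        M.Γ.indicator g y = (a - b) * ν j) :
    Integrable (fun x => g x * trace (M.part 0) σ x) M.surf ∧
      (∫ x, G x * τ j x) + (∫ x, partialDeriv j G x * σ x)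
        = ∫ x, g x * trace (M.part 0) σ x ∂M.surf := by
  obtain ⟨θ, hθ, hθ1, -⟩ := exists_isTestFunction_eq_one hGc.isCompact M.isOpen_Ω hGΩ
  have hF := hσ.memLp_mul hθ
  have hF' : ∀ j, MemLp (fun x => θ x * τ j x + partialDeriv j θ x * σ x) 2 := fun j =>
    ((hτ j).memLp_mul hθ).add (hσ.memLp_mul (hθ.partialDeriv j))
  obtain ⟨Fn, hFn, hL, hL'⟩ := exists_rapidApprox hF hθ.2.1.mul_right hF'
    (fun j => (hd j).test_mul M.isOpen_Ω hθ)
  have hGL := hG.memLp h𝓗.1 hGc 2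
  have hDc : HasCompactSupport (partialDeriv j G) :=
    hGc.isCompact.of_isClosed_subset (isClosed_tsupport _) (tsupport_partialDeriv_subset j G)
  have hDL := (hG.partialDeriv j).memLp h𝓗.1 hDc 2
  -- The approximants of θσ are test functions and serve as φ in the Gauss–Green formula. Both
  -- volume terms then converge by L² pairing and the surface term by L¹ convergence on Γ.
  have hgg : ∀ n, (∫ x, G x * partialDeriv j (Fn n) x) + (∫ x, partialDeriv j G x * Fn n x)
      = ∫ x, g x * Fn n x ∂M.surf := by
    intro n
    rw [← h𝓗.sum_integral_hyper ((h𝓗.tendsto_integral_surf hFn hg).1 n)]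
    refine integral_gaussGreen h𝓗.1 hG (hFn.test n) j fun ν c hν hH y hy hye a b ha hb => ?_
    rw [← hJ ν c hν hH y hy hye a b ha hb]
    by_cases hyΓ : y ∈ M.Γ <;> simp [hyΓ]
  have e1 : ∀ x, partialDeriv j G x * (θ x * σ x) = partialDeriv j G x * σ x := fun x => by
    by_cases hx : x ∈ tsupport G
    · rw [(eventually_nhdsSet_iff_forall.1 hθ1 x hx).self_of_nhds, one_mul]
    · rw [image_eq_zero_of_notMem_tsupport fun h => hx (tsupport_partialDeriv_subset j G h),
        zero_mul, zero_mul]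
  have e2 : ∀ x, G x * (θ x * τ j x + partialDeriv j θ x * σ x) = G x * τ j x := fun x => by
    by_cases hx : x ∈ tsupport G
    · have h1 := eventually_nhdsSet_iff_forall.1 hθ1 x hx
      have h2 : θ =ᶠ[𝓝 x] fun _ => 1 := h1
      rw [h1.self_of_nhds, partialDeriv, h2.fderiv_eq]
      simp
    · rw [image_eq_zero_of_notMem_tsupport hx, zero_mul, zero_mul]
  have hl1 := tendsto_integral_mul_of_eLpNorm
    (fun n => ((hFn.test n).partialDeriv j).memLp 2 volume) (hF' j) hGL (hL' j)
  have hl2 := tendsto_integral_mul_of_eLpNorm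
    (fun n => (hFn.test n).memLp 2 volume) hF hDL hL
  simp only [mul_comm _ (G _), mul_comm _ (partialDeriv j G _), e1, e2] at hl1 hl2
  obtain ⟨-, hri, hr⟩ := h𝓗.tendsto_integral_surf hFn hg
  have := tendsto_nhds_unique (hl1.add hl2) (hr.congr fun n => (hgg n).symm)
  rw [this]
  suffices hae : (fun x => g x * preciseLim Fn x) =ᵐ[M.surf] fun x => g x * trace (M.part 0) σ x from
    ⟨hri.congr hae, integral_congr_ae hae⟩
  filter_upwards [h𝓗.ae_hasTrace_of_rapidApprox (σ := σ) hFn hF.locallyIntegrable_two,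
    h𝓗.ae_surf] with x hx hxΓ
  -- On the support of G the cut-off is locally 1, so the precise limit is the trace of σ. Elsewhere
  -- G vanishes near x, and the jump condition forces g x = 0.
  by_cases hxG : x ∈ tsupport G
  · have h1 : (fun x => θ x * σ x) =ᶠ[𝓝 x] σ := by
      filter_upwards [eventually_nhdsSet_iff_forall.1 hθ1 x hxG] with y hy
      rw [hy, one_mul]
    rw [(hx h1 0).trace_eq]
  · obtain ⟨ν, c, r, hr⟩ := h𝓗.exists_regularAt hxΓ.1 hxΓ.2
    have h0 : G =ᶠ[𝓝 x] fun _ => 0 := notMem_tsupport_iff_eventuallyEq.1 hxG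
    have ht : Tendsto G (𝓝 x) (𝓝 0) := tendsto_const_nhds.congr' h0.symm
    have := hJ ν c hr.norm_eq hr.hyper_mem x hr.mem hxΓ.2 0 0 (ht.mono_left nhdsWithin_le_nhds)
      (ht.mono_left nhdsWithin_le_nhds)
    rw [indicator_of_mem hxΓ.1, sub_zero, zero_mul] at this
    rw [this, zero_mul, zero_mul]

/-! ### Truncation -/

/-- A smooth truncation of the identity near the origin. -/
def trunc (ε s : ℝ) : ℝ := s * step (s / ε)

variable {ε s : ℝ}

theorem contDiff_trunc (ε : ℝ) : ContDiff ℝ ∞ (trunc ε) :=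
  contDiff_id.mul (contDiff_step.comp (contDiff_id.div_const ε))

theorem trunc_eq_zero (hε : 0 < ε) (hs : |s| ≤ ε) : trunc ε s = 0 := by
  rw [trunc, step_eq_zero, mul_zero]
  rwa [abs_div, abs_of_pos hε, div_le_one hε]

theorem abs_trunc_le : |trunc ε s| ≤ |s| := by
  have := step_mem_Icc (s / ε)
  rw [trunc, abs_mul, abs_of_nonneg this.1]
  exact mul_le_of_le_one_right (abs_nonneg _) this.2

theorem tendsto_div_atTop {s : ℝ} (hs : s ≠ 0) :
    ∀ᶠ ε in 𝓝[>] (0 : ℝ), 2 < |s / ε| := by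
  have h2 : Tendsto (fun δ : ℝ => 2 * δ) (𝓝[>] 0) (𝓝 0) := by
    have : Continuous fun δ : ℝ => 2 * δ := by fun_prop
    simpa using (this.tendsto 0).mono_left nhdsWithin_le_nhds
  filter_upwards [self_mem_nhdsWithin, h2.eventually_lt_const (abs_pos.2 hs)] with δ (hδ : 0 < δ) h
  rwa [abs_div, abs_of_pos hδ, lt_div_iff₀ hδ]

theorem tendsto_trunc (s : ℝ) : Tendsto (fun ε => trunc ε s) (𝓝[>] 0) (𝓝 s) := by
  rcases eq_or_ne s 0 with rfl | hs
  · simp [trunc]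
  · refine tendsto_const_nhds.congr' ?_
    filter_upwards [tendsto_div_atTop hs] with ε h
    rw [trunc, step_eq_one h.le, mul_one]

theorem deriv_trunc (ε s : ℝ) :
    deriv (trunc ε) s = step (s / ε) + (s / ε) * deriv step (s / ε) := by
  have h1 : HasDerivAt (fun s => step (s / ε)) (deriv step (s / ε) * (1 / ε)) s :=
    HasDerivAt.comp (h₂ := step) s (hasDerivAt_step (s / ε)) ((hasDerivAt_id' s).div_const ε)
  have h2 : HasDerivAt (trunc ε) (1 * step (s / ε) + s * (deriv step (s / ε) * (1 / ε))) s :=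
    (hasDerivAt_id s).mul h1
  rw [h2.deriv]; ring

theorem tendsto_deriv_trunc (hs : s ≠ 0) :
    Tendsto (fun ε => deriv (trunc ε) s) (𝓝[>] 0) (𝓝 1) := by
  refine tendsto_const_nhds.congr' ?_
  filter_upwards [tendsto_div_atTop hs] with ε h
  rw [deriv_trunc, step_eq_one h.le, deriv_step_eq_zero h, mul_zero, add_zero]

/-- The bound is uniform in ε because |s/ε| ≤ 2 wherever the derivative of `step` at s/ε is nonzero.
It supplies the dominating function when the truncation is removed. -/
theorem exists_deriv_trunc_le : ∃ C, ∀ ε s, |deriv (trunc ε) s| ≤ C := by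
  obtain ⟨C, hC⟩ := continuous_deriv_step.bounded_above_of_compact_support
    (HasCompactSupport.intro (isCompact_closedBall 0 2) fun s hs =>
      deriv_step_eq_zero (by simpa using hs))
  have hC0 : 0 ≤ C := (norm_nonneg _).trans (hC 0)
  refine ⟨1 + 2 * C, fun ε s => ?_⟩
  rw [deriv_trunc]
  refine (abs_add_le _ _).trans (add_le_add ?_ ?_)
  · have := step_mem_Icc (s / ε)
    rw [abs_of_nonneg this.1]; exact this.2
  · rw [abs_mul]
    by_cases h : 2 < |s / ε|
    · rw [deriv_step_eq_zero h]; simp; positivity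
    · exact mul_le_mul (not_lt.1 h) (hC _) (abs_nonneg _) zero_le_two

theorem partialDeriv_trunc {G : E d → ℝ} {x : E d} (hG : DifferentiableAt ℝ G x) (ε : ℝ)
    (j : Fin d) :
    partialDeriv j (fun y => trunc ε (G y)) x = deriv (trunc ε) (G x) * partialDeriv j G x := by
  have h1 := ((contDiff_trunc ε).differentiable (by simp) (G x)).hasDerivAt.comp_hasFDerivAt x
    hG.hasFDerivAt
  rw [partialDeriv, show (fun y => trunc ε (G y)) = trunc ε ∘ G from rfl, h1.fderiv]
  rfl

/-- On each line parallel to the j-th axis these zeros are isolated, hence null; Fubini concludes.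
-/
theorem volume_zero_partialDeriv_ne_zero {P : E d → ℝ} (hP : ContDiff ℝ ∞ P) (j : Fin d) :
    volume {x | P x = 0 ∧ partialDeriv j P x ≠ 0} = 0 := by
  set ν : E d := EuclideanSpace.single j 1
  have hν : ‖ν‖ = 1 := by simp [ν]
  have hm : MeasurableSet {x | P x = 0 ∧ partialDeriv j P x ≠ 0} :=
    (isClosed_eq hP.continuous continuous_const).measurableSet.inter
      (isOpen_ne_fun (hP.partialDeriv j).continuous continuous_const).measurableSet
  rw [← (measurePreserving_par (c := 0) hν).measure_preimage hm.nullMeasurableSet,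
    Measure.measure_prod_null ((measurableEquiv_par hν).measurable hm)]
  refine ae_of_all _ fun y => ?_
  refine measure_null_of_locally_null _ fun t ht => ⟨{t}, ?_, by simp⟩
  have hd : HasDerivAt (fun s => P (par ν 0 y s)) (partialDeriv j P (par ν 0 y t)) t := by
    have h1 : HasDerivAt (fun s : ℝ => par ν 0 y s) ν t := by
      have := (((hasDerivAt_id t).const_add 0).smul_const ν).const_add (y : E d)
      simpa [par] using this
    exact (hP.differentiable_infty _).hasFDerivAt.comp_hasDerivAt t h1
  have hne := hd.eventually_ne (c := 0) ht.2
  rw [mem_nhdsWithin_iff_eventually]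
  rw [eventually_nhdsWithin_iff] at hne
  filter_upwards [hne] with s hs hst
  by_contra hst'
  exact hs hst' hst.1

/-- At 0 the derivative of `trunc ε` is 0 and does not tend to 1. On the zero set of G this is
harmless because the gradient vanishes there almost everywhere. -/
theorem PiecewiseSmooth.ae_partialDeriv_eq_zero {G : E d → ℝ} (h𝓗 : IsArrangement 𝓗)
    (hG : PiecewiseSmooth 𝓗 G) (j : Fin d) :
    ∀ᵐ x, G x = 0 → CutStokes.partialDeriv j G x = 0 := by
  obtain ⟨Ps, hPs, hA⟩ := hG
  have h1 : ∀ᵐ x, ∀ P ∈ Ps, P x = 0 → CutStokes.partialDeriv j P x = 0 := by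
    refine (ae_ball_iff Ps.countable_toSet).2 fun P hP => ?_
    have := measure_eq_zero_iff_ae_notMem.1 (volume_zero_partialDeriv_ne_zero (hPs P hP) j)
    filter_upwards [this] with x hx h0
    by_contra hn
    exact hx ⟨h0, hn⟩
  filter_upwards [h1, measure_eq_zero_iff_ae_notMem.1 h𝓗.volume_skel] with x hx hxs h0
  obtain ⟨A, hAo, hAc, hAd, hxA⟩ := h𝓗.exists_open_of_segment
    (isPreconnected_singleton (x := x)) (disjoint_singleton_left.2 hxs)
  obtain ⟨P, hP, hPA⟩ := hA A hAo hAc hAd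
  have he : G =ᶠ[𝓝 x] P := hPA.eventuallyEq_of_mem (hAo.mem_nhds (hxA rfl))
  rw [CutStokes.partialDeriv, he.fderiv_eq]
  exact hx P hP (by rw [← he.self_of_nhds, h0])

end Green

/-! ### Discrete functions -/

section Discrete

variable {d : ℕ} {𝓗 : Finset (Set (E d))} {G : E d → ℝ}

theorem contDiff_mvPolynomial_eval (P : MvPolynomial (Fin d) ℝ) :
    ContDiff ℝ ∞ fun x : E d => MvPolynomial.eval (fun i => x i) P := by
  induction P using MvPolynomial.induction_on with
  | C a => simpa using contDiff_const
  | add p q hp hq => simpa using hp.add hq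
  | mul_X p i hp =>
    simpa using hp.mul (EuclideanSpace.proj i : E d →L[ℝ] ℝ).contDiff

theorem IsPolyOn.exists_contDiff {K : Set (E d)} {k : ℕ} {w : E d → ℝ} (h : IsPolyOn K k w) :
    ∃ P, ContDiff ℝ ∞ P ∧ EqOn w P K := by
  obtain ⟨P, -, hP⟩ := h
  exact ⟨_, contDiff_mvPolynomial_eval P, hP⟩

theorem PiecewiseSmooth.memLp_restrict (h𝓗 : IsArrangement 𝓗) (hG : PiecewiseSmooth 𝓗 G)
    {A : Set (E d)} (hA : Bornology.IsBounded A) (q : ENNReal) :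
    MemLp G q (volume.restrict A) := by
  obtain ⟨R, hR⟩ := hA.subset_closedBall 0
  obtain ⟨B, hB0, hB⟩ := hG.exists_bound h𝓗 R
  have : IsFiniteMeasure (volume.restrict (Metric.closedBall (0 : E d) R)) :=
    ⟨by rw [Measure.restrict_apply_univ]; exact (isCompact_closedBall _ _).measure_lt_top⟩
  refine MemLp.mono_measure (Measure.restrict_mono hR le_rfl)
    (MemLp.of_bound (hG.aestronglyMeasurable h𝓗).restrict B ?_)
  filter_upwards [ae_restrict_mem Metric.isClosed_closedBall.measurableSet,
    ae_restrict_of_ae (measure_eq_zero_iff_ae_notMem.1 h𝓗.volume_skel)] with x hx hxs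
  exact hB x hxs (by simpa using hx)

theorem PiecewiseSmooth.locallyIntegrable (h𝓗 : IsArrangement 𝓗) (hG : PiecewiseSmooth 𝓗 G) :
    LocallyIntegrable G := fun x =>
  ⟨Metric.ball x 1, Metric.ball_mem_nhds x one_pos, memLp_one_iff_integrable.1
    (hG.memLp_restrict h𝓗 Metric.isBounded_ball 1)⟩

/-- Continuity on U makes all jumps in the Gauss–Green formula vanish, so the classical derivative
off the arrangement is the weak one. -/
theorem PiecewiseSmooth.isWeakDeriv (h𝓗 : IsArrangement 𝓗) (hG : PiecewiseSmooth 𝓗 G)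
    {U : Set (E d)} (hU : IsOpen U) (hc : ContinuousOn G U) (j : Fin d) :
    IsWeakDeriv U j G (CutStokes.partialDeriv j G) := by
  refine isWeakDeriv_iff.2 ⟨(hG.locallyIntegrable h𝓗).locallyIntegrableOn U,
    ((hG.partialDeriv j).locallyIntegrable h𝓗).locallyIntegrableOn U, fun φ hφ => ?_⟩
  have := integral_gaussGreen (J := fun _ => 0) h𝓗 hG (hφ.mono (subset_univ U)) j
    fun ν c hν hH y hy hye a b ha hb => by
      by_cases hyU : y ∈ U
      · have hcy := (hc.continuousAt (hU.mem_nhds hyU)).tendsto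
        have h0 := CompositeMesh.neBot_side hν hy 0
        have h1 := CompositeMesh.neBot_side hν hy 1
        have e1 : a = G y := tendsto_nhds_unique (l := 𝓝[side ν c 1] y) ha
          (hcy.mono_left nhdsWithin_le_nhds)
        have e2 : b = G y := tendsto_nhds_unique (l := 𝓝[side ν c 0] y) hb
          (hcy.mono_left nhdsWithin_le_nhds)
        rw [e1, e2, sub_self, zero_mul, zero_mul]
      · rw [hφ.eq_zero hyU, mul_zero]
  simp only [integral_zero, Finset.sum_const_zero] at this
  linarith

namespace CompositeMesh

variable {M : CompositeMesh d}

/-- A connected set off the arrangement lies in a single element or misses all of them; the branch 0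
accounts for the latter. Only values in the interiors of elements matter, so discontinuous pressures
are included. -/
theorem Adapted.piecewiseSmooth_indicator (h𝓗 : M.Adapted 𝓗) {i : Fin 2} {w : E d → ℝ}
    (hw : ∀ K ∈ M.mesh i, ∃ P, ContDiff ℝ ∞ P ∧ EqOn w P (interior K)) :
    PiecewiseSmooth 𝓗 ((M.Ωh i).indicator w) := by
  classical
  have : ∀ K, ∃ P, ContDiff ℝ ∞ P ∧ (K ∈ M.mesh i → EqOn w P (interior K)) := fun K => by
    by_cases hK : K ∈ M.mesh i
    · obtain ⟨P, h1, h2⟩ := hw K hK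
      exact ⟨P, h1, fun _ => h2⟩
    · exact ⟨0, contDiff_const, fun h => absurd h hK⟩
  choose P hP hPw using this
  refine ⟨insert 0 ((M.mesh i).image P), ?_, fun A hAo hAc hAd => ?_⟩
  · simp only [Finset.mem_insert, Finset.mem_image]
    rintro _ (rfl | ⟨K, -, rfl⟩)
    exacts [contDiff_const, hP K]
  · by_cases h : ∃ K ∈ M.subFinset i, A ⊆ K
    · obtain ⟨K, hK, hAK⟩ := h
      have hKm := (M.mem_subFinset.1 hK).1
      refine ⟨P K, Finset.mem_insert_of_mem (Finset.mem_image_of_mem _ hKm), fun x hx => ?_⟩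
      rw [indicator_of_mem (by rw [Ωh_eq]; exact mem_iUnion₂.2 ⟨K, hK, hAK hx⟩)]
      exact hPw K hKm (interior_maximal hAK hAo hx)
    · refine ⟨0, Finset.mem_insert_self _ _, fun x hx => indicator_of_notMem (fun hxΩ => ?_) _⟩
      rw [Ωh_eq] at hxΩ
      obtain ⟨K, hK, hxK⟩ := mem_iUnion₂.1 hxΩ
      rcases hAc.subset_or_disjoint_of_frontier
        (hAd.mono_right (h𝓗.2 i K (M.mem_subFinset.1 hK).1)) with h1 | h1
      · exact h ⟨K, hK, h1⟩
      · exact disjoint_left.1 h1 hx hxK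

theorem isBounded_Ωh (i : Fin 2) : Bornology.IsBounded (M.Ωh i) :=
  (M.isBounded_closure_pre i).subset (M.Ωh_subset_closure i)

variable {S : FESpaces M} {v : Fin 2 → E d → E d} {q : Fin 2 → E d → ℝ}

theorem Adapted.piecewiseSmooth_V (h𝓗 : M.Adapted 𝓗) (hv : v ∈ S.Vh) (i : Fin 2) (k : Fin d) :
    PiecewiseSmooth 𝓗 (fun x => v i x k) := by
  obtain ⟨w, hw, hvw⟩ := (hv i).1
  have : (fun x => v i x k) = (M.Ωh i).indicator (fun x => w x k) := by
    ext x
    rw [hvw]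
    by_cases hx : x ∈ M.Ωh i <;> simp [hx]
  rw [this]
  refine h𝓗.piecewiseSmooth_indicator fun K hK => ?_
  obtain ⟨P, hP, hPw⟩ := (S.poly_V i w hw K hK k).exists_contDiff
  exact ⟨P, hP, hPw.mono interior_subset⟩

theorem Adapted.piecewiseSmooth_Q (h𝓗 : M.Adapted 𝓗) (hq : q ∈ S.Qh) (i : Fin 2) :
    PiecewiseSmooth 𝓗 (q i) := by
  obtain ⟨w, hw, hqw⟩ := hq i
  rw [hqw]
  exact h𝓗.piecewiseSmooth_indicator fun K hK => (S.poly_Q i w hw K hK).exists_contDiff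

theorem continuousOn_V (hv : v ∈ S.Vh) (i : Fin 2) (k : Fin d) :
    ContinuousOn (fun x => v i x k) (M.Ωh i) := by
  obtain ⟨w, hw, hvw⟩ := (hv i).1
  have h1 := (S.continuousOn_V i w hw).mono (M.Ωh_subset_closure i)
  refine ((EuclideanSpace.proj k : E d →L[ℝ] ℝ).continuous.comp_continuousOn h1).congr fun x hx => ?_
  rw [hvw, indicator_of_mem hx]; rfl

theorem V_eq_zero (hv : v ∈ S.Vh) {i : Fin 2} {x : E d} (hx : x ∉ M.Ωh i) (k : Fin d) :
    v i x k = 0 := by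
  obtain ⟨w, hw, hvw⟩ := (hv i).1
  rw [hvw, indicator_of_notMem hx]; rfl

theorem Adapted.isWeakDeriv_V (h𝓗 : M.Adapted 𝓗) (hv : v ∈ S.Vh) (i : Fin 2) (k j : Fin d) :
    IsWeakDeriv (interior (M.Ωh i)) j (fun x => v i x k) (partialDeriv j fun x => v i x k) :=
  (h𝓗.piecewiseSmooth_V hv i k).isWeakDeriv h𝓗.1 isOpen_interior
    ((continuousOn_V hv i k).mono interior_subset) j

theorem Adapted.D_V_ae (h𝓗 : M.Adapted 𝓗) (hv : v ∈ S.Vh) (i : Fin 2) (k j : Fin d) :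
    ∀ᵐ x, x ∈ M.Ωh i → M.D i v k j x = partialDeriv j (fun x => v i x k) x := by
  filter_upwards [(h𝓗.isWeakDeriv_V hv i k j).weakDeriv_ae isOpen_interior, h𝓗.ae_mem_interior i]
    with x h1 h2 hx using h1 (h2 hx)

/-- Almost every point of `Ω_{h,i}` lies in the interior of exactly one mesh element. -/
theorem Adapted.ae_sum_indicator (h𝓗 : M.Adapted 𝓗) (i : Fin 2) :
    ∀ᵐ x, x ∈ M.Ωh i → ∃ K ∈ M.subFinset i, x ∈ interior K ∧
      ∀ g : Set (E d) → E d → ℝ, ∑ K ∈ M.mesh i, (interior K).indicator (g K) x = g K x := by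
  filter_upwards [h𝓗.ae_notMem_skel] with x hx hxΩ
  rw [Ωh_eq] at hxΩ
  obtain ⟨K, hK, hxK⟩ := mem_iUnion₂.1 hxΩ
  have hKm := (M.mem_subFinset.1 hK).1
  have hxi : x ∈ interior K := by
    by_contra hn
    exact hx (h𝓗.2 i K hKm ⟨subset_closure hxK, hn⟩)
  refine ⟨K, hK, hxi, fun g => ?_⟩
  rw [Finset.sum_eq_single_of_mem K hKm, indicator_of_mem hxi]
  intro L hL hLK
  exact indicator_of_notMem (fun hxL => disjoint_left.1 ((M.isMesh i).2.1 L hL K hKm hLK) hxL hxi) _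

theorem mesh_subset_Ωh {i : Fin 2} {K : Set (E d)} (hK : K ∈ M.subFinset i) : K ⊆ M.Ωh i := by
  rw [Ωh_eq]; exact subset_biUnion_of_mem (u := fun K => K) hK

theorem exists_contDiff_V (hv : v ∈ S.Vh) {i : Fin 2} (k : Fin d) {K : Set (E d)}
    (hK : K ∈ M.subFinset i) : ∃ P, ContDiff ℝ ∞ P ∧ EqOn (fun x => v i x k) P (interior K) := by
  obtain ⟨w, hw, hvw⟩ := (hv i).1
  obtain ⟨P, hP, hPw⟩ := (S.poly_V i w hw K (M.mem_subFinset.1 hK).1 k).exists_contDiff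
  refine ⟨P, hP, fun x hx => ?_⟩
  have h1 : v i x = w x := by rw [hvw, indicator_of_mem (M.mesh_subset_Ωh hK (interior_subset hx))]
  change v i x k = P x
  rw [h1]
  exact hPw (interior_subset hx)

theorem exists_contDiff_Q (hq : q ∈ S.Qh) {i : Fin 2} {K : Set (E d)}
    (hK : K ∈ M.subFinset i) : ∃ P, ContDiff ℝ ∞ P ∧ EqOn (q i) P (interior K) := by
  obtain ⟨w, hw, hqw⟩ := hq i
  obtain ⟨P, hP, hPw⟩ := (S.poly_Q i w hw K (M.mem_subFinset.1 hK).1).exists_contDiff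
  refine ⟨P, hP, fun x hx => ?_⟩
  rw [hqw, indicator_of_mem (M.mesh_subset_Ωh hK (interior_subset hx))]
  exact hPw hx

end CompositeMesh

theorem isWeakDeriv_of_eqOn {U : Set (E d)} (hU : IsOpen U) {P : E d → ℝ} (hP : ContDiff ℝ ∞ P)
    (h : EqOn G P U) (j : Fin d) : IsWeakDeriv U j G (partialDeriv j G) := by
  refine (isWeakDeriv_of_contDiff hP j).congr_ae hU (ae_of_all _ fun x hx => (h hx).symm)
    (ae_of_all _ fun x hx => ?_)
  rw [partialDeriv, partialDeriv, (h.eventuallyEq_of_mem (hU.mem_nhds hx)).fderiv_eq]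

theorem eqOn_partialDeriv {U : Set (E d)} (hU : IsOpen U) {P : E d → ℝ}
    (h : EqOn G P U) (j : Fin d) : EqOn (partialDeriv j G) (partialDeriv j P) U := fun x hx => by
  rw [partialDeriv, partialDeriv, (h.eventuallyEq_of_mem (hU.mem_nhds hx)).fderiv_eq]

/-- The inner chosen derivative may be any representative, but weak differentiation does not see
null sets. -/
theorem IsWeakDeriv.weakDeriv_weakDeriv_ae {U : Set (E d)} (hU : IsOpen U) {w b c : E d → ℝ}
    {j : Fin d} (h : IsWeakDeriv U j w b) (h' : IsWeakDeriv U j b c) :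
    ∀ᵐ x, x ∈ U → weakDeriv U j (weakDeriv U j w) x = c x := by
  have h1 := h.weakDeriv_ae hU
  refine IsWeakDeriv.weakDeriv_ae hU (h'.congr_ae hU ?_ (ae_of_all _ fun _ _ => rfl))
  filter_upwards [h1] with x hx hxU using (hx hxU).symm

end Discrete

/-! ### Gluing and truncating a discrete velocity. -/

section DiscreteGreen

variable {d : ℕ} {𝓗 : Finset (Set (E d))} {M : CompositeMesh d}

/-- A solution of the Stokes equations with its regularity in the interior of `Ω`: `H k j` is the
gradient of `∂ⱼ uₖ`, and `π` is the gradient of `p`. -/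
structure RegularSolution (M : CompositeMesh d) (f u : E d → E d) (p : E d → ℝ)
    (H : Fin d → Fin d → Fin d → E d → ℝ) (π : Fin d → E d → ℝ) : Prop where
  memL2_f : ∀ k, MemL2 M.Ω (fun x => f x k)
  memL2_u : ∀ k, MemL2 M.Ω (fun x => u x k)
  memL2_p : MemL2 M.Ω p
  memL2_grad : ∀ k j, MemL2 M.Ω (weakDeriv M.Ω j fun x => u x k)
  isWeakDeriv_u : ∀ k j, IsWeakDeriv M.Ω j (fun x => u x k) (weakDeriv M.Ω j fun x => u x k)
  locL2_H : ∀ k j i, LocL2 M.Ω (H k j i)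
  isWeakDeriv_grad : ∀ k j i, IsWeakDeriv M.Ω i (weakDeriv M.Ω j fun x => u x k) (H k j i)
  locL2_π : ∀ k, LocL2 M.Ω (π k)
  isWeakDeriv_p : ∀ k, IsWeakDeriv M.Ω k p (π k)
  residual : ∀ᵐ x, x ∈ M.Ω → ∀ k, ∑ j, H k j j x - π k x = - f x k
  div_eq_zero : ∀ᵐ x, x ∈ M.Ω → ∑ k, weakDeriv M.Ω k (fun y => u y k) x = 0

theorem IsWeakStokesSolution.exists_regularSolution {f u : E d → E d} {p : E d → ℝ}
    (h : IsWeakStokesSolution M.Ω f u p) (hf : MemLp f 2 (volume.restrict M.Ω)) :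
    ∃ H π, RegularSolution M f u p H π := by
  have hΩ := M.isOpen_Ω
  have hf' : ∀ k, MemL2 M.Ω (fun x => f x k) := fun k =>
    hf.continuousLinearMap_comp (EuclideanSpace.proj k : E d →L[ℝ] ℝ)
  have hg : ∀ k j, MemL2 M.Ω (weakDeriv M.Ω j fun x => u x k) := fun k j =>
    (h.1 k).1.memL2_weakDeriv hΩ j
  have hug := fun k j => (h.1 k).1.isWeakDeriv j
  have hdiv := h.div_eq_zero hΩ M.volume_Ω_ne_top
  obtain ⟨H, π, h1, h2, h3⟩ := stokes_regularity hΩ (u := fun k x => u x k) (f := fun k x => f x k)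
    (fun k j => (hg k j).locL2) hug h.2.1.1.locL2 (fun k => (hf' k).locL2)
    (fun φ hφ k => h.momentum hΩ hφ k) hdiv
  exact ⟨H, π, hf', fun k => (h.1 k).1.1, h.2.1.1, hg, hug, fun k j i => (h1 k j i).1,
    fun k j i => (h1 k j i).2, fun k => (h2 k).1, fun k => (h2 k).2, h3, hdiv⟩

namespace CompositeMesh

open Classical in
/-- The function that equals `vᵢ` on the part `Ωᵢ`, extended by zero. -/
def glue (M : CompositeMesh d) (v : Fin 2 → E d → E d) (k : Fin d) (x : E d) : ℝ :=
  if x ∈ M.pre 1 then v 1 x k else if x ∈ M.Ω then v 0 x k else 0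

variable {S : FESpaces M} {v : Fin 2 → E d → E d} {x : E d} {k : Fin d}

theorem glue_eq {i : Fin 2} (hx : x ∈ M.part i) : M.glue v k x = v i x k := by
  fin_cases i
  · have hx' : x ∈ M.Ω \ M.pre 1 := hx
    simp [glue, hx'.1, hx'.2]
  · have hx' : x ∈ M.pre 1 := hx
    simp [glue, hx']

theorem glue_eq_zero (hx : x ∉ M.Ω) : M.glue v k x = 0 := by
  have : x ∉ M.pre 1 := fun h => hx (M.pre_subset 1 h)
  simp [glue, hx, this]

theorem Adapted.piecewiseSmooth_glue (h𝓗 : M.Adapted 𝓗) (hv : v ∈ S.Vh) (k : Fin d) :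
    PiecewiseSmooth 𝓗 (M.glue v k) := by
  classical
  have := (h𝓗.piecewiseSmooth_V hv 1 k).ite ((h𝓗.piecewiseSmooth_V hv 0 k).ite
    (piecewiseSmooth_const 0) h𝓗.frontier_Ω) (h𝓗.frontier_pre 1)
  exact this

theorem part_cover (hx : x ∈ M.Ω) : ∃ i, x ∈ M.part i := by
  by_cases h : x ∈ M.pre 1
  exacts [⟨1, h⟩, ⟨0, hx, h⟩]

/-- A point of `Ωh i` outside Ω lies on ∂Ω, where v vanishes and is continuous from within `Ωh i`.
As `Ωh i` is closed and v is extended by zero, smallness holds in a full neighbourhood. -/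
theorem eventually_abs_V_le (hv : v ∈ S.Vh) (i : Fin 2) (k : Fin d) (hx : x ∉ M.Ω) {ε : ℝ}
    (hε : 0 < ε) : ∀ᶠ y in 𝓝 x, |v i y k| ≤ ε := by
  by_cases hxi : x ∈ M.Ωh i
  · have hxf : x ∈ frontier M.Ω := by
      rw [M.isOpen_Ω.frontier_eq]
      exact ⟨closure_mono (M.pre_subset i) (M.Ωh_subset_closure i hxi), hx⟩
    have h0 : v i x k = 0 := by rw [(hv i).2 x ⟨hxi, hxf⟩]; rfl
    have hc := (continuousOn_V hv i k x hxi).tendsto.abs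
    simp only [h0, abs_zero] at hc
    filter_upwards [eventually_nhdsWithin_iff.1 (hc.eventually_lt_const hε)] with y hy
    by_cases hyi : y ∈ M.Ωh i
    · exact (hy hyi).le
    · rw [V_eq_zero hv hyi, abs_zero]; exact hε.le
  · filter_upwards [(M.isClosed_Ωh i).isOpen_compl.mem_nhds hxi] with y hy
    rw [V_eq_zero hv hy, abs_zero]; exact hε.le

theorem eventually_abs_glue_le (hv : v ∈ S.Vh) (k : Fin d) (hx : x ∉ M.Ω) {ε : ℝ}
    (hε : 0 < ε) : ∀ᶠ y in 𝓝 x, |M.glue v k y| ≤ ε := by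
  filter_upwards [eventually_abs_V_le hv 0 k hx hε, eventually_abs_V_le hv 1 k hx hε] with y h0 h1
  by_cases hy : y ∈ M.Ω
  · obtain ⟨i, hi⟩ := part_cover hy
    rw [glue_eq hi]
    fin_cases i
    exacts [h0, h1]
  · rw [glue_eq_zero hy, abs_zero]; exact hε.le

/-- The purpose of the truncation: the glued velocity is below ε near every point outside Ω, so the
truncated one vanishes there and interior regularity of the solution suffices. -/
theorem tsupport_trunc_glue (hv : v ∈ S.Vh) (k : Fin d) {ε : ℝ} (hε : 0 < ε) :
    tsupport (fun x => trunc ε (M.glue v k x)) ⊆ M.Ω := fun x hx => by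
  by_contra hn
  refine notMem_tsupport_iff_eventuallyEq.2 ?_ hx
  filter_upwards [eventually_abs_glue_le hv k hn hε] with y hy using trunc_eq_zero hε hy

theorem hasCompactSupport_trunc_glue (hv : v ∈ S.Vh) (k : Fin d) {ε : ℝ} (hε : 0 < ε) :
    HasCompactSupport (fun x => trunc ε (M.glue v k x)) :=
  Metric.isCompact_of_isClosed_isBounded (isClosed_tsupport _)
    (M.isBounded_Ω.subset (tsupport_trunc_glue hv k hε))

theorem continuousAt_glue (hv : v ∈ S.Vh) (k : Fin d) (hx : x ∈ M.Ω) (hxΓ : x ∉ M.Γ) :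
    ContinuousAt (M.glue v k) x := by
  have key : ∀ i, ∀ U, IsOpen U → U ⊆ M.part i → x ∈ U → ContinuousAt (M.glue v k) x := by
    intro i U hU hUi hxU
    have hUh := hUi.trans (M.part_subset_Ωh i)
    exact (((continuousOn_V hv i k).mono hUh).continuousAt (hU.mem_nhds hxU)).congr
      (eventuallyEq_of_mem (hU.mem_nhds hxU) fun y hy => (glue_eq (hUi hy)).symm)
  by_cases hx1 : x ∈ M.pre 1
  · exact key 1 _ (M.isOpen_pre 1) le_rfl hx1
  · refine key 0 (M.Ω \ closure (M.pre 1)) (M.isOpen_Ω.sdiff isClosed_closure)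
      (sdiff_subset_sdiff_right subset_closure) ⟨hx, fun hxc => hxΓ ⟨?_, ?_⟩⟩
    · rw [M.part_one, (M.isOpen_pre 1).frontier_eq]; exact ⟨hxc, hx1⟩
    · rw [M.isOpen_Ω.frontier_eq]; exact fun h => h.2 hx

theorem RegularAt.tendsto_glue {ν : E d} {c r : ℝ} (h : RegularAt M 𝓗 x ν c r) (h𝓗 : M.Adapted 𝓗)
    (hv : v ∈ S.Vh) (k : Fin d) (i : Fin 2) :
    Tendsto (M.glue v k) (𝓝[side ν c i] x)
      (𝓝 (trace (M.part i) (fun y => v i y k) x)) := by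
  refine (h.tendsto_side (h𝓗.piecewiseSmooth_V hv i k) i).congr' ?_
  filter_upwards [ball_mem_nhdsWithin (s := side ν c i) h.pos] with y hy
  refine (glue_eq ?_).symm
  fin_cases i
  · exact ⟨h.ball_subset hy.1, disjoint_left.1 h.above_disjoint hy⟩
  · exact h.below_subset hy

/-- The jump of the truncation of `v` over `Γ`, in the component `k`. -/
def truncJump (M : CompositeMesh d) (ε : ℝ) (v : Fin 2 → E d → E d) (k : Fin d) (x : E d) : ℝ :=
  trunc ε (trace (M.part 1) (fun y => v 1 y k) x) - trunc ε (trace (M.part 0) (fun y => v 0 y k) x)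

/-- On Γ the given ν is the exterior normal or its negative; the latter also exchanges a and b, so
the product is unchanged. At a point of Ω off Γ the glued function is continuous, and near a point
outside Ω its truncation is zero; either way there is no jump. -/
theorem Adapted.jump_trunc_glue (h𝓗 : M.Adapted 𝓗) (hv : v ∈ S.Vh) (k : Fin d) {ε : ℝ}
    (hε : 0 < ε) (j : Fin d) (ν : E d) (c : ℝ) (hν : ‖ν‖ = 1) (hH : hyper ν c ∈ 𝓗) (y : E d)
    (hy : y ∈ hyper ν c) (hye : y ∉ edges 𝓗) (a b : ℝ)
    (ha : Tendsto (fun x => trunc ε (M.glue v k x)) (𝓝[{x | inner ℝ ν x < c}] y) (𝓝 a))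
    (hb : Tendsto (fun x => trunc ε (M.glue v k x)) (𝓝[above ν c] y) (𝓝 b)) :
    M.Γ.indicator (fun x => M.truncJump ε v k x * M.n x j) y = (a - b) * ν j := by
  have n0 := neBot_side hν hy 0
  have n1 := neBot_side hν hy 1
  change Tendsto _ (𝓝[side ν c 1] y) _ at ha
  change Tendsto _ (𝓝[side ν c 0] y) _ at hb
  by_cases hyΓ : y ∈ M.Γ
  · rw [indicator_of_mem hyΓ]
    obtain ⟨ν', c', r, h⟩ := h𝓗.exists_regularAt hyΓ hye
    have hs : hyper ν c = hyper ν' c' := by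
      by_contra hne
      exact hye (mem_edges.2 ⟨_, hH, _, h.hyper_mem, hne, hy, h.mem⟩)
    have ht := fun i => ((contDiff_trunc ε).continuous.tendsto _).comp (h.tendsto_glue h𝓗 hv k i)
    rw [h.n_eq, truncJump]
    rcases eq_or_neg_of_hyper_eq hν h.norm_eq hs with ⟨rfl, rfl⟩ | ⟨rfl, rfl⟩
    · rw [tendsto_nhds_unique ha (ht 1), tendsto_nhds_unique hb (ht 0)]
    · have hs0 : side (-ν) (-c) 0 = side ν c 1 := above_neg ν c
      have hs1 : side (-ν) (-c) 1 = side ν c 0 := by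
        ext z; simp [side, above, inner_neg_left]
      have h0 := ht 0
      have h1 := ht 1
      rw [hs0] at h0
      rw [hs1] at h1
      rw [tendsto_nhds_unique ha h0, tendsto_nhds_unique hb h1, PiLp.neg_apply]
      ring
  · rw [indicator_of_notMem hyΓ]
    have hc : ∃ l, Tendsto (fun x => trunc ε (M.glue v k x)) (𝓝 y) (𝓝 l) := by
      by_cases hyΩ : y ∈ M.Ω
      · exact ⟨_, ((contDiff_trunc ε).continuous.tendsto _).comp
          (continuousAt_glue hv k hyΩ hyΓ).tendsto⟩
      · refine ⟨0, tendsto_const_nhds.congr' ?_⟩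
        filter_upwards [eventually_abs_glue_le hv k hyΩ hε] with z hz
        exact (trunc_eq_zero hε hz).symm
    obtain ⟨l, hl⟩ := hc
    rw [tendsto_nhds_unique ha (hl.mono_left nhdsWithin_le_nhds),
      tendsto_nhds_unique hb (hl.mono_left nhdsWithin_le_nhds), sub_self, zero_mul]

theorem Adapted.memLp_trace_V (h𝓗 : M.Adapted 𝓗) (hv : v ∈ S.Vh) (i : Fin 2) (k : Fin d) :
    MemLp (trace (M.part i) fun y => v i y k) ⊤ M.surf :=
  h𝓗.memLp_trace (h𝓗.piecewiseSmooth_V hv i k) i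

theorem Adapted.memLp_truncJump (h𝓗 : M.Adapted 𝓗) (hv : v ∈ S.Vh) (k : Fin d) (ε : ℝ) :
    MemLp (M.truncJump ε v k) ⊤ M.surf := by
  have key : ∀ i, MemLp (fun x => trunc ε (trace (M.part i) (fun y => v i y k) x)) ⊤ M.surf :=
    fun i => (h𝓗.memLp_trace_V hv i k).mono
      ((contDiff_trunc ε).continuous.comp_aestronglyMeasurable (h𝓗.memLp_trace_V hv i k).1)
      (ae_of_all _ fun x => abs_trunc_le)
  exact (key 1).sub (key 0)

end CompositeMesh

end DiscreteGreen

/-! ### Removing the truncation in Green's formula. -/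

section DiscreteGreenLimit

variable {d : ℕ} {𝓗 : Finset (Set (E d))} {M : CompositeMesh d}

theorem integrable_mul_of_locL2 {U : Set (E d)} (hU : IsOpen U) {G w : E d → ℝ} (hG : MemLp G 2)
    (hGc : HasCompactSupport G) (hGU : tsupport G ⊆ U) (hw : LocL2 U w) :
    Integrable fun x => G x * w x := by
  obtain ⟨θ, hθ, hθ1, -⟩ := exists_isTestFunction_eq_one hGc.isCompact hU hGU
  refine (hG.integrable_mul (hw.memLp_mul hθ)).congr (ae_of_all _ fun x => ?_)
  by_cases hx : x ∈ tsupport G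
  · simp [(eventually_nhdsSet_iff_forall.1 hθ1 x hx).self_of_nhds]
  · simp [image_eq_zero_of_notMem_tsupport hx]

namespace CompositeMesh

variable {S : FESpaces M} {v : Fin 2 → E d → E d} {f u : E d → E d} {p : E d → ℝ}
  {H : Fin d → Fin d → Fin d → E d → ℝ} {π : Fin d → E d → ℝ}

/-- The normal stress `⟨(Du) · n⟩ₖ - ⟨p⟩ nₖ` of an exact solution. -/
def normalStress (M : CompositeMesh d) (u : E d → E d) (p : E d → ℝ) (k : Fin d) (x : E d) : ℝ :=
  (∑ j, M.n x j * trace (M.part 0) (weakDeriv M.Ω j fun y => u y k) x)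
    - M.n x k * trace (M.part 0) p x

/-- `Adapted.integral_green` is applied to every ∂ⱼuₖ and to p, and the results are combined so that
the volume terms with second derivatives of u and with ∇p form the strong residual Δuₖ - ∂ₖp = -fₖ.
No regularity of u or p near ∂Ω is used. -/
theorem Adapted.integral_green_trunc (h𝓗 : M.Adapted 𝓗) (hv : v ∈ S.Vh)
    (h : RegularSolution M f u p H π) (k : Fin d) {ε : ℝ} (hε : 0 < ε) :
    (∑ j, ∫ x, partialDeriv j (fun x => trunc ε (M.glue v k x)) x
        * weakDeriv M.Ω j (fun y => u y k) x)
      - (∫ x, partialDeriv k (fun x => trunc ε (M.glue v k x)) x * p x)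
      - (∫ x, trunc ε (M.glue v k x) * f x k)
      = ∫ x, M.truncJump ε v k x * M.normalStress u p k x ∂M.surf := by
  set G : E d → ℝ := fun x => trunc ε (M.glue v k x) with hGdef
  have hG : PiecewiseSmooth 𝓗 G := (h𝓗.piecewiseSmooth_glue hv k).comp (contDiff_trunc ε)
  have hGc : HasCompactSupport G := hasCompactSupport_trunc_glue hv k hε
  have hGΩ : tsupport G ⊆ M.Ω := tsupport_trunc_glue hv k hε
  have hGL := hG.memLp h𝓗.1 hGc 2
  have hg : ∀ j, MemLp (fun x => M.truncJump ε v k x * M.n x j) ⊤ M.surf := fun j =>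
    (h𝓗.memLp_n j).mul (h𝓗.memLp_truncJump hv k ε)
  have h1 := fun j => h𝓗.integral_green (h.memL2_grad k j).locL2 (h.locL2_H k j)
    (h.isWeakDeriv_grad k j) hG hGc hGΩ (hg j) j (h𝓗.jump_trunc_glue hv k hε j)
  have h2 := h𝓗.integral_green h.memL2_p.locL2 h.locL2_π h.isWeakDeriv_p hG hGc hGΩ (hg k) k
    (h𝓗.jump_trunc_glue hv k hε k)
  have iH := fun j => integrable_mul_of_locL2 M.isOpen_Ω hGL hGc hGΩ (h.locL2_H k j j)
  have iπ := integrable_mul_of_locL2 M.isOpen_Ω hGL hGc hGΩ (h.locL2_π k)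
  have hres : (∑ j, ∫ x, G x * H k j j x) - (∫ x, G x * π k x) = - ∫ x, G x * f x k := by
    rw [← integral_finsetSum _ fun j _ => iH j,
      ← integral_sub (integrable_finsetSum _ fun j _ => iH j) iπ, ← integral_neg]
    refine integral_congr_ae ?_
    filter_upwards [h.residual] with x hx
    by_cases hxΩ : x ∈ M.Ω
    · rw [← Finset.mul_sum, ← mul_sub, hx hxΩ k, mul_neg]
    · have : G x = 0 := image_eq_zero_of_notMem_tsupport fun h => hxΩ (hGΩ h)
      simp [this]
  have hr : ∫ x, M.truncJump ε v k x * M.normalStress u p k x ∂M.surf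
      = (∑ j, ∫ x, M.truncJump ε v k x * M.n x j
          * trace (M.part 0) (weakDeriv M.Ω j fun y => u y k) x ∂M.surf)
        - ∫ x, M.truncJump ε v k x * M.n x k * trace (M.part 0) p x ∂M.surf := by
    rw [← integral_finsetSum _ fun j _ => (h1 j).1,
      ← integral_sub (integrable_finsetSum _ fun j _ => (h1 j).1) h2.1]
    congr 1 with x
    rw [normalStress, mul_sub, Finset.mul_sum]
    simp only [mul_assoc]
  rw [hr, ← h2.2, Finset.sum_congr rfl fun j _ => (h1 j).2.symm, Finset.sum_add_distrib]
  linarith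

/-- Chain rule and dominated convergence. Where the glued function is nonzero the factor is
eventually 1; where it vanishes its derivative is zero almost everywhere. -/
theorem Adapted.tendsto_partialDeriv_trunc (h𝓗 : M.Adapted 𝓗) (hv : v ∈ S.Vh) (k j : Fin d)
    {w : E d → ℝ} (hw : MemL2 M.Ω w) :
    Tendsto (fun ε => ∫ x, partialDeriv j (fun x => trunc ε (M.glue v k x)) x * w x) (𝓝[>] 0)
      (𝓝 (∫ x in M.Ω, partialDeriv j (M.glue v k) x * w x)) := by
  obtain ⟨C, hC⟩ := exists_deriv_trunc_le
  have hps := h𝓗.piecewiseSmooth_glue hv k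
  have hdiff : ∀ x ∉ skel 𝓗, ∀ ε, partialDeriv j (fun x => trunc ε (M.glue v k x)) x
      = deriv (trunc ε) (M.glue v k x) * partialDeriv j (M.glue v k) x := fun x hx ε => by
    obtain ⟨P, hP, hPx⟩ := hps.exists_nhds h𝓗.1 hx
    exact partialDeriv_trunc ((hP.differentiable_infty x).congr_of_eventuallyEq hPx) ε j
  have hi : Integrable (fun x => partialDeriv j (M.glue v k) x * w x) (volume.restrict M.Ω) :=
    ((hps.partialDeriv j).memLp_restrict h𝓗.1 M.isBounded_Ω 2).integrable_mul hw
  have e : ∀ ε, 0 < ε → ∫ x, partialDeriv j (fun x => trunc ε (M.glue v k x)) x * w x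
      = ∫ x in M.Ω, partialDeriv j (fun x => trunc ε (M.glue v k x)) x * w x := fun ε hε =>
    (setIntegral_eq_integral_of_forall_compl_eq_zero fun x hx => by
      rw [image_eq_zero_of_notMem_tsupport fun h => hx (tsupport_trunc_glue hv k hε
        (tsupport_partialDeriv_subset _ _ h)), zero_mul]).symm
  refine Tendsto.congr' (f₁ := fun ε => ∫ x in M.Ω,
    partialDeriv j (fun x => trunc ε (M.glue v k x)) x * w x) ?_ ?_
  · filter_upwards [self_mem_nhdsWithin] with ε hε using (e ε hε).symm
  refine tendsto_integral_filter_of_dominated_convergence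
    (fun x => C * ‖partialDeriv j (M.glue v k) x * w x‖) ?_ ?_ (hi.norm.const_mul C) ?_
  · exact Eventually.of_forall fun ε => (((hps.comp (contDiff_trunc ε)).partialDeriv
      j).aestronglyMeasurable h𝓗.1).restrict.mul hw.1
  · refine Eventually.of_forall fun ε => ae_restrict_of_ae ?_
    filter_upwards [h𝓗.ae_notMem_skel] with x hx
    rw [hdiff x hx, mul_assoc, norm_mul]
    exact mul_le_mul_of_nonneg_right (hC ε _) (norm_nonneg _)
  · refine ae_restrict_of_ae ?_
    filter_upwards [h𝓗.ae_notMem_skel, hps.ae_partialDeriv_eq_zero h𝓗.1 j] with x hx hx0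
    simp only [hdiff x hx]
    by_cases h0 : M.glue v k x = 0
    · simp [hx0 h0]
    · simpa using ((tendsto_deriv_trunc h0).mul_const _).mul_const (w x)

theorem Adapted.tendsto_trunc_glue (h𝓗 : M.Adapted 𝓗) (hv : v ∈ S.Vh) (k : Fin d)
    {w : E d → ℝ} (hw : MemL2 M.Ω w) :
    Tendsto (fun ε => ∫ x, trunc ε (M.glue v k x) * w x) (𝓝[>] 0)
      (𝓝 (∫ x in M.Ω, M.glue v k x * w x)) := by
  have hps := h𝓗.piecewiseSmooth_glue hv k
  have hi : Integrable (fun x => M.glue v k x * w x) (volume.restrict M.Ω) :=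
    (hps.memLp_restrict h𝓗.1 M.isBounded_Ω 2).integrable_mul hw
  have e : ∀ ε, ∫ x in M.Ω, trunc ε (M.glue v k x) * w x = ∫ x, trunc ε (M.glue v k x) * w x :=
    fun ε => setIntegral_eq_integral_of_forall_compl_eq_zero fun x hx => by
      rw [glue_eq_zero hx]; simp [trunc]
  simp only [← e]
  refine tendsto_integral_filter_of_dominated_convergence
    (fun x => ‖M.glue v k x * w x‖) ?_ ?_ hi.norm ?_
  · exact Eventually.of_forall fun ε =>
      ((hps.comp (contDiff_trunc ε)).aestronglyMeasurable h𝓗.1).restrict.mul hw.1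
  · refine Eventually.of_forall fun ε => ae_of_all _ fun x => ?_
    rw [norm_mul, norm_mul]
    exact mul_le_mul_of_nonneg_right abs_trunc_le (norm_nonneg _)
  · exact ae_of_all _ fun x => (tendsto_trunc _).mul_const _

/-- Green's formula for the exact solution against a discrete velocity. -/
theorem Adapted.integral_green_V (h𝓗 : M.Adapted 𝓗) (hv : v ∈ S.Vh)
    (h : RegularSolution M f u p H π) (k : Fin d)
    (hs : Integrable (M.normalStress u p k) M.surf) :
    (∑ j, ∫ x in M.Ω, partialDeriv j (M.glue v k) x * weakDeriv M.Ω j (fun y => u y k) x)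
      - (∫ x in M.Ω, partialDeriv k (M.glue v k) x * p x)
      - (∫ x in M.Ω, M.glue v k x * f x k)
      = ∫ x, M.jump v k x * M.normalStress u p k x ∂M.surf := by
  have hl := ((tendsto_finsetSum Finset.univ fun j _ =>
    h𝓗.tendsto_partialDeriv_trunc hv k j (h.memL2_grad k j)).sub
    (h𝓗.tendsto_partialDeriv_trunc hv k k h.memL2_p)).sub
    (h𝓗.tendsto_trunc_glue hv k (h.memL2_f k))
  have hi : ∀ i, Integrable (fun x => |trace (M.part i) (fun y => v i y k) x|
      * ‖M.normalStress u p k x‖) M.surf := fun i => by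
    have := (hs.essSup_smul (h𝓗.memLp_trace_V hv i k).1 (h𝓗.memLp_trace_V hv i k).2.ne).norm
    refine this.congr (ae_of_all _ fun x => ?_)
    simp
  -- The traces of v are bounded, so integrability of the normal stress alone dominates the surface
  -- integrands.
  have hr : Tendsto (fun ε => ∫ x, M.truncJump ε v k x * M.normalStress u p k x ∂M.surf) (𝓝[>] 0)
      (𝓝 (∫ x, M.jump v k x * M.normalStress u p k x ∂M.surf)) := by
    refine tendsto_integral_filter_of_dominated_convergence
      (fun x => |trace (M.part 1) (fun y => v 1 y k) x| * ‖M.normalStress u p k x‖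
        + |trace (M.part 0) (fun y => v 0 y k) x| * ‖M.normalStress u p k x‖)
      ?_ ?_ ((hi 1).add (hi 0)) ?_
    · exact Eventually.of_forall fun ε => (h𝓗.memLp_truncJump hv k ε).1.mul hs.1
    · refine Eventually.of_forall fun ε => ae_of_all _ fun x => ?_
      rw [norm_mul, ← add_mul]
      refine mul_le_mul_of_nonneg_right ?_ (norm_nonneg _)
      exact (norm_sub_le _ _).trans (add_le_add abs_trunc_le abs_trunc_le)
    · exact ae_of_all _ fun x => ((tendsto_trunc _).sub (tendsto_trunc _)).mul_const _
  refine tendsto_nhds_unique hl (hr.congr' ?_)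
  filter_upwards [self_mem_nhdsWithin] with ε hε
  exact (h𝓗.integral_green_trunc hv h k hε).symm

end CompositeMesh

end DiscreteGreenLimit

/-! ### Linearity of the discrete form in its first argument -/

section Linearity

variable {d : ℕ} {𝓗 : Finset (Set (E d))} {M : CompositeMesh d}

/-- The common shape of the bilinear terms. F is kept separate from f - f' because traces and chosen
weak derivatives subtract only almost everywhere. -/
theorem integral_sum_mul_sub {ι α : Type*} [Fintype ι] [MeasurableSpace α] {μ : Measure α}
    {F f f' g : ι → α → ℝ} (hf : ∀ a, MemLp (f a) 2 μ) (hf' : ∀ a, MemLp (f' a) 2 μ)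
    (hg : ∀ a, MemLp (g a) 2 μ) (hF : ∀ a, ∀ᵐ x ∂μ, F a x = f a x - f' a x) :
    ∫ x, ∑ a, F a x * g a x ∂μ = (∫ x, ∑ a, f a x * g a x ∂μ) - ∫ x, ∑ a, f' a x * g a x ∂μ := by
  have i1 : Integrable (fun x => ∑ a, f a x * g a x) μ :=
    integrable_finsetSum _ fun a _ => (hf a).integrable_mul (hg a)
  have i2 : Integrable (fun x => ∑ a, f' a x * g a x) μ :=
    integrable_finsetSum _ fun a _ => (hf' a).integrable_mul (hg a)
  rw [← integral_sub i1 i2]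
  refine integral_congr_ae ?_
  filter_upwards [ae_all_iff.2 hF] with x hx
  rw [← Finset.sum_sub_distrib]
  exact Finset.sum_congr rfl fun a _ => by rw [hx a]; ring

/-- Pairs for which all terms of the discrete form are defined. -/
structure Admissible (M : CompositeMesh d) (U : Fin 2 → E d → E d) (P : Fin 2 → E d → ℝ) :
    Prop where
  memLp_D : ∀ i k j, MemLp (M.D i U k j) 2 (volume.restrict (M.Ωh i))
  memLp_P : ∀ i, MemLp (P i) 2 (volume.restrict (M.part i))
  memLp_jump : ∀ k, MemLp (M.jump U k) 2 M.surf
  memLp_avgNormalDeriv : ∀ k, MemLp (M.avgNormalDeriv U k) 2 M.surf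
  memLp_avg : MemLp (M.avg P) 2 M.surf
  isWeakDeriv : ∀ i k j, IsWeakDeriv (interior (M.Ωh i)) j (fun x => U i x k) (M.D i U k j)
  hasTrace : ∀ i k, ∀ᵐ x ∂M.surf, ∃ a, HasTrace (M.part i) (fun y => U i y k) x a
  hasTrace_D : ∀ i k j, ∀ᵐ x ∂M.surf, ∃ a, HasTrace (M.part i) (M.D i U k j) x a
  hasTrace_P : ∀ i, ∀ᵐ x ∂M.surf, ∃ a, HasTrace (M.part i) (P i) x a
  exists_second : ∀ K ∈ M.subFinset 0, ∀ k j, ∃ b c,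
    IsWeakDeriv (interior K) j (fun x => U 0 x k) b ∧ IsWeakDeriv (interior K) j b c
  exists_first : ∀ K ∈ M.subFinset 0, ∀ k, ∃ b, IsWeakDeriv (interior K) k (P 0) b
  memLp_residual : ∀ k, MemLp (fun x => brokenLaplacian (M.mesh 0) (fun y => U 0 y k) x
    - brokenDeriv (M.mesh 0) k (P 0) x) 2 (volume.restrict (M.Ωh 0))

namespace CompositeMesh

variable {U U' : Fin 2 → E d → E d} {P P' : Fin 2 → E d → ℝ}

theorem measurableSet_Ωh (i : Fin 2) : MeasurableSet (M.Ωh i) := (M.isClosed_Ωh i).measurableSet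

theorem Adapted.D_sub (h𝓗 : M.Adapted 𝓗) (h : Admissible M U P) (h' : Admissible M U' P')
    (i : Fin 2) (k j : Fin d) : ∀ᵐ x, x ∈ M.Ωh i →
      M.D i (fun i x => U i x - U' i x) k j x = M.D i U k j x - M.D i U' k j x := by
  have h1 := ((h.isWeakDeriv i k j).sub isOpen_interior (h'.isWeakDeriv i k j)).weakDeriv_ae
    isOpen_interior
  filter_upwards [h1, h𝓗.ae_mem_interior i] with x hx hxi hxΩ using hx (hxi hxΩ)

theorem jump_sub (h : Admissible M U P) (h' : Admissible M U' P') (k : Fin d) :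
    ∀ᵐ x ∂M.surf, M.jump (fun i x => U i x - U' i x) k x = M.jump U k x - M.jump U' k x := by
  filter_upwards [ae_all_iff.2 fun i => h.hasTrace i k, ae_all_iff.2 fun i => h'.hasTrace i k]
    with x hx hx'
  have key : ∀ i, trace (M.part i) (fun y => (U i y - U' i y) k) x
      = trace (M.part i) (fun y => U i y k) x - trace (M.part i) (fun y => U' i y k) x := fun i => by
    obtain ⟨a, ha⟩ := hx i
    obtain ⟨b, hb⟩ := hx' i
    rw [ha.trace_eq, hb.trace_eq]
    exact (ha.sub hb).trace_eq
  rw [jump, key, key, jump, jump]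
  ring

theorem avg_sub (h : Admissible M U P) (h' : Admissible M U' P') :
    ∀ᵐ x ∂M.surf, M.avg (fun i x => P i x - P' i x) x = M.avg P x - M.avg P' x := by
  filter_upwards [ae_all_iff.2 h.hasTrace_P, ae_all_iff.2 h'.hasTrace_P] with x hx hx'
  have key : ∀ i, trace (M.part i) (fun y => P i y - P' i y) x
      = trace (M.part i) (P i) x - trace (M.part i) (P' i) x := fun i => by
    obtain ⟨a, ha⟩ := hx i
    obtain ⟨b, hb⟩ := hx' i
    rw [ha.trace_eq, hb.trace_eq, (ha.sub hb).trace_eq]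
  rw [avg, key, key, avg, avg]
  ring

theorem Adapted.avgNormalDeriv_sub (h𝓗 : M.Adapted 𝓗) (h : Admissible M U P)
    (h' : Admissible M U' P') (k : Fin d) :
    ∀ᵐ x ∂M.surf, M.avgNormalDeriv (fun i x => U i x - U' i x) k x
      = M.avgNormalDeriv U k x - M.avgNormalDeriv U' k x := by
  filter_upwards [ae_all_iff.2 fun i => ae_all_iff.2 fun j => h.hasTrace_D i k j,
    ae_all_iff.2 fun i => ae_all_iff.2 fun j => h'.hasTrace_D i k j] with x hx hx'
  have key : ∀ i j, trace (M.part i) (M.D i (fun i x => U i x - U' i x) k j) x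
      = trace (M.part i) (M.D i U k j) x - trace (M.part i) (M.D i U' k j) x := fun i j => by
    obtain ⟨a, ha⟩ := hx i j
    obtain ⟨b, hb⟩ := hx' i j
    rw [ha.trace_eq, hb.trace_eq]
    refine ((ha.sub hb).congr_ae one_pos (M.measurableSet_part i) ?_).trace_eq
    filter_upwards [h𝓗.D_sub h h' i k j] with y hy hyi _
    exact (hy (M.part_subset_Ωh i hyi)).symm
  simp only [avgNormalDeriv, key, sub_mul, Finset.sum_sub_distrib]
  ring

/-- The argument is elementwise: existence of the derivatives is indispensable, since the default
value 0 of `weakDeriv` is not additive, and almost every point is interior to exactly one element.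
-/
theorem Adapted.residual_sub (h𝓗 : M.Adapted 𝓗) (h : Admissible M U P) (h' : Admissible M U' P')
    (k : Fin d) : ∀ᵐ x, x ∈ M.Ωh 0 →
      brokenLaplacian (M.mesh 0) (fun y => (U 0 y - U' 0 y) k) x
        - brokenDeriv (M.mesh 0) k (fun y => P 0 y - P' 0 y) x
      = (brokenLaplacian (M.mesh 0) (fun y => U 0 y k) x - brokenDeriv (M.mesh 0) k (P 0) x)
        - (brokenLaplacian (M.mesh 0) (fun y => U' 0 y k) x
          - brokenDeriv (M.mesh 0) k (P' 0) x) := by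
  have key : ∀ K ∈ M.subFinset 0, ∀ᵐ x, x ∈ interior K →
      (∀ j, weakDeriv (interior K) j (weakDeriv (interior K) j fun y => (U 0 y - U' 0 y) k) x
        = weakDeriv (interior K) j (weakDeriv (interior K) j fun y => U 0 y k) x
        - weakDeriv (interior K) j (weakDeriv (interior K) j fun y => U' 0 y k) x) ∧
      weakDeriv (interior K) k (fun y => P 0 y - P' 0 y) x
        = weakDeriv (interior K) k (P 0) x - weakDeriv (interior K) k (P' 0) x := by
    intro K hK
    have hKo : IsOpen (interior K) := isOpen_interior
    have hj : ∀ j, ∀ᵐ x, x ∈ interior K →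
        weakDeriv (interior K) j (weakDeriv (interior K) j fun y => (U 0 y - U' 0 y) k) x
        = weakDeriv (interior K) j (weakDeriv (interior K) j fun y => U 0 y k) x
        - weakDeriv (interior K) j (weakDeriv (interior K) j fun y => U' 0 y k) x := by
      intro j
      obtain ⟨b, c, hb, hc⟩ := h.exists_second K hK k j
      obtain ⟨b', c', hb', hc'⟩ := h'.exists_second K hK k j
      filter_upwards [(hb.sub hKo hb').weakDeriv_weakDeriv_ae hKo (hc.sub hKo hc'),
        hb.weakDeriv_weakDeriv_ae hKo hc, hb'.weakDeriv_weakDeriv_ae hKo hc'] with x h1 h2 h3 hx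
      rw [h2 hx, h3 hx]
      exact h1 hx
    obtain ⟨b, hb⟩ := h.exists_first K hK k
    obtain ⟨b', hb'⟩ := h'.exists_first K hK k
    filter_upwards [ae_all_iff.2 hj, (hb.sub hKo hb').weakDeriv_ae hKo, hb.weakDeriv_ae hKo,
      hb'.weakDeriv_ae hKo] with x h0 h1 h2 h3 hx
    exact ⟨fun j => h0 j hx, by rw [h1 hx, h2 hx, h3 hx]⟩
  have key' := (ae_ball_iff (M.subFinset 0).countable_toSet).2 key
  filter_upwards [key', h𝓗.ae_sum_indicator 0] with x hx hx2 hxΩ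
  obtain ⟨K, hK, hxK, hsum⟩ := hx2 hxΩ
  obtain ⟨h1, h2⟩ := hx K hK hxK
  simp only [brokenLaplacian, brokenDeriv, hsum]
  rw [h2, Finset.sum_congr rfl fun j _ => h1 j, Finset.sum_sub_distrib]
  ring

/-- Every term of the form pairs two square integrable factors, so its integral splits. The
condition on Δv + ∇q is separate because `Admissible` controls only the combination with the
opposite sign. -/
theorem Adapted.Ah_sub (h𝓗 : M.Adapted 𝓗) (h : Admissible M U P) (h' : Admissible M U' P')
    {v : Fin 2 → E d → E d} {q : Fin 2 → E d → ℝ} (hv : Admissible M v q)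
    (hr : ∀ k, MemLp (fun x => brokenLaplacian (M.mesh 0) (fun y => v 0 y k) x
      + brokenDeriv (M.mesh 0) k (q 0) x) 2 (volume.restrict (M.Ωh 0))) (t β : ℝ) :
    M.Ah t β (fun i x => U i x - U' i x) (fun i x => P i x - P' i x) v q
      = M.Ah t β U P v q - M.Ah t β U' P' v q := by
  have hDs := fun i k j => h𝓗.D_sub h h' i k j
  have hpart : ∀ i, volume.restrict (M.part i) ≤ volume.restrict (M.Ωh i) := fun i =>
    Measure.restrict_mono (M.part_subset_Ωh i) le_rfl
  have hDp : ∀ i k j, ∀ᵐ x ∂volume.restrict (M.part i),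
      M.D i (fun i x => U i x - U' i x) k j x = M.D i U k j x - M.D i U' k j x := fun i k j => by
    refine (ae_restrict_iff' (M.measurableSet_part i)).2 ?_
    filter_upwards [hDs i k j] with x hx hxi using hx (M.part_subset_Ωh i hxi)
  have hnq : ∀ (g : E d → ℝ), MemLp g 2 M.surf → ∀ k, MemLp (fun x => M.n x k * g x) 2 M.surf :=
    fun g hg k => hg.mul (h𝓗.memLp_n k)
  have e1 : ∀ i, ∫ x in M.part i, ∑ k, ∑ j,
      M.D i (fun i x => U i x - U' i x) k j x * M.D i v k j x
      = (∫ x in M.part i, ∑ k, ∑ j, M.D i U k j x * M.D i v k j x)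
        - ∫ x in M.part i, ∑ k, ∑ j, M.D i U' k j x * M.D i v k j x := fun i => by
    have := integral_sum_mul_sub (μ := volume.restrict (M.part i)) (ι := Fin d × Fin d)
      (F := fun a => M.D i (fun i x => U i x - U' i x) a.1 a.2) (f := fun a => M.D i U a.1 a.2)
      (f' := fun a => M.D i U' a.1 a.2) (g := fun a => M.D i v a.1 a.2)
      (fun a => (h.memLp_D i _ _).mono_measure (hpart i))
      (fun a => (h'.memLp_D i _ _).mono_measure (hpart i))
      (fun a => (hv.memLp_D i _ _).mono_measure (hpart i)) (fun a => hDp i _ _)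
    simpa only [Fintype.sum_prod_type] using this
  have e2 := integral_sum_mul_sub h.memLp_avgNormalDeriv h'.memLp_avgNormalDeriv hv.memLp_jump
    (fun k => h𝓗.avgNormalDeriv_sub h h' k)
  have e3 := integral_sum_mul_sub h.memLp_jump h'.memLp_jump hv.memLp_avgNormalDeriv
    (fun k => jump_sub h h' k)
  have e4 := integral_sum_mul_sub h.memLp_jump h'.memLp_jump hv.memLp_jump
    (fun k => jump_sub h h' k)
  have e5 : ∫ x in M.Ωh 0 ∩ M.part 1, ∑ k, ∑ j,
      (M.D 1 (fun i x => U i x - U' i x) k j x - M.D 0 (fun i x => U i x - U' i x) k j x)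
        * (M.D 1 v k j x - M.D 0 v k j x)
      = (∫ x in M.Ωh 0 ∩ M.part 1, ∑ k, ∑ j, (M.D 1 U k j x - M.D 0 U k j x)
        * (M.D 1 v k j x - M.D 0 v k j x))
        - ∫ x in M.Ωh 0 ∩ M.part 1, ∑ k, ∑ j, (M.D 1 U' k j x - M.D 0 U' k j x)
        * (M.D 1 v k j x - M.D 0 v k j x) := by
    have hle : ∀ i, volume.restrict (M.Ωh 0 ∩ M.part 1) ≤ volume.restrict (M.Ωh i) := fun i => by
      refine Measure.restrict_mono ?_ le_rfl
      fin_cases i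
      exacts [inter_subset_left, inter_subset_right.trans (M.part_subset_Ωh 1)]
    have hL : ∀ {V : Fin 2 → E d → E d} {R : Fin 2 → E d → ℝ}, Admissible M V R → ∀ k j,
        MemLp (fun x => M.D 1 V k j x - M.D 0 V k j x) 2 (volume.restrict (M.Ωh 0 ∩ M.part 1)) :=
      fun hV k j => ((hV.memLp_D 1 k j).mono_measure (hle 1)).sub
        ((hV.memLp_D 0 k j).mono_measure (hle 0))
    have := integral_sum_mul_sub (μ := volume.restrict (M.Ωh 0 ∩ M.part 1)) (ι := Fin d × Fin d)
      (F := fun a x => M.D 1 (fun i x => U i x - U' i x) a.1 a.2 x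
        - M.D 0 (fun i x => U i x - U' i x) a.1 a.2 x)
      (f := fun a x => M.D 1 U a.1 a.2 x - M.D 0 U a.1 a.2 x)
      (f' := fun a x => M.D 1 U' a.1 a.2 x - M.D 0 U' a.1 a.2 x)
      (g := fun a x => M.D 1 v a.1 a.2 x - M.D 0 v a.1 a.2 x)
      (fun a => hL h _ _) (fun a => hL h' _ _) (fun a => hL hv _ _) (fun a => by
        refine (ae_restrict_iff' ((measurableSet_Ωh 0).inter (M.measurableSet_part 1))).2 ?_
        filter_upwards [hDs 0 a.1 a.2, hDs 1 a.1 a.2] with x h0 h1 hx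
        rw [h0 hx.1, h1 (M.part_subset_Ωh 1 hx.2)]
        ring)
    simpa only [Fintype.sum_prod_type] using this
  have e6 : ∀ i, ∫ x in M.part i, M.divergence i (fun i x => U i x - U' i x) x * q i x
      = (∫ x in M.part i, M.divergence i U x * q i x)
        - ∫ x in M.part i, M.divergence i U' x * q i x := fun i => by
    have := integral_sum_mul_sub (μ := volume.restrict (M.part i))
      (F := fun k => M.D i (fun i x => U i x - U' i x) k k) (f := fun k => M.D i U k k)
      (f' := fun k => M.D i U' k k) (g := fun _ => q i)
      (fun a => (h.memLp_D i _ _).mono_measure (hpart i))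
      (fun a => (h'.memLp_D i _ _).mono_measure (hpart i))
      (fun a => hv.memLp_P i) (fun a => hDp i _ _)
    simpa only [divergence, Finset.sum_mul] using this
  have e7 : ∫ x, (∑ k, M.n x k * M.jump (fun i x => U i x - U' i x) k x) * M.avg q x ∂M.surf
      = (∫ x, (∑ k, M.n x k * M.jump U k x) * M.avg q x ∂M.surf)
        - ∫ x, (∑ k, M.n x k * M.jump U' k x) * M.avg q x ∂M.surf := by
    have := integral_sum_mul_sub h.memLp_jump h'.memLp_jump (hnq _ hv.memLp_avg)
      (fun k => jump_sub h h' k)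
    simpa only [Finset.sum_mul, mul_comm (M.n _ _) (M.jump _ _ _), mul_assoc] using this
  have e8 : ∀ i, ∫ x in M.part i, M.divergence i v x * (P i x - P' i x)
      = (∫ x in M.part i, M.divergence i v x * P i x)
        - ∫ x in M.part i, M.divergence i v x * P' i x := fun i => by
    have := integral_sum_mul_sub (μ := volume.restrict (M.part i))
      (F := fun (_ : Fin d) x => P i x - P' i x) (f := fun _ => P i) (f' := fun _ => P' i)
      (g := fun k => M.D i v k k) (fun _ => h.memLp_P i) (fun _ => h'.memLp_P i)
      (fun a => (hv.memLp_D i _ _).mono_measure (hpart i)) (fun _ => ae_of_all _ fun _ => rfl)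
    simpa only [divergence, Finset.sum_mul, mul_comm (M.D i v _ _ _)] using this
  have e9 : ∫ x, (∑ k, M.n x k * M.jump v k x) * M.avg (fun i x => P i x - P' i x) x ∂M.surf
      = (∫ x, (∑ k, M.n x k * M.jump v k x) * M.avg P x ∂M.surf)
        - ∫ x, (∑ k, M.n x k * M.jump v k x) * M.avg P' x ∂M.surf := by
    have := integral_sum_mul_sub (F := fun (_ : Fin d) => M.avg fun i x => P i x - P' i x)
      (fun _ => h.memLp_avg) (fun _ => h'.memLp_avg) (fun k => hnq _ (hv.memLp_jump k) k)
      (fun _ => avg_sub h h')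
    simpa only [Finset.sum_mul, mul_comm (M.avg _ _)] using this
  have hle : volume.restrict (M.Ωh 0 \ M.coreSet) ≤ volume.restrict (M.Ωh 0) :=
    Measure.restrict_mono sdiff_subset le_rfl
  have e10 := integral_sum_mul_sub (μ := volume.restrict (M.Ωh 0 \ M.coreSet))
    (fun k => (h.memLp_residual k).mono_measure hle)
    (fun k => (h'.memLp_residual k).mono_measure hle) (fun k => (hr k).mono_measure hle)
    (fun k => ae_mono hle ((ae_restrict_iff' (measurableSet_Ωh 0)).2 (h𝓗.residual_sub h h' k)))
  simp only [Ah, ah, ahN, ahO, bh, dh, Fin.sum_univ_two] at e1 e2 e3 e4 e5 e6 e7 e8 e9 e10 ⊢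
  rw [e1, e1, e2, e3, e4, e5, e6, e6, e7, e8, e8, e9, e10]
  ring

end CompositeMesh

end Linearity

/-! ### Consistency -/

section Consistency

variable {d : ℕ} {𝓗 : Finset (Set (E d))} {M : CompositeMesh d}

namespace CompositeMesh

variable {S : FESpaces M} {v : Fin 2 → E d → E d} {q : Fin 2 → E d → ℝ} {f u : E d → E d}
  {p : E d → ℝ} {H : Fin d → Fin d → Fin d → E d → ℝ} {π : Fin d → E d → ℝ}

theorem Adapted.hasTrace_D_V (h𝓗 : M.Adapted 𝓗) (hv : v ∈ S.Vh) (i : Fin 2) (k j : Fin d) :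
    ∀ᵐ x ∂M.surf, HasTrace (M.part i) (M.D i v k j) x
      (trace (M.part i) (partialDeriv j fun y => v i y k) x) := by
  filter_upwards [h𝓗.ae_regularAt] with x ⟨ν, c, r, h⟩
  refine (h.hasTrace ((h𝓗.piecewiseSmooth_V hv i k).partialDeriv j) i).congr_ae one_pos
    (M.measurableSet_part i) ?_
  filter_upwards [h𝓗.D_V_ae hv i k j] with y hy hyi _ using (hy (M.part_subset_Ωh i hyi)).symm

theorem Adapted.brokenLaplacian_V_ae (h𝓗 : M.Adapted 𝓗) (hv : v ∈ S.Vh) (k : Fin d) :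
    ∀ᵐ x, x ∈ M.Ωh 0 → brokenLaplacian (M.mesh 0) (fun y => v 0 y k) x
      = ∑ j, partialDeriv j (partialDeriv j fun y => v 0 y k) x := by
  have key : ∀ K ∈ M.subFinset 0, ∀ᵐ x, ∀ j, x ∈ interior K →
      weakDeriv (interior K) j (weakDeriv (interior K) j fun y => v 0 y k) x
        = partialDeriv j (partialDeriv j fun y => v 0 y k) x := fun K hK => by
    obtain ⟨P, hP, hPv⟩ := exists_contDiff_V hv k hK
    exact ae_all_iff.2 fun j => (isWeakDeriv_of_eqOn isOpen_interior hP hPv j).weakDeriv_weakDeriv_ae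
      isOpen_interior (isWeakDeriv_of_eqOn isOpen_interior (hP.partialDeriv j)
        (eqOn_partialDeriv isOpen_interior hPv j) j)
  filter_upwards [(ae_ball_iff (M.subFinset 0).countable_toSet).2 key, h𝓗.ae_sum_indicator 0]
    with x hx hx2 hxΩ
  obtain ⟨K, hK, hxK, hsum⟩ := hx2 hxΩ
  simp only [brokenLaplacian, hsum]
  exact Finset.sum_congr rfl fun j _ => hx K hK j hxK

theorem Adapted.brokenDeriv_Q_ae (h𝓗 : M.Adapted 𝓗) (hq : q ∈ S.Qh) (k : Fin d) :
    ∀ᵐ x, x ∈ M.Ωh 0 → brokenDeriv (M.mesh 0) k (q 0) x = partialDeriv k (q 0) x := by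
  have key : ∀ K ∈ M.subFinset 0, ∀ᵐ x, x ∈ interior K →
      weakDeriv (interior K) k (q 0) x = partialDeriv k (q 0) x := fun K hK => by
    obtain ⟨P, hP, hPq⟩ := exists_contDiff_Q hq hK
    exact (isWeakDeriv_of_eqOn isOpen_interior hP hPq k).weakDeriv_ae isOpen_interior
  filter_upwards [(ae_ball_iff (M.subFinset 0).countable_toSet).2 key, h𝓗.ae_sum_indicator 0]
    with x hx hx2 hxΩ
  obtain ⟨K, hK, hxK, hsum⟩ := hx2 hxΩ
  simp only [brokenDeriv, hsum]
  exact hx K hK hxK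

theorem ae_restrict_Ωh {i : Fin 2} {F F' : E d → ℝ} (h : ∀ᵐ x, x ∈ M.Ωh i → F x = F' x) :
    F =ᵐ[volume.restrict (M.Ωh i)] F' := (ae_restrict_iff' (measurableSet_Ωh i)).2 h

theorem Adapted.memLp_brokenLaplacian_V (h𝓗 : M.Adapted 𝓗) (hv : v ∈ S.Vh) (k : Fin d) :
    MemLp (brokenLaplacian (M.mesh 0) fun y => v 0 y k) 2 (volume.restrict (M.Ωh 0)) := by
  have h1 : MemLp (fun x => ∑ j, partialDeriv j (partialDeriv j fun y => v 0 y k) x) 2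
      (volume.restrict (M.Ωh 0)) := memLp_finsetSum _ fun j _ =>
    (((h𝓗.piecewiseSmooth_V hv 0 k).partialDeriv j).partialDeriv j).memLp_restrict h𝓗.1
      (isBounded_Ωh 0) 2
  exact h1.ae_eq (ae_restrict_Ωh (h𝓗.brokenLaplacian_V_ae hv k)).symm

theorem Adapted.memLp_brokenDeriv_Q (h𝓗 : M.Adapted 𝓗) (hq : q ∈ S.Qh) (k : Fin d) :
    MemLp (brokenDeriv (M.mesh 0) k (q 0)) 2 (volume.restrict (M.Ωh 0)) :=
  (((h𝓗.piecewiseSmooth_Q hq 0).partialDeriv k).memLp_restrict h𝓗.1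
    (isBounded_Ωh 0) 2).ae_eq (ae_restrict_Ωh (h𝓗.brokenDeriv_Q_ae hq k)).symm

theorem Adapted.admissible_discrete (h𝓗 : M.Adapted 𝓗) (hv : v ∈ S.Vh) (hq : q ∈ S.Qh) :
    Admissible M v q := by
  have := h𝓗.isFiniteMeasure_surf
  have hvi := fun i k => h𝓗.piecewiseSmooth_V hv i k
  have hqi := fun i => h𝓗.piecewiseSmooth_Q hq i
  refine ⟨fun i k j => ?_, fun i => ?_, fun k => ?_, fun k => ?_, ?_, fun i k j => ?_,
    fun i k => ?_, fun i k j => ?_, fun i => ?_, fun K hK k j => ?_, fun K hK k => ?_, fun k => ?_⟩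
  · exact (((hvi i k).partialDeriv j).memLp_restrict h𝓗.1 (isBounded_Ωh i) 2).ae_eq
      (ae_restrict_Ωh (h𝓗.D_V_ae hv i k j)).symm
  · exact (hqi i).memLp_restrict h𝓗.1 (M.isBounded_Ω.subset (M.part_subset i)) 2
  · exact ((h𝓗.memLp_trace_V hv 1 k).sub (h𝓗.memLp_trace_V hv 0 k)).mono_exponent le_top
  · have h1 : ∀ i j, MemLp (fun x => trace (M.part i) (M.D i v k j) x * M.n x j) ⊤ M.surf :=
      fun i j => (h𝓗.memLp_n j).mul ((h𝓗.memLp_trace ((hvi i k).partialDeriv j) i).ae_eq (by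
        filter_upwards [h𝓗.hasTrace_D_V hv i k j] with x hx using hx.trace_eq.symm))
    have h2 := ((memLp_finsetSum Finset.univ fun j _ => h1 0 j).add
      (memLp_finsetSum Finset.univ fun j _ => h1 1 j)).const_mul (2⁻¹ : ℝ)
    refine (h2.mono_exponent le_top).ae_eq (ae_of_all _ fun x => ?_)
    simp only [avgNormalDeriv, Pi.add_apply]
    ring
  · have h2 := ((h𝓗.memLp_trace (hqi 0) 0).add (h𝓗.memLp_trace (hqi 1) 1)).const_mul (2⁻¹ : ℝ)
    refine (h2.mono_exponent le_top).ae_eq (ae_of_all _ fun x => ?_)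
    simp only [avg, Pi.add_apply]
    ring
  · exact (h𝓗.isWeakDeriv_V hv i k j).isWeakDeriv_weakDeriv
  · filter_upwards [h𝓗.ae_regularAt] with x ⟨ν, c, r, h⟩ using ⟨_, h.hasTrace (hvi i k) i⟩
  · filter_upwards [h𝓗.hasTrace_D_V hv i k j] with x hx using ⟨_, hx⟩
  · filter_upwards [h𝓗.ae_regularAt] with x ⟨ν, c, r, h⟩ using ⟨_, h.hasTrace (hqi i) i⟩
  · obtain ⟨P, hP, hPv⟩ := exists_contDiff_V hv k hK
    exact ⟨_, _, isWeakDeriv_of_eqOn isOpen_interior hP hPv j,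
      isWeakDeriv_of_eqOn isOpen_interior (hP.partialDeriv j)
        (eqOn_partialDeriv isOpen_interior hPv j) j⟩
  · obtain ⟨P, hP, hPq⟩ := exists_contDiff_Q hq hK
    exact ⟨_, isWeakDeriv_of_eqOn isOpen_interior hP hPq k⟩
  · exact (h𝓗.memLp_brokenLaplacian_V hv k).sub (h𝓗.memLp_brokenDeriv_Q hq k)

theorem Adapted.D_exact_ae (h𝓗 : M.Adapted 𝓗) (h : RegularSolution M f u p H π) (i : Fin 2)
    (k j : Fin d) : ∀ᵐ x, x ∈ M.Ωh i →
      M.D i (fun _ => u) k j x = weakDeriv M.Ω j (fun y => u y k) x := by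
  filter_upwards [((h.isWeakDeriv_u k j).mono (M.interior_Ωh_subset_Ω i)).weakDeriv_ae
    isOpen_interior, h𝓗.ae_mem_interior i] with x h1 h2 hx using h1 (h2 hx)

theorem Adapted.hasTrace_D_exact (h𝓗 : M.Adapted 𝓗) (h : RegularSolution M f u p H π)
    (k j : Fin d) : ∀ᵐ x ∂M.surf, ∀ i, HasTrace (M.part i) (M.D i (fun _ => u) k j) x
      (trace (M.part 0) (weakDeriv M.Ω j fun y => u y k) x) := by
  filter_upwards [h𝓗.ae_exists_hasTrace (h.memL2_grad k j).locL2 (h.locL2_H k j)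
    (h.isWeakDeriv_grad k j)] with x ⟨a, ha⟩ i
  rw [(ha 0).trace_eq]
  refine (ha i).congr_ae one_pos (M.measurableSet_part i) ?_
  filter_upwards [h𝓗.D_exact_ae h i k j] with y hy hyi _ using (hy (M.part_subset_Ωh i hyi)).symm

theorem Adapted.hasTrace_u (h𝓗 : M.Adapted 𝓗) (h : RegularSolution M f u p H π) (k : Fin d) :
    ∀ᵐ x ∂M.surf, ∃ a, ∀ i, HasTrace (M.part i) (fun y => u y k) x a :=
  h𝓗.ae_exists_hasTrace (h.memL2_u k).locL2 (fun j => (h.memL2_grad k j).locL2)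
    (fun j => h.isWeakDeriv_u k j)

theorem Adapted.hasTrace_p (h𝓗 : M.Adapted 𝓗) (h : RegularSolution M f u p H π) :
    ∀ᵐ x ∂M.surf, ∃ a, ∀ i, HasTrace (M.part i) p x a :=
  h𝓗.ae_exists_hasTrace h.memL2_p.locL2 h.locL2_π h.isWeakDeriv_p

theorem Adapted.jump_exact (h𝓗 : M.Adapted 𝓗) (h : RegularSolution M f u p H π) (k : Fin d) :
    ∀ᵐ x ∂M.surf, M.jump (fun _ => u) k x = 0 := by
  filter_upwards [h𝓗.hasTrace_u h k] with x ⟨a, ha⟩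
  rw [jump, (ha 0).trace_eq, (ha 1).trace_eq, sub_self]

/-- Inside an element the weak derivatives are restrictions of those on Ω, so the strong momentum
equation can be read off there. -/
theorem Adapted.residual_exact (h𝓗 : M.Adapted 𝓗) (h : RegularSolution M f u p H π) (k : Fin d) :
    ∀ᵐ x, x ∈ M.Ωh 0 → brokenLaplacian (M.mesh 0) (fun y => u y k) x
      - brokenDeriv (M.mesh 0) k p x = - f x k := by
  have hsub : ∀ K ∈ M.subFinset 0, interior K ⊆ M.Ω := fun K hK =>
    (M.interior_mesh_subset (M.mem_subFinset.1 hK).1).trans (M.pre_subset 0)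
  have key : ∀ K ∈ M.subFinset 0, ∀ᵐ x, x ∈ interior K →
      (∀ j, weakDeriv (interior K) j (weakDeriv (interior K) j fun y => u y k) x = H k j j x) ∧
        weakDeriv (interior K) k p x = π k x := fun K hK => by
    have h1 := fun j => ((h.isWeakDeriv_u k j).mono (hsub K hK)).weakDeriv_weakDeriv_ae
      isOpen_interior ((h.isWeakDeriv_grad k j j).mono (hsub K hK))
    filter_upwards [ae_all_iff.2 h1, ((h.isWeakDeriv_p k).mono (hsub K hK)).weakDeriv_ae
      isOpen_interior] with x h1 h2 hx using ⟨fun j => h1 j hx, h2 hx⟩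
  filter_upwards [(ae_ball_iff (M.subFinset 0).countable_toSet).2 key, h𝓗.ae_sum_indicator 0,
    h.residual] with x hx hx2 hr hxΩ
  obtain ⟨K, hK, hxK, hsum⟩ := hx2 hxΩ
  obtain ⟨h1, h2⟩ := hx K hK hxK
  simp only [brokenLaplacian, brokenDeriv, hsum]
  rw [h2, Finset.sum_congr rfl fun j _ => h1 j]
  exact hr (hsub K hK hxK) k

theorem Adapted.restrict_Ωh_le (h𝓗 : M.Adapted 𝓗) (i : Fin 2) :
    volume.restrict (M.Ωh i) ≤ volume.restrict M.Ω := by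
  refine Measure.restrict_mono_ae ?_
  filter_upwards [h𝓗.ae_mem_interior i] with x hx hxi using M.interior_Ωh_subset_Ω i (hx hxi)

/-- The two assumptions on Γ cannot be taken from the local regularity, because Γ may run up to ∂Ω.
The residual, in contrast, is globally square integrable since it equals -f. -/
theorem Adapted.admissible_exact (h𝓗 : M.Adapted 𝓗) (h : RegularSolution M f u p H π)
    (hu_Γ : ∀ k, MemLp (M.avgNormalDeriv (fun _ => u) k) 2 M.surf)
    (hp_Γ : MemLp (M.avg (fun _ => p)) 2 M.surf) :
    Admissible M (fun _ => u) (fun _ => p) := by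
  have hsub : ∀ K ∈ M.subFinset 0, interior K ⊆ M.Ω := fun K hK =>
    (M.interior_mesh_subset (M.mem_subFinset.1 hK).1).trans (M.pre_subset 0)
  refine ⟨fun i k j => ?_, fun i => ?_, fun k => ?_, hu_Γ, hp_Γ, fun i k j => ?_,
    fun i k => ?_, fun i k j => ?_, fun i => ?_, fun K hK k j => ?_, fun K hK k => ?_, fun k => ?_⟩
  · exact ((h.memL2_grad k j).mono_measure (h𝓗.restrict_Ωh_le i)).ae_eq
      (ae_restrict_Ωh (h𝓗.D_exact_ae h i k j)).symm
  · exact h.memL2_p.mono_measure (Measure.restrict_mono (M.part_subset i) le_rfl)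
  · refine (MemLp.zero (ε := ℝ)).ae_eq ?_
    filter_upwards [h𝓗.jump_exact h k] with x hx using hx.symm
  · exact ((h.isWeakDeriv_u k j).mono (M.interior_Ωh_subset_Ω i)).isWeakDeriv_weakDeriv
  · filter_upwards [h𝓗.hasTrace_u h k] with x ⟨a, ha⟩ using ⟨a, ha i⟩
  · filter_upwards [h𝓗.hasTrace_D_exact h k j] with x hx using ⟨_, hx i⟩
  · filter_upwards [h𝓗.hasTrace_p h] with x ⟨a, ha⟩ using ⟨a, ha i⟩
  · exact ⟨_, _, (h.isWeakDeriv_u k j).mono (hsub K hK), (h.isWeakDeriv_grad k j j).mono (hsub K hK)⟩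
  · exact ⟨_, (h.isWeakDeriv_p k).mono (hsub K hK)⟩
  · refine ((h.memL2_f k).neg.mono_measure (h𝓗.restrict_Ωh_le 0)).ae_eq ?_
    exact (ae_restrict_Ωh (h𝓗.residual_exact h k)).symm

/-- Du and p have equal traces from both sides, so the one-sided traces in `normalStress` are the
averages that occur in the form. -/
theorem Adapted.normalStress_ae (h𝓗 : M.Adapted 𝓗) (h : RegularSolution M f u p H π) (k : Fin d) :
    M.normalStress u p k =ᵐ[M.surf] fun x =>
      M.avgNormalDeriv (fun _ => u) k x - M.n x k * M.avg (fun _ => p) x := by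
  filter_upwards [ae_all_iff.2 fun j => h𝓗.hasTrace_D_exact h k j, h𝓗.hasTrace_p h]
    with x hx ⟨a, ha⟩
  simp only [normalStress, avgNormalDeriv, avg, (hx _ _).trace_eq, (ha _).trace_eq,
    mul_comm (M.n x _)]
  ring

theorem setIntegral_Ω {F : E d → ℝ} (hF : Integrable F (volume.restrict M.Ω)) :
    ∫ x in M.Ω, F x = ∑ i, ∫ x in M.part i, F x := by
  have hu : M.part 0 ∪ M.part 1 = M.Ω := sdiff_union_of_subset (M.pre_subset 1)
  have hd : Disjoint (M.part 0) (M.part 1) := disjoint_sdiff_left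
  rw [Fin.sum_univ_two, ← setIntegral_union hd (M.measurableSet_part 1)
    (IntegrableOn.mono_set hF (M.part_subset 0)) (IntegrableOn.mono_set hF (M.part_subset 1)), hu]

theorem Adapted.integral_glue (h𝓗 : M.Adapted 𝓗) (hv : v ∈ S.Vh) (k : Fin d) {w : E d → ℝ}
    (hw : MemL2 M.Ω w) :
    ∫ x in M.Ω, M.glue v k x * w x = ∑ i, ∫ x in M.part i, v i x k * w x := by
  have hi : Integrable (fun x => M.glue v k x * w x) (volume.restrict M.Ω) :=
    ((h𝓗.piecewiseSmooth_glue hv k).memLp_restrict h𝓗.1 M.isBounded_Ω 2).integrable_mul hw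
  rw [setIntegral_Ω hi]
  refine Finset.sum_congr rfl fun i _ => setIntegral_congr_fun (M.measurableSet_part i) fun x hx => ?_
  simp only [glue_eq hx]

theorem Adapted.partialDeriv_glue (h𝓗 : M.Adapted 𝓗) (hv : v ∈ S.Vh) (i : Fin 2) (k j : Fin d) :
    ∀ᵐ x, x ∈ M.part i → partialDeriv j (M.glue v k) x = M.D i v k j x := by
  filter_upwards [h𝓗.ae_notMem_skel, h𝓗.D_V_ae hv i k j] with x hx hD hxi
  rw [hD (M.part_subset_Ωh i hxi)]
  have hn : M.part i ∈ 𝓝 x := by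
    fin_cases i
    · refine mem_of_superset ((M.isOpen_Ω.sdiff isClosed_closure).mem_nhds ⟨hxi.1, fun hc => ?_⟩)
        (sdiff_subset_sdiff_right subset_closure)
      exact hx (h𝓗.frontier_pre 1 (by rw [(M.isOpen_pre 1).frontier_eq]; exact ⟨hc, hxi.2⟩))
    · exact (M.isOpen_pre 1).mem_nhds hxi
  have he : M.glue v k =ᶠ[𝓝 x] fun y => v i y k := eventuallyEq_of_mem hn fun y hy => glue_eq hy
  rw [partialDeriv, partialDeriv, he.fderiv_eq]

theorem Adapted.integral_partialDeriv_glue (h𝓗 : M.Adapted 𝓗) (hv : v ∈ S.Vh) (k j : Fin d)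
    {w : E d → ℝ} (hw : MemL2 M.Ω w) :
    ∫ x in M.Ω, partialDeriv j (M.glue v k) x * w x
      = ∑ i, ∫ x in M.part i, M.D i v k j x * w x := by
  have hi : Integrable (fun x => partialDeriv j (M.glue v k) x * w x) (volume.restrict M.Ω) :=
    (((h𝓗.piecewiseSmooth_glue hv k).partialDeriv j).memLp_restrict h𝓗.1
      M.isBounded_Ω 2).integrable_mul hw
  rw [setIntegral_Ω hi]
  refine Finset.sum_congr rfl fun i _ => setIntegral_congr_ae (M.measurableSet_part i) ?_
  filter_upwards [h𝓗.partialDeriv_glue hv i k j] with x hx hxi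
  rw [hx hxi]

/-- All terms containing the jump of u, the overlap difference of Du or div u vanish, and the
residual identity turns d_h into the least-squares part of l_h. The surviving volume and interface
terms are exactly those of `Adapted.integral_green_V`, summed over the components. -/
theorem Adapted.consistency (h𝓗 : M.Adapted 𝓗) (h : RegularSolution M f u p H π)
    (hu_Γ : ∀ k, MemLp (M.avgNormalDeriv (fun _ => u) k) 2 M.surf)
    (hp_Γ : MemLp (M.avg (fun _ => p)) 2 M.surf) (hv : v ∈ S.Vh) (hq : q ∈ S.Qh) (t β : ℝ) :
    M.Ah t β (fun _ => u) (fun _ => p) v q = M.lh t f v q := by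
  have := h𝓗.isFiniteMeasure_surf
  have hA := h𝓗.admissible_exact h hu_Γ hp_Γ
  have hB := h𝓗.admissible_discrete hv hq
  have hpart : ∀ i, volume.restrict (M.part i) ≤ volume.restrict (M.Ωh i) := fun i =>
    Measure.restrict_mono (M.part_subset_Ωh i) le_rfl
  have hpΩ : ∀ i, volume.restrict (M.part i) ≤ volume.restrict M.Ω := fun i =>
    Measure.restrict_mono (M.part_subset i) le_rfl
  have hn : ∀ k, MemLp (fun x => M.n x k * M.avg (fun _ => p) x) 2 M.surf := fun k =>
    hp_Γ.mul (h𝓗.memLp_n k)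
  have hgreen := fun k => h𝓗.integral_green_V hv h k
    ((((hu_Γ k).sub (hn k)).integrable one_le_two).congr (h𝓗.normalStress_ae h k).symm)
  simp only [h𝓗.integral_partialDeriv_glue hv _ _ (h.memL2_grad _ _),
    h𝓗.integral_partialDeriv_glue hv _ _ h.memL2_p, h𝓗.integral_glue hv _ (h.memL2_f _)] at hgreen
  have hDL : ∀ i k j, MemLp (M.D i v k j) 2 (volume.restrict (M.part i)) := fun i k j =>
    (hB.memLp_D i k j).mono_measure (hpart i)
  -- the volume terms
  have e1 : ∀ i, ∫ x in M.part i, ∑ k, ∑ j, M.D i (fun _ => u) k j x * M.D i v k j x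
      = ∑ k, ∑ j, ∫ x in M.part i, M.D i v k j x * weakDeriv M.Ω j (fun y => u y k) x := fun i => by
    have hi : ∀ k j, Integrable (fun x => M.D i v k j x * weakDeriv M.Ω j (fun y => u y k) x)
        (volume.restrict (M.part i)) := fun k j =>
      (hDL i k j).integrable_mul ((h.memL2_grad k j).mono_measure (hpΩ i))
    simp only [← integral_finsetSum _ fun j _ => hi _ j]
    rw [← integral_finsetSum _ fun k _ => integrable_finsetSum _ fun j _ => hi k j]
    refine setIntegral_congr_ae (M.measurableSet_part i) ?_
    filter_upwards [ae_all_iff.2 fun k => ae_all_iff.2 fun j => h𝓗.D_exact_ae h i k j] with x hx hxi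
    refine Finset.sum_congr rfl fun k _ => Finset.sum_congr rfl fun j _ => ?_
    rw [hx k j (M.part_subset_Ωh i hxi), mul_comm]
  have e2 : ∀ i, ∫ x in M.part i, M.divergence i v x * p x
      = ∑ k, ∫ x in M.part i, M.D i v k k x * p x := fun i => by
    have hi : ∀ k, Integrable (fun x => M.D i v k k x * p x) (volume.restrict (M.part i)) :=
      fun k => (hDL i k k).integrable_mul (hA.memLp_P i)
    rw [← integral_finsetSum _ fun k _ => hi k]
    simp only [divergence, Finset.sum_mul]
  have e3 : ∀ i, ∫ x in M.part i, ∑ k, f x k * v i x k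
      = ∑ k, ∫ x in M.part i, v i x k * f x k := fun i => by
    have hi : ∀ k, Integrable (fun x => v i x k * f x k) (volume.restrict (M.part i)) := fun k =>
      ((h𝓗.piecewiseSmooth_V hv i k).memLp_restrict h𝓗.1
        (M.isBounded_Ω.subset (M.part_subset i)) 2).integrable_mul
          ((h.memL2_f k).mono_measure (hpΩ i))
    rw [← integral_finsetSum _ fun k _ => hi k]
    simp only [mul_comm]
  -- the interface terms
  have e4 : (∫ x, ∑ k, M.avgNormalDeriv (fun _ => u) k x * M.jump v k x ∂M.surf)
      - (∫ x, (∑ k, M.n x k * M.jump v k x) * M.avg (fun _ => p) x ∂M.surf)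
      = ∑ k, ∫ x, M.jump v k x * M.normalStress u p k x ∂M.surf := by
    have i1 : ∀ k, Integrable (fun x => M.jump v k x * M.avgNormalDeriv (fun _ => u) k x) M.surf :=
      fun k => (hB.memLp_jump k).integrable_mul (hu_Γ k)
    have i2 : ∀ k, Integrable (fun x => M.jump v k x * (M.n x k * M.avg (fun _ => p) x)) M.surf :=
      fun k => (hB.memLp_jump k).integrable_mul (hn k)
    have j1 : ∀ k, ∫ x, M.jump v k x * M.normalStress u p k x ∂M.surf
        = (∫ x, M.jump v k x * M.avgNormalDeriv (fun _ => u) k x ∂M.surf)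
          - ∫ x, M.jump v k x * (M.n x k * M.avg (fun _ => p) x) ∂M.surf := fun k => by
      rw [← integral_sub (i1 k) (i2 k)]
      refine integral_congr_ae ?_
      filter_upwards [h𝓗.normalStress_ae h k] with x hx
      rw [hx, mul_sub]
    rw [Finset.sum_congr rfl fun k _ => j1 k, Finset.sum_sub_distrib,
      ← integral_finsetSum _ fun k _ => i1 k, ← integral_finsetSum _ fun k _ => i2 k]
    congr 1
    · simp only [mul_comm]
    · congr 1 with x
      rw [Finset.sum_mul]
      exact Finset.sum_congr rfl fun k _ => by ring
  -- the terms that vanish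
  have z1 : ∫ x, ∑ k, M.jump (fun _ => u) k x * M.avgNormalDeriv v k x ∂M.surf = 0 := by
    refine integral_eq_zero_of_ae ?_
    filter_upwards [ae_all_iff.2 fun k => h𝓗.jump_exact h k] with x hx
    simp [hx]
  have z2 : ∫ x, ∑ k, M.jump (fun _ => u) k x * M.jump v k x ∂M.surf = 0 := by
    refine integral_eq_zero_of_ae ?_
    filter_upwards [ae_all_iff.2 fun k => h𝓗.jump_exact h k] with x hx
    simp [hx]
  have z3 : M.ahO (fun _ => u) v = 0 := by
    refine setIntegral_eq_zero_of_ae_eq_zero ?_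
    filter_upwards [ae_all_iff.2 fun k => ae_all_iff.2 fun j => h𝓗.D_exact_ae h 0 k j,
      ae_all_iff.2 fun k => ae_all_iff.2 fun j => h𝓗.D_exact_ae h 1 k j] with x h0 h1 hx
    refine Finset.sum_eq_zero fun k _ => Finset.sum_eq_zero fun j _ => ?_
    rw [h0 k j hx.1, h1 k j (M.part_subset_Ωh 1 hx.2), sub_self, zero_mul]
  have z4 : ∀ i, ∫ x in M.part i, M.divergence i (fun _ => u) x * q i x = 0 := fun i => by
    refine setIntegral_eq_zero_of_ae_eq_zero ?_
    filter_upwards [ae_all_iff.2 fun k => h𝓗.D_exact_ae h i k k, h.div_eq_zero] with x hx hd hxi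
    rw [divergence, Finset.sum_congr rfl fun k _ => hx k (M.part_subset_Ωh i hxi),
      hd (M.part_subset i hxi), zero_mul]
  have z5 : ∫ x, (∑ k, M.n x k * M.jump (fun _ => u) k x) * M.avg q x ∂M.surf = 0 := by
    refine integral_eq_zero_of_ae ?_
    filter_upwards [ae_all_iff.2 fun k => h𝓗.jump_exact h k] with x hx
    simp [hx]
  -- the least-squares term
  have e5 : ∫ x in M.Ωh 0 \ M.coreSet, ∑ k,
      (brokenLaplacian (M.mesh 0) (fun y => u y k) x - brokenDeriv (M.mesh 0) k p x) *
      (brokenLaplacian (M.mesh 0) (fun y => v 0 y k) x + brokenDeriv (M.mesh 0) k (q 0) x)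
      = - ∫ x in M.Ωh 0 \ M.coreSet, ∑ k, f x k *
      (brokenLaplacian (M.mesh 0) (fun y => v 0 y k) x + brokenDeriv (M.mesh 0) k (q 0) x) := by
    have hle : volume.restrict (M.Ωh 0 \ M.coreSet) ≤ volume.restrict (M.Ωh 0) :=
      Measure.restrict_mono sdiff_subset le_rfl
    rw [← integral_neg]
    refine integral_congr_ae ?_
    filter_upwards [ae_all_iff.2 fun k => ae_mono hle
      (ae_restrict_Ωh (h𝓗.residual_exact h k))] with x hx
    rw [← Finset.sum_neg_distrib]
    exact Finset.sum_congr rfl fun k _ => by rw [hx k, neg_mul]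
  have hG := Finset.sum_congr (rfl : (Finset.univ : Finset (Fin d)) = _) fun k _ => hgreen k
  rw [← e4] at hG
  simp only [Finset.sum_sub_distrib, Fin.sum_univ_two, Finset.sum_add_distrib] at hG
  simp only [Ah, ah, ahN, bh, dh, lh, Fin.sum_univ_two, e1, e2, e3, e5, z1, z2, z3, z4, z5]
  linarith

end CompositeMesh

end Consistency

end CutStokes

end

/-! ### Galerkin orthogonality from linearity and consistency. -/

theorem mainTheorem4 {d : ℕ} (hd : 2 ≤ d) (M : CutStokes.CompositeMesh d)
    (S : CutStokes.FESpaces M) (h β : ℝ) (hh : 0 < h) (hβ : 0 < β)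
    (f : CutStokes.E d → CutStokes.E d) (hf : MemLp f 2 (volume.restrict M.Ω))
    (u : CutStokes.E d → CutStokes.E d) (p : CutStokes.E d → ℝ)
    (hup : CutStokes.IsWeakStokesSolution M.Ω f u p)
    (hu_Γ : ∀ k, MemLp (M.avgNormalDeriv (fun _ => u) k) 2 M.surf)
    (hp_Γ : MemLp (M.avg (fun _ => p)) 2 M.surf)
    (uh : Fin 2 → CutStokes.E d → CutStokes.E d) (ph : Fin 2 → CutStokes.E d → ℝ)
    (hh_sol : CutStokes.IsDiscreteSolution S h β f uh ph) :
    ∀ v ∈ S.Vh, ∀ q ∈ S.Qh,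
      M.Ah h β (fun i x => u x - uh i x) (fun i x => p x - ph i x) v q = 0 := by
  intro v hv q hq
  obtain ⟨𝓗, h𝓗⟩ := M.exists_adapted
  obtain ⟨H, π, hreg⟩ := hup.exists_regularSolution hf
  have hV := h𝓗.admissible_discrete hv hq
  have e := h𝓗.Ah_sub (h𝓗.admissible_exact hreg hu_Γ hp_Γ)
    (h𝓗.admissible_discrete hh_sol.1 hh_sol.2.1) hV
    (fun k => (h𝓗.memLp_brokenLaplacian_V hv k).add (h𝓗.memLp_brokenDeriv_Q hq k)) h β
  rw [h𝓗.consistency hreg hu_Γ hp_Γ hv hq, hh_sol.2.2 v hv q hq, sub_self] at e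
  exact e
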